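/- Let $n\ge 1$, let $M\subseteq\mathbb P_n$ be an open subset of the complex projective space, and let $\mathbb P_n'$ be the dual space of hyperplanes. The manifold $\widetilde M$ of contact elements of $M$ is identified with $\{(m,h)\in M\times\mathbb P_n' : m\in h\}$ (the pair $(m,h)$ being the contact element $T_mh\subset T_m\mathbb P_n$); let $\pi:\widetilde M\to M$ be the projection, $\mathcal T$ the tautological bundle with fibre $T_mh$ at $(m,h)$, and $\omega:T\widetilde M\to\pi^{-1}(TM)/\mathcal T$ the tautological contact form. For a subvariety $W\subseteq\widetilde M$ of pure dimension $n$, let $W'$ be its regular part, $\Gamma_W$ the set of points of $W$ where $W$ is singular or $d\pi:TW'\to TM$ is not an isomorphism, and $M_0=M\setminus\pi(\Gamma_W)$. For $d\ge1$, $W$ is a *$d$-web* on $M$ if $\pi|_W$ is onto $M$; $\omega|_{W'}$ is integrable ($\eta\wedge d\eta=0$ on $W'$ for local representatives $\eta$ of $\omega$); $W\cap\pi^{-1}(M_0)\to M_0$ is a $d$-fold covering; $\dim\Gamma_W\le n-1$ or $\Gamma_W=\emptyset$; and every fibre of $W\to M$ is finite, with $d$ points counted with multiplicity. Near each point of $M_0$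 the sheets of $W$ define $d$ foliations of codimension one. A *leaf* of the web is an irreducible hypersurface $L$ (not necessarily closed) in $M$, not contained in the caustic $\pi(\Gamma_W)$, such that $L\cap M_0$ is locally a leaf of one of these foliations. The web is *linear* if every leaf is a piece (open subset) of a hyperplane. A $d$-web on $\mathbb P_n$ is *algebraic* if its leaves are the pieces of the hyperplanes belonging to some algebraic curve of degree $d$ in $\mathbb P_n'$ (each such hyperplane not contained in the caustic being a leaf). The web is *totally linearizable* if near every point of $M$ (not only of $M_0$) there are local holomorphic coordinates in which the leaves have an affine equation. It is *dicritical* if, for every irreducible component $C$ of $W$, with regular part $C'$, the foliation $\widetilde{\mathcal F}$ of $C'$ given by the holomorphic vector fields on $C'$ annihilated by $\omega$ is non-singular, i.e. near every point of $C'$ there are $n-1$ such fields that are linearly independent at every point. **Proposition.** Every linear web $W$ on an open subset $M$ of $\mathbb P_n$ is totally linearizable, and it is dicritical; moreover, for every irreducible component $C$ of $W$, the morphism $\mathcal T\to TW$ defined where $d\pi:TW'\to TM$ is an isomorphism (the inverse of $d\pi$ on $\mathcal T$) extends to an injective morphism $\mathcal T|_{C'}\to TC'$. In particular, every algebraic web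 on $\mathbb P_n$ is linear, and hence has all these properties. -/

import Mathlib

open Set Topology Filter
open scoped LinearAlgebra.Projectivization

namespace ProjWeb

/-! ### Local analytic geometry in a complex normed space -/

section Local

variable {E : Type*} [NormedAddCommGroup E] [NormedSpace ℂ E]

/-- Near `z`, the set `A` is the common zero set of finitely many holomorphic functions. -/
def IsAnalyticSetAt (A : Set E) (z : E) : Prop :=
  ∃ (c : ℕ) (f : E → (Fin c → ℂ)), AnalyticAt ℂ f z ∧ ∀ᶠ y in 𝓝 z, (y ∈ A ↔ f y = 0)

/-- `z ∈ A`, and near `z` the set `A` is a complex submanifold of dimension `k`: it is cut out by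
`dim E - k` holomorphic functions with independent differentials. -/
def IsSubmanifoldAt (A : Set E) (k : ℕ) (z : E) : Prop :=
  z ∈ A ∧ ∃ c : ℕ, k + c = Module.finrank ℂ E ∧ ∃ f : E → (Fin c → ℂ),
    AnalyticAt ℂ f z ∧ Function.Surjective (fderiv ℂ f z) ∧ ∀ᶠ y in 𝓝 z, (y ∈ A ↔ f y = 0)

/-- `z` is a regular point of `A`. -/
def IsRegularAt (A : Set E) (z : E) : Prop := ∃ k, IsSubmanifoldAt A k z

/-- Pure dimension `k`: the points near which `A` is a `k`-dimensional manifold are dense. -/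
def HasPureDim (A : Set E) (k : ℕ) : Prop := A ⊆ closure {z | IsSubmanifoldAt A k z}

/-- The dimension of `A` (the largest dimension of `A` at its regular points) is at most `k`;
the empty set is allowed. -/
def DimLE (A : Set E) (k : ℕ) : Prop := ∀ (j : ℕ) (z : E), IsSubmanifoldAt A j z → j ≤ k

/-- The tangent space of `A` at `z`: the vectors killed by the differentials at `z` of all
germs of holomorphic functions vanishing on `A`. -/
def tangentSpaceAt (A : Set E) (z : E) : Submodule ℂ E where
  carrier := {v | ∀ g : E → ℂ, AnalyticAt ℂ g z → (∀ᶠ y in 𝓝 z, y ∈ A → g y = 0) →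
    fderiv ℂ g z v = 0}
  add_mem' := by
    intro a b ha hb g hg h0
    rw [map_add, ha g hg h0, hb g hg h0, add_zero]
  zero_mem' := by
    intro g _ _
    exact map_zero _
  smul_mem' := by
    intro c a ha g hg h0
    rw [map_smul, ha g hg h0, smul_zero]

end Local

/-! ### Projective space, homogeneous coordinates, contact elements -/

/-- Vectors of homogeneous coordinates `(X₀, …, Xₙ)`. -/
abbrev HVec (n : ℕ) : Type := Fin (n + 1) → ℂ

/-- The complex projective space of dimension `n`. -/
abbrev P (n : ℕ) : Type := ℙ ℂ (HVec n)

/-- The dual projective space: `[u₀, …, uₙ]` is the hyperplane `u₀ X₀ + ⋯ + uₙ Xₙ = 0`. -/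
abbrev PDual (n : ℕ) : Type := ℙ ℂ (HVec n)

/-- The quotient topology on projective space. -/
noncomputable instance instTopologicalSpaceP (n : ℕ) : TopologicalSpace (ℙ ℂ (HVec n)) :=
  TopologicalSpace.coinduced
    (fun v : {v : HVec n // v ≠ 0} => Projectivization.mk ℂ v.1 v.2) inferInstance

/-- The hyperplane `h`, as a subset of projective space. -/
def hyperplane {n : ℕ} (h : PDual n) : Set (P n) := {m | Projectivization.orthogonal m h}

/-- The hyperplane `h`, as a linear hyperplane of `ℂⁿ⁺¹`. -/
noncomputable def hyperplaneLin {n : ℕ} (h : PDual n) : Submodule ℂ (HVec n) where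
  carrier := {Y | h.rep ⬝ᵥ Y = 0}
  add_mem' := by
    intro a b ha hb
    simp only [mem_ofPred_eq] at ha hb ⊢
    rw [dotProduct_add, ha, hb, add_zero]
  zero_mem' := dotProduct_zero _
  smul_mem' := by
    intro c a ha
    simp only [mem_ofPred_eq] at ha ⊢
    rw [dotProduct_smul, ha, smul_zero]

/-- The manifold of contact elements of `M ⊆ ℙₙ`: the contact element `T_m h ⊆ T_m ℙₙ` is
identified with the pair `(m, h)`, where `h` is a hyperplane through `m`. The projection `π` to
`M` is `Prod.fst`. -/
def contactElements {n : ℕ} (M : Set (P n)) : Set (P n × PDual n) :=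
  {w | w.1 ∈ M ∧ w.1 ∈ hyperplane w.2}

/-- The set of all homogeneous coordinates of the points of `A ⊆ ℙₙ`. It is a bundle over `A`
with fibre `ℂ*`, so `A` is analytic, or a submanifold of dimension `k`, exactly if the cone is
analytic, resp. a submanifold of dimension `k + 1`. -/
def cone {n : ℕ} (A : Set (P n)) : Set (HVec n) :=
  {X | ∃ hX : X ≠ 0, Projectivization.mk ℂ X hX ∈ A}

/-- The set of all pairs of homogeneous coordinates `(X, u)` of the points of `A ⊆ ℙₙ × ℙₙ'`.
It is a bundle over `A` with fibre `ℂ* × ℂ*`, so `A` is analytic, or a submanifold of dimension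
`k`, exactly if the bicone is analytic, resp. a submanifold of dimension `k + 2`. -/
def bicone {n : ℕ} (A : Set (P n × PDual n)) : Set (HVec n × HVec n) :=
  {z | ∃ (h₁ : z.1 ≠ 0) (h₂ : z.2 ≠ 0),
    (Projectivization.mk ℂ z.1 h₁, Projectivization.mk ℂ z.2 h₂) ∈ A}

/-- A choice of homogeneous coordinates of a pair `(m, h)`. -/
noncomputable def rep₂ {n : ℕ} (w : P n × PDual n) : HVec n × HVec n := (w.1.rep, w.2.rep)

/-- The tautological contact form in homogeneous coordinates: `θ = ∑ uᵢ dXᵢ` at `z = (X, u)`,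
applied to the tangent vector `v`. On the chart `X = (1, x)`,
`u = (xₙ - ∑ p_α x_α, p, -1)` it is, up to sign, `dxₙ - ∑ p_α dx_α`. -/
def contactForm {n : ℕ} (z v : HVec n × HVec n) : ℂ := z.2 ⬝ᵥ v.1

/-- The exterior derivative `dθ = ∑ duᵢ ∧ dXᵢ`, applied to the tangent vectors `v, w`. -/
def contactFormDeriv {n : ℕ} (v w : HVec n × HVec n) : ℂ := v.2 ⬝ᵥ w.1 - w.2 ⬝ᵥ v.1

/-! ### Webs of codimension one on an open subset of projective space -/

section Webs

variable {n : ℕ}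

/-- The regular part `W'` of `W`. -/
def regularPart (W : Set (P n × PDual n)) : Set (P n × PDual n) :=
  {w | w ∈ W ∧ IsRegularAt (bicone W) (rep₂ w)}

/-- At the regular point `w` of `W`, the differential `dπ : T_w W' → T_{π(w)} ℙₙ` is injective.
A tangent vector `v` of the bicone at `(X, u)` represents a vector in the kernel of `dπ` if
`v.1 ∈ ℂ X`, and it represents zero if, moreover, `v.2 ∈ ℂ u`. -/
def ProjectionImmersiveAt (W : Set (P n × PDual n)) (w : P n × PDual n) : Prop :=
  ∀ v ∈ tangentSpaceAt (bicone W) (rep₂ w),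
    v.1 ∈ Submodule.span ℂ {w.1.rep} → v.2 ∈ Submodule.span ℂ {w.2.rep}

/-- The critical set `Γ_W`: the points where `W` is singular or where `dπ : T W' → T M` is not
an isomorphism (for `W` of pure dimension `n`, this means: not injective). -/
def criticalSet (W : Set (P n × PDual n)) : Set (P n × PDual n) :=
  {w | w ∈ W ∧ ¬ (w ∈ regularPart W ∧ ProjectionImmersiveAt W w)}

/-- The regular part `M₀` of the web: the complement in `M` of the caustic `π(Γ_W)`. -/
def regularBase (M : Set (P n)) (W : Set (P n × PDual n)) : Set (P n) :=
  M \ (Prod.fst '' criticalSet W)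

/-- The fibre of `W` over `m`. -/
def fibre (W : Set (P n × PDual n)) (m : P n) : Set (PDual n) := {h | (m, h) ∈ W}

/-- The point `h` of the fibre of `W` over `m` has multiplicity `k`: exactly `k` of the sheets of
`W` over the regular part of the web come together there. -/
def HasMultiplicity (M : Set (P n)) (W : Set (P n × PDual n)) (m : P n) (h : PDual n) (k : ℕ) :
    Prop :=
  ∀ N ∈ 𝓝 h, ∃ N' ∈ 𝓝 h, N' ⊆ N ∧ ∃ U ∈ 𝓝 m, ∀ m' ∈ U ∩ regularBase M W,
    (fibre W m' ∩ N').ncard = k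

/-- `W` is a `d`-web of codimension one on the open set `M ⊆ ℙₙ`. -/
structure IsWeb (M : Set (P n)) (W : Set (P n × PDual n)) (d : ℕ) : Prop where
  weight_pos : 1 ≤ d
  /-- `W` is a subvariety of the manifold of contact elements ... -/
  subset : W ⊆ contactElements M
  analytic : ∀ z ∈ bicone (contactElements M), IsAnalyticSetAt (bicone W) z
  /-- ... of pure dimension `n`. -/
  pureDim : HasPureDim (bicone W) (n + 2)
  surjective : ∀ m ∈ M, (fibre W m).Nonempty
  /-- Integrability, `θ ∧ dθ = 0` on the regular part. -/
  integrable : ∀ w ∈ regularPart W, ∀ a ∈ tangentSpaceAt (bicone W) (rep₂ w),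
    ∀ b ∈ tangentSpaceAt (bicone W) (rep₂ w), ∀ c ∈ tangentSpaceAt (bicone W) (rep₂ w),
      contactForm (rep₂ w) a * contactFormDeriv b c
        + contactForm (rep₂ w) b * contactFormDeriv c a
        + contactForm (rep₂ w) c * contactFormDeriv a b = 0
  /-- Over `M₀`, the projection is a `d`-fold covering. -/
  covering : IsCoveringMapOn (fun w : W => (w : P n × PDual n).1) (regularBase M W)
  sheets : ∀ m ∈ regularBase M W, (fibre W m).ncard = d
  /-- The critical set has dimension at most `n - 1`, or is empty. -/
  critical_dim : DimLE (bicone (criticalSet W)) (n + 1)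
  /-- Every fibre is finite and has `d` points, counted with multiplicity. -/
  fibre_finite : ∀ m ∈ M, (fibre W m).Finite
  fibre_degree : ∀ m ∈ M, ∃ μ : PDual n → ℕ,
    (∀ h ∈ fibre W m, 0 < μ h ∧ HasMultiplicity M W m h (μ h)) ∧ ∑ᶠ h ∈ fibre W m, μ h = d

/-- `L` is an irreducible complex hypersurface of some open subset of `ℙₙ` (an analytic set of
pure dimension `n - 1` whose regular part is connected). -/
structure IsIrreducibleHypersurface (L : Set (P n)) : Prop where
  analytic : ∀ X ∈ cone L, IsAnalyticSetAt (cone L) X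
  pureDim : HasPureDim (cone L) n
  irreducible : IsConnected {m | m ∈ L ∧ IsSubmanifoldAt (cone L) n m.rep}

/-- `L` is a leaf of the web: an irreducible hypersurface in `M`, not contained in the caustic,
which near each of its points in `M₀` is an integral hypersurface of one of the local foliations
of the web, that is, of one of the foliations whose tangent hyperplanes are given by
a local section `σ` of `W` over `M₀`. -/
structure IsLeaf (M : Set (P n)) (W : Set (P n × PDual n)) (L : Set (P n)) : Prop where
  subset : L ⊆ M
  hypersurface : IsIrreducibleHypersurface L
  meets_regular : (L ∩ regularBase M W).Nonempty
  integral : ∀ m ∈ L ∩ regularBase M W, ∃ U ∈ 𝓝 m, ∃ σ : P n → PDual n, ContinuousOn σ U ∧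
    (∀ m' ∈ U, (m', σ m') ∈ W) ∧
    ∀ m' ∈ L ∩ U, IsSubmanifoldAt (cone L) n m'.rep ∧
      tangentSpaceAt (cone L) m'.rep = hyperplaneLin (σ m')

/-- `L` is a piece of the hyperplane `h`, i.e. a relatively open subset of it. -/
def IsPieceOf (L : Set (P n)) (h : PDual n) : Prop :=
  ∃ O : Set (P n), IsOpen O ∧ L = O ∩ hyperplane h

/-- A linear web: all leaves are pieces of hyperplanes. -/
def IsLinear (M : Set (P n)) (W : Set (P n × PDual n)) : Prop :=
  ∀ L, IsLeaf M W L → ∃ h : PDual n, IsPieceOf L h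

/-- `S` is an algebraic curve of degree `d` in the dual projective space: the zero set of a family
of homogeneous polynomials, of pure dimension one, such that a generic hyperplane of the dual
space (the set of all `h` through a generic point of `ℙₙ`) meets it in `d` points. -/
structure IsAlgebraicCurve (S : Set (PDual n)) (d : ℕ) : Prop where
  algebraic : ∃ I : Set (MvPolynomial (Fin (n + 1)) ℂ), (∀ p ∈ I, ∃ k, p.IsHomogeneous k) ∧
    cone S = {u | u ≠ 0 ∧ ∀ p ∈ I, MvPolynomial.eval u p = 0}
  pureDim : HasPureDim (cone S) 2
  degree : ∃ G : MvPolynomial (Fin (n + 1)) ℂ, G ≠ 0 ∧ ∀ (X : HVec n) (hX : X ≠ 0),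
    MvPolynomial.eval X G ≠ 0 → {h | h ∈ S ∧ Projectivization.mk ℂ X hX ∈ hyperplane h}.ncard = d

/-- `W` (a `d`-web on all of `ℙₙ`) is algebraic: its leaves are the hyperplanes belonging to some
algebraic curve of degree `d` in the dual space. As the leaves are not assumed to be maximal, this
says that every leaf is a piece of such a hyperplane and that every such hyperplane which is not
contained in the caustic is a leaf. -/
def IsAlgebraicWeb (W : Set (P n × PDual n)) (d : ℕ) : Prop :=
  ∃ S : Set (PDual n), IsAlgebraicCurve S d ∧
    (∀ L, IsLeaf univ W L → ∃ h ∈ S, IsPieceOf L h) ∧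
    ∀ h ∈ S, (hyperplane h ∩ regularBase univ W).Nonempty → IsLeaf univ W (hyperplane h)

/-! ### Linearizability and dicriticity -/

/-- `x` is a system of local holomorphic coordinates on the open set `x.source` of `ℙₙ`: as
a function of the homogeneous coordinates it is holomorphic, and its inverse lifts locally to
a holomorphic map into the homogeneous coordinates. -/
def IsHolomorphicChart (x : OpenPartialHomeomorph (P n) (Fin n → ℂ)) : Prop :=
  (∀ X ∈ cone x.source, ∃ F : HVec n → (Fin n → ℂ), AnalyticAt ℂ F X ∧
    ∀ᶠ Y in 𝓝 X, ∀ hY : Y ≠ 0, x (Projectivization.mk ℂ Y hY) = F Y) ∧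
  ∀ y ∈ x.target, ∃ s : (Fin n → ℂ) → HVec n, AnalyticAt ℂ s y ∧
    ∀ᶠ t in 𝓝 y, ∃ hs : s t ≠ 0, x.symm t = Projectivization.mk ℂ (s t) hs

/-- `L` has an affine equation in the coordinates `x`: it is an open piece of
`{a₁ x₁ + ⋯ + aₙ xₙ = b}` with `a ≠ 0`. -/
def HasAffineEquation (x : OpenPartialHomeomorph (P n) (Fin n → ℂ)) (L : Set (P n)) : Prop :=
  ∃ (a : Fin n → ℂ) (b : ℂ), a ≠ 0 ∧ ∃ O : Set (P n), IsOpen O ∧ O ⊆ x.source ∧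
    L = {m | m ∈ O ∧ a ⬝ᵥ x m = b}

/-- A totally linearizable web: near every point of `M` (not only of `M₀`) there are local
holomorphic coordinates in which the leaves of the web have an affine equation. -/
def IsTotallyLinearizable (M : Set (P n)) (W : Set (P n × PDual n)) : Prop :=
  ∀ m ∈ M, ∃ x : OpenPartialHomeomorph (P n) (Fin n → ℂ), IsHolomorphicChart x ∧
    m ∈ x.source ∧ x.source ⊆ M ∧
    ∀ L, IsLeaf M W L → L ⊆ x.source → HasAffineEquation x L

/-- `C` is an irreducible component of `W`: the closure in `W` of a connected component of the
regular part of `W`. -/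
def IsComponent (W C : Set (P n × PDual n)) : Prop :=
  ∃ w ∈ regularPart W, C = W ∩ closure (connectedComponentIn (regularPart W) w)

/-- The restriction to the regular part `C'` of `C` of the foliation given by the holomorphic
vector fields annihilated by the contact form is non-singular: near each point of `C'`, there are
`n - 1` such fields which are linearly independent at every point. On the bicone of `C`, where the
two scalings give two more fields of this kind, their number is `n + 1`. -/
def FoliationNonsingular (C : Set (P n × PDual n)) : Prop :=
  ∀ w ∈ regularPart C, ∃ Y : Fin (n + 1) → HVec n × HVec n → HVec n × HVec n,
    (∀ i, AnalyticAt ℂ (Y i) (rep₂ w)) ∧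
    ∀ᶠ z in 𝓝 (rep₂ w), z ∈ bicone C →
      (∀ i, Y i z ∈ tangentSpaceAt (bicone C) z ∧ contactForm z (Y i z) = 0) ∧
      LinearIndependent ℂ (fun i => Y i z)

/-- The web is dicritical: the foliation is non-singular on each irreducible component. -/
def IsDicritical (W : Set (P n × PDual n)) : Prop :=
  ∀ C, IsComponent W C → FoliationNonsingular C

/-- The tautological bundle `𝒯`, with fibre `T_m h` at `(m, h)`, lifts to the tangent bundle of the
regular part `C'` of `C`: near each point of `C'` there are `n - 1` holomorphic vector fields on
`C'` which `dπ` maps to a frame of `𝒯`. On the bicone their number is `n`, as `T_m h` becomes the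
`n`-dimensional space of all `Ẋ` with `∑ uᵢ Ẋᵢ = 0`. -/
def TautologicalLifts (C : Set (P n × PDual n)) : Prop :=
  ∀ w ∈ regularPart C, ∃ Y : Fin n → HVec n × HVec n → HVec n × HVec n,
    (∀ i, AnalyticAt ℂ (Y i) (rep₂ w)) ∧
    ∀ᶠ z in 𝓝 (rep₂ w), z ∈ bicone C →
      (∀ i, Y i z ∈ tangentSpaceAt (bicone C) z ∧ contactForm z (Y i z) = 0) ∧
      LinearIndependent ℂ (fun i => (Y i z).1)

/-- The injective morphism `𝒯 → T W` over the unramified part of `W`, inverse to `dπ`, extends to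
an injective morphism `𝒯 → T C'` on the regular part of each irreducible component `C`. -/
def TautologicalExtends (W : Set (P n × PDual n)) : Prop :=
  ∀ C, IsComponent W C → TautologicalLifts C

end Webs

end ProjWeb

/-! Total linearizability is immediate: leaves are pieces of hyperplanes, and these have affine
equations in the affine charts of projective space, at points of the caustic as elsewhere
(`IsLinear.isTotallyLinearizable`). Algebraic webs are linear by definition. The work lies in
lifting the tautological bundle, and dicriticity comes with the lift.

Over the regular base the web is locally the graph of a section `σ`, and integrability reads `σ ∧ dσ
= 0`. Frobenius' theorem gives a leaf through each point `(m, h)` of the web, tangent to `h` at `m`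
(`IsWeb.exists_leaf`). If the web is linear, this leaf is an open piece of `h`; its contact elements
lie in `W` and all equal `h`. So moving `m` inside the fixed hyperplane `h` stays in `W`: in
homogeneous coordinates, `(Y, 0)` is tangent to the bicone at `(X, u)` whenever `u ⬝ᵥ Y = 0`
(`IsWeb.mem_tangentSpaceAt_of_isLinear`). At regular points of a component, given locally by `f =
0`, tangency is the closed condition that `df` kills the vector. It passes from the dense part over
the regular base to all regular points, ramified or not
(`IsWeb.eventually_mem_tangentSpaceAt_component`). A frame of the vectors annihilated by `u` then
lifts explicitly.

Two classical ingredients are built from scratch. The density of the part over the regular base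
rests on the openness of `W → M`. Near an isolated point of a fibre, elimination describes the image
of `W` by an equation `g = 0`; unramified points are dense for dimension reasons and give this image
interior points, so `g = 0` identically and the image is a neighbourhood
(`image_mem_nhds_of_isolated`). Near a base point with the largest possible number of preimages, the
sheets are then moved off the critical set one at a time (`IsWeb.exists_mem_regularBase`).
Frobenius' theorem (`exists_solution_of_integrable`) is proved by integrating along rays from the
origin, holomorphic dependence coming from the implicit function theorem in a space of continuous
functions. -/

namespace ProjWeb

/-! ### Projective space through homogeneous coordinates -/

section Proj

variable {n : ℕ}

open Classical in
/-- The point with homogeneous coordinates `X`, with a junk value at `X = 0`. -/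
noncomputable def proj (X : HVec n) : P n :=
  if h : X ≠ 0 then Projectivization.mk ℂ X h
  else Projectivization.mk ℂ (fun _ => 1) (fun h => one_ne_zero (congrFun h 0))

/-- The pair of points with homogeneous coordinates `(X, u)`. -/
noncomputable def proj₂ (z : HVec n × HVec n) : P n × PDual n := (proj z.1, proj z.2)

lemma proj_of_ne {X : HVec n} (h : X ≠ 0) : proj X = Projectivization.mk ℂ X h := by
  simp [proj, h]

@[simp] lemma proj_rep (m : P n) : proj m.rep = m := by
  rw [proj_of_ne m.rep_nonzero, Projectivization.mk_rep]

@[simp] lemma proj₂_rep₂ (w : P n × PDual n) : proj₂ (rep₂ w) = w := by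
  simp [proj₂, rep₂]

lemma proj_smul {a : ℂ} (ha : a ≠ 0) (X : HVec n) : proj (a • X) = proj X := by
  by_cases h : X = 0
  · simp [h]
  · rw [proj_of_ne h, proj_of_ne (smul_ne_zero ha h), Projectivization.mk_eq_mk_iff']
    exact ⟨a, rfl⟩

lemma exists_smul_of_proj_eq {X Y : HVec n} (hX : X ≠ 0) (hY : Y ≠ 0) (h : proj X = proj Y) :
    ∃ a : ℂ, a ≠ 0 ∧ X = a • Y := by
  rw [proj_of_ne hX, proj_of_ne hY, Projectivization.mk_eq_mk_iff'] at h
  obtain ⟨a, rfl⟩ := h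
  exact ⟨a, fun h => hX (by simp [h]), rfl⟩

lemma mem_cone {A : Set (P n)} {X : HVec n} : X ∈ cone A ↔ X ≠ 0 ∧ proj X ∈ A := by
  constructor
  · rintro ⟨h, hA⟩
    exact ⟨h, by rwa [proj_of_ne h]⟩
  · rintro ⟨h, hA⟩
    exact ⟨h, by rwa [proj_of_ne h] at hA⟩

lemma mem_bicone {A : Set (P n × PDual n)} {z : HVec n × HVec n} :
    z ∈ bicone A ↔ z.1 ≠ 0 ∧ z.2 ≠ 0 ∧ proj₂ z ∈ A := by
  constructor
  · rintro ⟨h, h', hA⟩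
    exact ⟨h, h', by rwa [proj₂, proj_of_ne h, proj_of_ne h']⟩
  · rintro ⟨h, h', hA⟩
    exact ⟨h, h', by rwa [proj₂, proj_of_ne h, proj_of_ne h'] at hA⟩

lemma rep_mem_cone {A : Set (P n)} {m : P n} : m.rep ∈ cone A ↔ m ∈ A := by
  simp [mem_cone, m.rep_nonzero]

lemma rep₂_mem_bicone {A : Set (P n × PDual n)} {w : P n × PDual n} :
    rep₂ w ∈ bicone A ↔ w ∈ A := by
  simp [mem_bicone, rep₂, proj₂, Projectivization.rep_nonzero]

lemma smul_mem_bicone {A : Set (P n × PDual n)} {a b : ℂ} (ha : a ≠ 0) (hb : b ≠ 0)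
    {z : HVec n × HVec n} : (a • z.1, b • z.2) ∈ bicone A ↔ z ∈ bicone A := by
  simp [mem_bicone, proj₂, proj_smul ha, proj_smul hb, ha, hb]

lemma mem_hyperplane {X u : HVec n} (hX : X ≠ 0) (hu : u ≠ 0) :
    proj X ∈ hyperplane (proj u) ↔ u ⬝ᵥ X = 0 := by
  rw [proj_of_ne hX, proj_of_ne hu, hyperplane, mem_ofPred_eq, Projectivization.orthogonal_mk,
    dotProduct_comm]

lemma mem_hyperplaneLin {u : HVec n} (hu : u ≠ 0) {Y : HVec n} :
    Y ∈ hyperplaneLin (proj u) ↔ u ⬝ᵥ Y = 0 := by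
  change (proj u).rep ⬝ᵥ Y = 0 ↔ _
  obtain ⟨a, ha, h⟩ := exists_smul_of_proj_eq (proj u).rep_nonzero hu (proj_rep _)
  rw [h, smul_dotProduct, smul_eq_zero, or_iff_right ha]

/-- The nonzero vectors form an open subset, so the quotient topology can be tested in `HVec n`
itself. -/
lemma isOpen_iff_isOpen_cone {U : Set (P n)} : IsOpen U ↔ IsOpen (cone U) := by
  rw [isOpen_coinduced]
  have h0 : IsOpen {v : HVec n | v ≠ 0} := isOpen_ne
  rw [h0.isOpenEmbedding_subtypeVal.isOpen_iff_image_isOpen]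
  have : Subtype.val '' ((fun v : {v : HVec n // v ≠ 0} => Projectivization.mk ℂ v.1 v.2) ⁻¹' U)
      = cone U := by
    ext X
    simp [cone]
  exact Eq.to_iff (congrArg IsOpen this)

lemma cone_proj_image {O : Set (HVec n)} :
    cone (proj '' (O \ {0})) = ⋃ a : {a : ℂ // a ≠ 0}, {X | a.1 • X ∈ O \ {0}} := by
  ext X
  simp only [mem_cone, mem_image, mem_iUnion, mem_ofPred_eq]
  constructor
  · rintro ⟨hX, Y, hY, h⟩
    obtain ⟨a, ha, rfl⟩ := exists_smul_of_proj_eq hY.2 hX h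
    exact ⟨⟨a, ha⟩, hY⟩
  · rintro ⟨⟨a, ha⟩, h⟩
    refine ⟨fun h0 => h.2 (by simp [h0]), a • X, h, proj_smul ha X⟩

lemma isOpen_proj_image {O : Set (HVec n)} (hO : IsOpen O) : IsOpen (proj '' (O \ {0})) := by
  rw [isOpen_iff_isOpen_cone, cone_proj_image]
  refine isOpen_iUnion fun a => ?_
  exact (hO.sdiff isClosed_singleton).preimage (continuous_const_smul a.1)

/-- Away from zero, `proj` is continuous and open: the saturation of an open set under scaling is a
union of open sets. Through this equality all local statements are moved to homogeneous coordinates.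
-/
lemma nhds_proj {X : HVec n} (hX : X ≠ 0) : 𝓝 (proj X) = map proj (𝓝 X) := by
  apply le_antisymm
  · intro U hU
    rw [mem_map] at hU
    obtain ⟨O, hO, hOo, hXO⟩ := mem_nhds_iff.1 hU
    refine mem_nhds_iff.2 ⟨proj '' (O \ {0}), ?_, isOpen_proj_image hOo, ⟨X, ⟨hXO, hX⟩, rfl⟩⟩
    rintro _ ⟨Y, hY, rfl⟩
    exact hO hY.1
  · intro U hU
    obtain ⟨V, hV, hVo, hXV⟩ := mem_nhds_iff.1 hU
    rw [mem_map]
    filter_upwards [(isOpen_iff_isOpen_cone.1 hVo).mem_nhds (mem_cone.2 ⟨hX, hXV⟩)] with Y hY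
    exact hV (mem_cone.1 hY).2

lemma nhds_proj₂ {z : HVec n × HVec n} (h₁ : z.1 ≠ 0) (h₂ : z.2 ≠ 0) :
    𝓝 (proj₂ z) = map proj₂ (𝓝 z) := by
  rw [proj₂, nhds_prod_eq, nhds_proj h₁, nhds_proj h₂, Filter.prod_map_map_eq, ← nhds_prod_eq]
  rfl

lemma continuousAt_proj {X : HVec n} (hX : X ≠ 0) : ContinuousAt proj X :=
  (nhds_proj hX).ge

lemma continuousAt_proj₂ {z : HVec n × HVec n} (h₁ : z.1 ≠ 0) (h₂ : z.2 ≠ 0) :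
    ContinuousAt proj₂ z := (nhds_proj₂ h₁ h₂).ge

lemma nhds_eq_map_rep (m : P n) : 𝓝 m = map proj (𝓝 m.rep) := by
  rw [← nhds_proj m.rep_nonzero, proj_rep]

lemma nhds_eq_map_rep₂ (w : P n × PDual n) : 𝓝 w = map proj₂ (𝓝 (rep₂ w)) := by
  rw [← nhds_proj₂ w.1.rep_nonzero w.2.rep_nonzero, proj₂_rep₂]

lemma eventually_ne_ne {z : HVec n × HVec n} (h₁ : z.1 ≠ 0) (h₂ : z.2 ≠ 0) :
    ∀ᶠ y in 𝓝 z, y.1 ≠ 0 ∧ y.2 ≠ 0 :=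
  (continuous_fst.continuousAt.eventually_ne h₁).and (continuous_snd.continuousAt.eventually_ne h₂)

lemma exists_rep_smul {X : HVec n} (hX : X ≠ 0) : ∃ a : ℂ, a ≠ 0 ∧ (proj X).rep = a • X :=
  exists_smul_of_proj_eq (proj X).rep_nonzero hX (proj_rep _)

end Proj

/-! ### Complex submanifolds and their tangent spaces -/

section Submanifold

variable {E : Type*} [NormedAddCommGroup E] [NormedSpace ℂ E]
  {F : Type*} [NormedAddCommGroup F] [NormedSpace ℂ F] [FiniteDimensional ℂ F]

/-- With a right inverse `R` of `L₀`, the endomorphism `L ∘ R` of the finite-dimensional `F` is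
injective for `L` near `L₀`, hence surjective. -/
lemma isOpen_setOf_surjective : IsOpen {L : E →L[ℂ] F | Function.Surjective L} := by
  rw [isOpen_iff_eventually]
  intro L₀ hL₀
  obtain ⟨R, hR⟩ := L₀.toLinearMap.exists_rightInverse_of_surjective
    (LinearMap.range_eq_top.2 hL₀)
  let R' : F →L[ℂ] E := R.toContinuousLinearMap
  have hc : Continuous fun L : E →L[ℂ] F => L.comp R' := by fun_prop
  have h0 : Function.Injective (L₀.comp R') := by
    intro a b hab
    have h1 := LinearMap.congr_fun hR a
    have h2 := LinearMap.congr_fun hR b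
    exact h1.symm.trans (Eq.trans hab h2)
  filter_upwards [hc.continuousAt.eventually (ContinuousLinearMap.isOpen_injective.mem_nhds h0)]
    with L hL
  have : Function.Surjective (L.comp R') :=
    (LinearMap.injective_iff_surjective (f := (L.comp R').toLinearMap)).1 hL
  exact Function.Surjective.of_comp this

lemma eventually_surjective_fderiv {f : E → F} {z : E} (hf : AnalyticAt ℂ f z)
    (hs : Function.Surjective (fderiv ℂ f z)) :
    ∀ᶠ y in 𝓝 z, AnalyticAt ℂ f y ∧ Function.Surjective (fderiv ℂ f y) :=
  hf.eventually_analyticAt.and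
    (hf.fderiv.continuousAt.eventually (isOpen_setOf_surjective.mem_nhds hs))

/-- The components of `f` are among the germs vanishing on `A`, which gives one inclusion. For the
other, any such germ vanishes along the implicit-function parametrization `ψ` of the zero set, whose
derivative at `0` is the inclusion of the kernel. -/
lemma tangentSpaceAt_eq_ker [FiniteDimensional ℂ E] {A : Set E} {z : E} (hz : z ∈ A) {c : ℕ} {f : E → (Fin c → ℂ)}
    (hf : AnalyticAt ℂ f z) (hs : Function.Surjective (fderiv ℂ f z))
    (hA : ∀ᶠ y in 𝓝 z, (y ∈ A ↔ f y = 0)) :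
    tangentSpaceAt A z = (fderiv ℂ f z).ker := by
  have hf0 : f z = 0 := (hA.self_of_nhds).1 hz
  ext v
  constructor
  · intro hv
    rw [LinearMap.mem_ker]
    ext i
    have h := hv (fun y => f y i) ((analyticAt_pi_iff.1 hf) i)
      (by filter_upwards [hA] with y hy hyA; rw [hy.1 hyA]; rfl)
    have hd := (hasFDerivAt_pi'.1 hf.differentiableAt.hasFDerivAt) i
    rw [hd.fderiv] at h
    exact h
  · intro hv g hg h0
    have hstrict := hf.hasStrictFDerivAt
    have hr : (fderiv ℂ f z).range = ⊤ := LinearMap.range_eq_top.2 hs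
    let ψ : (fderiv ℂ f z).ker → E := hstrict.implicitFunction f _ hr 0
    have hψ : HasFDerivAt ψ ((fderiv ℂ f z).ker.subtypeL) 0 := by
      have := (hstrict.to_implicitFunction hr).hasFDerivAt
      rwa [hf0] at this
    have hψ0 : ψ 0 = z := by
      have := hstrict.implicitFunction_apply_image hr
      rwa [hf0] at this
    have hfψ : ∀ᶠ p in 𝓝 (0 : (fderiv ℂ f z).ker), f (ψ p) = 0 := by
      have h := hstrict.map_implicitFunction_eq hr
      rw [hf0] at h
      exact (Continuous.prodMk_right (0 : Fin c → ℂ)).continuousAt.eventually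
        (p := fun p => f (hstrict.implicitFunction f _ hr p.1 p.2) = p.1) h
    have hgψ : ∀ᶠ p in 𝓝 (0 : (fderiv ℂ f z).ker), g (ψ p) = 0 := by
      have hct : Tendsto ψ (𝓝 0) (𝓝 z) := by simpa [hψ0] using hψ.continuousAt.tendsto
      filter_upwards [hfψ, hct.eventually hA, hct.eventually h0] with p h1 h2 h3
      exact h3 (h2.2 h1)
    have hcomp : HasFDerivAt (g ∘ ψ) ((fderiv ℂ g z).comp ((fderiv ℂ f z).ker.subtypeL)) 0 :=
      HasFDerivAt.comp 0 (by rw [hψ0]; exact hg.differentiableAt.hasFDerivAt) hψ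
    have hz0 : HasFDerivAt (g ∘ ψ) (0 : (fderiv ℂ f z).ker →L[ℂ] ℂ) 0 :=
      (hasFDerivAt_const (0 : ℂ) _).congr_of_eventuallyEq hgψ
    have := congrArg (fun T => T ⟨v, hv⟩) (hcomp.unique hz0)
    simpa using this

/-- A local defining function of a submanifold also defines it at all nearby points. -/
lemma IsSubmanifoldAt.exists_local [FiniteDimensional ℂ E] {A : Set E} {k : ℕ} {z : E} (h : IsSubmanifoldAt A k z) :
    ∃ c : ℕ, k + c = Module.finrank ℂ E ∧ ∃ f : E → (Fin c → ℂ), AnalyticAt ℂ f z ∧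
      Function.Surjective (fderiv ℂ f z) ∧
      ∀ᶠ y in 𝓝 z, (y ∈ A ↔ f y = 0) ∧
        (y ∈ A → IsSubmanifoldAt A k y ∧ tangentSpaceAt A y = (fderiv ℂ f y).ker) := by
  obtain ⟨-, c, hc, f, hf, hs, hA⟩ := h
  refine ⟨c, hc, f, hf, hs, ?_⟩
  filter_upwards [hA, eventually_surjective_fderiv hf hs, hA.eventually_nhds] with y h1 h2 h3
  exact ⟨h1, fun hy => ⟨⟨hy, c, hc, f, h2.1, h2.2, h3⟩, tangentSpaceAt_eq_ker hy h2.1 h2.2 h3⟩⟩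

lemma IsSubmanifoldAt.eventually [FiniteDimensional ℂ E] {A : Set E} {k : ℕ} {z : E} (h : IsSubmanifoldAt A k z) :
    ∀ᶠ y in 𝓝 z, y ∈ A → IsSubmanifoldAt A k y := by
  obtain ⟨c, -, f, -, -, h⟩ := h.exists_local
  filter_upwards [h] with y hy hyA using (hy.2 hyA).1

lemma IsSubmanifoldAt.finrank_tangentSpaceAt [FiniteDimensional ℂ E] {A : Set E} {k : ℕ} {z : E}
    (h : IsSubmanifoldAt A k z) : Module.finrank ℂ (tangentSpaceAt A z) = k := by
  obtain ⟨hz, c, hc, f, hf, hs, hA⟩ := h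
  rw [tangentSpaceAt_eq_ker hz hf hs hA]
  have h1 := LinearMap.finrank_range_add_finrank_ker (fderiv ℂ f z).toLinearMap
  rw [LinearMap.range_eq_top.2 hs, finrank_top, Module.finrank_fin_fun] at h1
  change Module.finrank ℂ (LinearMap.ker (fderiv ℂ f z).toLinearMap) = k
  omega

lemma IsSubmanifoldAt.dim_unique [FiniteDimensional ℂ E] {A : Set E} {k l : ℕ} {z : E}
    (h : IsSubmanifoldAt A k z) (h' : IsSubmanifoldAt A l z) : k = l :=
  h.finrank_tangentSpaceAt.symm.trans h'.finrank_tangentSpaceAt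

lemma IsSubmanifoldAt.congr {A B : Set E} {k : ℕ} {z : E} (h : IsSubmanifoldAt A k z)
    (hAB : ∀ᶠ y in 𝓝 z, (y ∈ A ↔ y ∈ B)) : IsSubmanifoldAt B k z := by
  obtain ⟨hz, c, hc, f, hf, hs, hA⟩ := h
  refine ⟨hAB.self_of_nhds.1 hz, c, hc, f, hf, hs, ?_⟩
  filter_upwards [hA, hAB] with y h1 h2
  rw [← h2, h1]

lemma tangentSpaceAt_congr {A B : Set E} {z : E} (hAB : ∀ᶠ y in 𝓝 z, (y ∈ A ↔ y ∈ B)) :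
    tangentSpaceAt A z = tangentSpaceAt B z := by
  ext v
  constructor
  · intro hv g hg h0
    refine hv g hg ?_
    filter_upwards [hAB, h0] with y h1 h2 h3 using h2 (h1.1 h3)
  · intro hv g hg h0
    refine hv g hg ?_
    filter_upwards [hAB, h0] with y h1 h2 h3 using h2 (h1.2 h3)

lemma IsSubmanifoldAt.map_equiv {A : Set E} {k : ℕ} {z : E} (T : E ≃L[ℂ] E)
    (hT : ∀ y, T y ∈ A ↔ y ∈ A) (h : IsSubmanifoldAt A k z) : IsSubmanifoldAt A k (T z) := by
  obtain ⟨hz, c, hc, f, hf, hs, hA⟩ := h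
  have hTs : T.symm (T z) = z := T.symm_apply_apply z
  refine ⟨(hT z).2 hz, c, hc, f ∘ T.symm, ?_, ?_, ?_⟩
  · exact AnalyticAt.comp (by rwa [hTs]) (T.symm.toContinuousLinearMap.analyticAt _)
  · have : HasFDerivAt (f ∘ T.symm) ((fderiv ℂ f z).comp (T.symm : E →L[ℂ] E)) (T z) :=
      HasFDerivAt.comp _ (by rw [hTs]; exact hf.differentiableAt.hasFDerivAt)
        T.symm.hasFDerivAt
    rw [this.fderiv]
    exact hs.comp T.symm.surjective
  · have hct : Tendsto T.symm (𝓝 (T z)) (𝓝 z) := by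
      simpa [hTs] using T.symm.continuous.tendsto (T z)
    filter_upwards [hct.eventually hA] with y hy
    rw [← T.apply_symm_apply y, hT, hy]
    simp

lemma map_mem_tangentSpaceAt {A : Set E} {z v : E} (T : E ≃L[ℂ] E)
    (hT : ∀ y, T y ∈ A ↔ y ∈ A) (hv : v ∈ tangentSpaceAt A z) :
    T v ∈ tangentSpaceAt A (T z) := by
  intro g hg h0
  have h := hv (g ∘ T) (hg.comp (T.toContinuousLinearMap.analyticAt _)) (by
    filter_upwards [T.continuous.continuousAt.eventually h0] with y hy hyA
    exact hy ((hT y).2 hyA))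
  have hd : HasFDerivAt (g ∘ T) ((fderiv ℂ g (T z)).comp (T : E →L[ℂ] E)) z :=
    HasFDerivAt.comp z hg.differentiableAt.hasFDerivAt T.hasFDerivAt
  rw [hd.fderiv] at h
  exact h

lemma map_mem_tangentSpaceAt_iff {A : Set E} {z v : E} (T : E ≃L[ℂ] E)
    (hT : ∀ y, T y ∈ A ↔ y ∈ A) :
    T v ∈ tangentSpaceAt A (T z) ↔ v ∈ tangentSpaceAt A z := by
  refine ⟨fun h => ?_, map_mem_tangentSpaceAt T hT⟩
  have := map_mem_tangentSpaceAt T.symm (fun y => by rw [← hT, T.apply_symm_apply]) h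
  simpa using this

/-- Velocity vectors of holomorphic curves in `A` are tangent to `A`. -/
lemma mem_tangentSpaceAt_of_hasFDerivAt {A : Set E} {G : Type*} [NormedAddCommGroup G]
    [NormedSpace ℂ G] {γ : G → E} {p : G} {γ' : G →L[ℂ] E} (hγ : HasFDerivAt γ γ' p)
    (hA : ∀ᶠ q in 𝓝 p, γ q ∈ A) (v : G) : γ' v ∈ tangentSpaceAt A (γ p) := by
  intro g hg h0
  have hcomp : HasFDerivAt (g ∘ γ) ((fderiv ℂ g (γ p)).comp γ') p :=
    HasFDerivAt.comp p hg.differentiableAt.hasFDerivAt hγ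
  have hz0 : HasFDerivAt (g ∘ γ) (0 : G →L[ℂ] ℂ) p := by
    refine (hasFDerivAt_const (0 : ℂ) _).congr_of_eventuallyEq ?_
    filter_upwards [hA, hγ.continuousAt.eventually h0] with q h1 h2 using h2 h1
  exact congrArg (fun T => T v) (hcomp.unique hz0)

lemma mem_tangentSpaceAt_of_line {A : Set E} {z v : E}
    (hA : ∀ᶠ t : ℂ in 𝓝 0, z + t • v ∈ A) : v ∈ tangentSpaceAt A z := by
  have hγ : HasFDerivAt (fun t : ℂ => z + t • v)
      (ContinuousLinearMap.toSpanSingleton ℂ v) 0 := by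
    have := (ContinuousLinearMap.toSpanSingleton ℂ v).hasFDerivAt (x := (0 : ℂ))
    exact this.const_add z
  simpa using mem_tangentSpaceAt_of_hasFDerivAt hγ hA 1

/-- A submanifold is locally connected. -/
lemma IsSubmanifoldAt.exists_preconnected [FiniteDimensional ℂ E] {A : Set E} {k : ℕ} {z : E}
    (h : IsSubmanifoldAt A k z) {N : Set E} (hN : N ∈ 𝓝 z) :
    ∃ S ⊆ A ∩ N, IsPreconnected S ∧ z ∈ S ∧ ∀ᶠ y in 𝓝 z, y ∈ A → y ∈ S := by
  obtain ⟨hz, c, hc, f, hf, hs, hA⟩ := h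
  have hf0 : f z = 0 := hA.self_of_nhds.1 hz
  have hstrict := hf.hasStrictFDerivAt
  have hr : (fderiv ℂ f z).range = ⊤ := LinearMap.range_eq_top.2 hs
  set e := hstrict.implicitToOpenPartialHomeomorph f _ hr with he
  have hzs : z ∈ e.source := hstrict.mem_implicitToOpenPartialHomeomorph_source hr
  have hez : e z = (0, 0) := by
    rw [he, hstrict.implicitToOpenPartialHomeomorph_self hr, hf0]
  have hct : Tendsto e.symm (𝓝 (0, 0)) (𝓝 z) := by
    rw [← hez]; exact e.tendsto_symm hzs
  have ht : ∀ᶠ p in 𝓝 ((0 : Fin c → ℂ), (0 : (fderiv ℂ f z).ker)),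
      p ∈ e.target ∧ (e.symm p ∈ A ↔ f (e.symm p) = 0) ∧ e.symm p ∈ N := by
    refine Filter.Eventually.and ?_ ((hct.eventually hA).and (hct.eventually hN))
    rw [← hez]
    exact e.open_target.mem_nhds (e.map_source hzs)
  rw [nhds_prod_eq] at ht
  obtain ⟨U, hU, V, hV, hUV⟩ := Filter.mem_prod_iff.1 ht
  obtain ⟨r, hr0, hrV⟩ := Metric.mem_nhds_iff.1 hV
  have h0U : (0 : Fin c → ℂ) ∈ U := mem_of_mem_nhds hU
  -- The first component of the chart `e` is `f`, so `A` corresponds to first component zero. A ball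
  -- in the kernel is convex, and its image is the connected neighbourhood in `A`.
  refine ⟨(fun q => e.symm ((0 : Fin c → ℂ), q)) '' Metric.ball 0 r, ?_, ?_, ?_, ?_⟩
  · rintro _ ⟨q, hq, rfl⟩
    have h1 := hUV (show ((0 : Fin c → ℂ), q) ∈ U ×ˢ V from ⟨h0U, hrV hq⟩)
    refine ⟨h1.2.1.2 ?_, h1.2.2⟩
    have h2 : (e (e.symm ((0 : Fin c → ℂ), q))).1 = f (e.symm ((0 : Fin c → ℂ), q)) := rfl
    rw [← h2, e.right_inv h1.1]
  · refine (convex_ball (0 : (fderiv ℂ f z).ker) r).isPreconnected.image _ ?_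
    refine e.symm.continuousOn.comp (by fun_prop) ?_
    intro q hq
    exact (hUV (show ((0 : Fin c → ℂ), q) ∈ U ×ˢ V from ⟨h0U, hrV hq⟩)).1
  · refine ⟨0, Metric.mem_ball_self hr0, ?_⟩
    change e.symm (0, 0) = z
    rw [← hez, e.left_inv hzs]
  · have hce : Tendsto (fun y => (e y).2) (𝓝 z) (𝓝 (0 : (fderiv ℂ f z).ker)) := by
      have := (e.continuousAt hzs).tendsto
      rw [hez] at this
      exact (continuous_snd.tendsto _).comp this
    filter_upwards [hA, e.open_source.mem_nhds hzs,
      hce.eventually (Metric.ball_mem_nhds _ hr0)] with y h1 h2 h3 hyA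
    refine ⟨(e y).2, h3, ?_⟩
    have : ((0 : Fin c → ℂ), (e y).2) = e y := by
      refine Prod.ext ?_ rfl
      exact (h1.1 hyA).symm
    change e.symm (0, (e y).2) = y
    rw [this, e.left_inv h2]

end Submanifold

/-! ### Rescaling homogeneous coordinates -/

section Scaling

variable {n : ℕ}

/-- Multiplication of the homogeneous coordinates `(X, u)` by `(a, b)`. -/
noncomputable def scale₂ {a b : ℂ} (ha : a ≠ 0) (hb : b ≠ 0) :
    (HVec n × HVec n) ≃L[ℂ] (HVec n × HVec n) :=
  (ContinuousLinearEquiv.smulLeft (Units.mk0 a ha)).prodCongr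
    (ContinuousLinearEquiv.smulLeft (Units.mk0 b hb))

@[simp] lemma scale₂_apply {a b : ℂ} (ha : a ≠ 0) (hb : b ≠ 0) (z : HVec n × HVec n) :
    scale₂ ha hb z = (a • z.1, b • z.2) := rfl

lemma scale₂_mem_bicone {a b : ℂ} (ha : a ≠ 0) (hb : b ≠ 0) (A : Set (P n × PDual n))
    (z : HVec n × HVec n) : scale₂ ha hb z ∈ bicone A ↔ z ∈ bicone A :=
  smul_mem_bicone ha hb

lemma exists_scale₂_rep₂ {z : HVec n × HVec n} (h₁ : z.1 ≠ 0) (h₂ : z.2 ≠ 0) :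
    ∃ (a b : ℂ) (ha : a ≠ 0) (hb : b ≠ 0), rep₂ (proj₂ z) = scale₂ ha hb z := by
  obtain ⟨a, ha, h⟩ := exists_rep_smul h₁
  obtain ⟨b, hb, h'⟩ := exists_rep_smul h₂
  exact ⟨a, b, ha, hb, Prod.ext h h'⟩

lemma isSubmanifoldAt_bicone_rep₂ {A : Set (P n × PDual n)} {k : ℕ} {z : HVec n × HVec n}
    (h₁ : z.1 ≠ 0) (h₂ : z.2 ≠ 0) :
    IsSubmanifoldAt (bicone A) k (rep₂ (proj₂ z)) ↔ IsSubmanifoldAt (bicone A) k z := by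
  obtain ⟨a, b, ha, hb, h⟩ := exists_scale₂_rep₂ h₁ h₂
  rw [h]
  refine ⟨fun h' => ?_, fun h' => h'.map_equiv _ (scale₂_mem_bicone ha hb A)⟩
  have := h'.map_equiv (scale₂ ha hb).symm
    (fun y => by rw [← scale₂_mem_bicone ha hb, ContinuousLinearEquiv.apply_symm_apply])
  rwa [ContinuousLinearEquiv.symm_apply_apply] at this

/-- The two scalings preserve the bicone, and `r ↦ ((1 + r s) X, (1 + r t) u)` is a line inside it
for small `r`. -/
lemma smul_mem_tangentSpaceAt_bicone {A : Set (P n × PDual n)} {z : HVec n × HVec n}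
    (hz : z ∈ bicone A) (s t : ℂ) : (s • z.1, t • z.2) ∈ tangentSpaceAt (bicone A) z := by
  apply mem_tangentSpaceAt_of_line
  have h1 : ∀ᶠ r : ℂ in 𝓝 0, (1 + r * s) ≠ 0 ∧ (1 + r * t) ≠ 0 := by
    refine Filter.Eventually.and ?_ ?_
    · exact (by fun_prop : Continuous fun r : ℂ => 1 + r * s).continuousAt.eventually_ne (by simp)
    · exact (by fun_prop : Continuous fun r : ℂ => 1 + r * t).continuousAt.eventually_ne (by simp)
  filter_upwards [h1] with r hr
  have := (smul_mem_bicone (A := A) hr.1 hr.2).2 hz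
  convert this using 1
  refine Prod.ext ?_ ?_ <;> simp [add_smul, mul_smul]

end Scaling

/-! ### Zeros of holomorphic functions in a disc -/

section Residues

open Metric Finset Complex

/-- Infinitely many zeros would accumulate in the compact disc, and the identity theorem would force
zeros on the circle. -/
lemma finite_zeros_closedBall {f : ℂ → ℂ} {c : ℂ} {r : ℝ} (hr : 0 < r)
    (hf : AnalyticOnNhd ℂ f (closedBall c r)) (hne : ∀ y ∈ sphere c r, f y ≠ 0) :
    {y | y ∈ closedBall c r ∧ f y = 0}.Finite := by
  by_contra hinf
  obtain ⟨z, hz, hacc⟩ := Set.Infinite.exists_accPt_of_subset_isCompact hinf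
    (isCompact_closedBall c r) (fun y hy => hy.1)
  have hfr : ∃ᶠ y in 𝓝[≠] z, f y = 0 :=
    (accPt_iff_frequently_nhdsNE.1 hacc).mono fun y hy => hy.2
  have := hf.eqOn_zero_of_preconnected_of_frequently_eq_zero
    (convex_closedBall c r).isPreconnected hz hfr
  have hs : c + r ∈ sphere c r := by simp [abs_of_pos hr]
  exact hne _ hs (this (sphere_subset_closedBall hs))

/-- Splitting off the zeros of a holomorphic function in a closed disc. -/
lemma exists_factorization_multiset {c : ℂ} {r : ℝ} (hr : 0 < r) (Z : Finset ℂ) :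
    ∀ f : ℂ → ℂ, AnalyticOnNhd ℂ f (closedBall c r) → (∀ y ∈ sphere c r, f y ≠ 0) →
      (∀ y, y ∈ closedBall c r ∧ f y = 0 ↔ y ∈ Z) →
      ∃ (s : Multiset ℂ) (H : ℂ → ℂ), (∀ a ∈ s, a ∈ ball c r) ∧
        AnalyticOnNhd ℂ H (closedBall c r) ∧ (∀ y ∈ closedBall c r, H y ≠ 0) ∧
        ∀ y, f y = (s.map fun a => y - a).prod * H y := by
  induction Z using Finset.induction_on with
  | empty =>
    intro f hf _ hZ
    refine ⟨0, f, by simp, hf, fun y hy h0 => ?_, by simp⟩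
    simpa using (hZ y).1 ⟨hy, h0⟩
  | insert a Z haZ ih =>
    intro f hf hne hZ
    obtain ⟨haB, hfa⟩ := (hZ a).2 (Finset.mem_insert_self a Z)
    have hab : a ∈ ball c r := by
      rw [mem_ball]
      refine lt_of_le_of_ne haB fun h => hne a h hfa
    have hnz : ¬ ∀ᶠ z in 𝓝 a, f z = 0 := by
      intro h0
      have := hf.eqOn_zero_of_preconnected_of_eventuallyEq_zero
        (convex_closedBall c r).isPreconnected haB h0
      have hs : c + r ∈ sphere c r := by simp [abs_of_pos hr]
      exact hne _ hs (this (sphere_subset_closedBall hs))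
    obtain ⟨m, G, hG, hGa, hfG⟩ := (hf a haB).exists_eventuallyEq_pow_smul_nonzero_iff.2 hnz
    have hm : m ≠ 0 := by
      rintro rfl
      have := hfG.self_of_nhds
      rw [hfa] at this
      simp at this
      exact hGa this.symm
    -- The quotient by the full power of `y - a`, its removable singularity filled in by `G a`. It
    -- is nonzero at `a`, so its zeros in the disc are those in `Z`.
    let g : ℂ → ℂ := Function.update (fun y => f y / (y - a) ^ m) a (G a)
    have hga : g =ᶠ[𝓝 a] G := by
      filter_upwards [hfG] with y hy
      by_cases h : y = a
      · simp [g, h]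
      · have : y - a ≠ 0 := sub_ne_zero.2 h
        simp only [g, Function.update_of_ne h, hy, smul_eq_mul]
        field_simp
    have hgne : ∀ y, y ≠ a → g y = f y / (y - a) ^ m := fun y h => Function.update_of_ne h _ _
    have hfg : ∀ y, f y = (y - a) ^ m * g y := by
      intro y
      by_cases h : y = a
      · rw [h, hfa, sub_self, zero_pow hm, zero_mul]
      · have : y - a ≠ 0 := sub_ne_zero.2 h
        rw [hgne y h]
        field_simp
    have hgan : AnalyticOnNhd ℂ g (closedBall c r) := by
      intro y hy
      by_cases h : y = a
      · rw [h]; exact hG.congr hga.symm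
      · have hq : AnalyticAt ℂ (fun y => f y / (y - a) ^ m) y :=
          (hf y hy).div (by fun_prop) (pow_ne_zero _ (sub_ne_zero.2 h))
        refine hq.congr ?_
        filter_upwards [isOpen_ne.mem_nhds h] with w hw using (hgne w hw).symm
    have hga0 : g a ≠ 0 := by rwa [hga.self_of_nhds]
    obtain ⟨s, H, hs, hH, hH0, hgH⟩ := ih g hgan
      (fun y hy h0 => hne y hy (by rw [hfg, h0, mul_zero])) (by
        intro y
        constructor
        · rintro ⟨hy, h0⟩
          have := (hZ y).1 ⟨hy, by rw [hfg, h0, mul_zero]⟩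
          rcases Finset.mem_insert.1 this with rfl | h
          · exact absurd h0 hga0
          · exact h
        · intro hy
          obtain ⟨h1, h2⟩ := (hZ y).2 (Finset.mem_insert_of_mem hy)
          have hya : y ≠ a := by rintro rfl; exact haZ hy
          exact ⟨h1, by rw [hgne y hya, h2, zero_div]⟩)
    refine ⟨Multiset.replicate m a + s, H, ?_, hH, hH0, fun y => ?_⟩
    · intro b hb
      rcases Multiset.mem_add.1 hb with h | h
      · rw [Multiset.eq_of_mem_replicate h]; exact hab
      · exact hs b h
    · rw [hfg, hgH, Multiset.map_add, Multiset.prod_add, Multiset.map_replicate,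
        Multiset.prod_replicate]
      ring

lemma exists_factorization {f : ℂ → ℂ} {c : ℂ} {r : ℝ} (hr : 0 < r)
    (hf : AnalyticOnNhd ℂ f (closedBall c r)) (hne : ∀ y ∈ sphere c r, f y ≠ 0) :
    ∃ (k : ℕ) (a : Fin k → ℂ) (H : ℂ → ℂ), (∀ j, a j ∈ ball c r) ∧
      AnalyticOnNhd ℂ H (closedBall c r) ∧ (∀ y ∈ closedBall c r, H y ≠ 0) ∧
      ∀ y, f y = (∏ j, (y - a j)) * H y := by
  obtain ⟨s, H, hs, hH, hH0, hfH⟩ := exists_factorization_multiset hr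
    (finite_zeros_closedBall hr hf hne).toFinset f hf hne (fun y => by simp)
  induction s using Quotient.inductionOn with
  | h l =>
    refine ⟨l.length, l.get, H, fun j => hs _ (by simp), hH, hH0, fun y => ?_⟩
    rw [hfH, Multiset.quot_mk_to_coe, Multiset.map_coe, Multiset.prod_coe, ← List.prod_ofFn]
    congr 2
    conv_lhs => rw [← List.ofFn_get l, List.map_ofFn]
    rfl

/-- The residue theorem for `g f' / f`. -/
lemma circleIntegral_mul_logDeriv {f H g : ℂ → ℂ} {c : ℂ} {r : ℝ} (hr : 0 < r) {k : ℕ}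
    {a : Fin k → ℂ} (ha : ∀ j, a j ∈ ball c r) (hH : AnalyticOnNhd ℂ H (closedBall c r))
    (hH0 : ∀ y ∈ closedBall c r, H y ≠ 0) (hf : ∀ y, f y = (∏ j, (y - a j)) * H y)
    (hg : AnalyticOnNhd ℂ g (closedBall c r)) :
    (∮ y in C(c, r), g y * (deriv f y / f y)) = (2 * Real.pi * I) * ∑ j, g (a j) := by
  have hsub : ∀ y ∈ sphere c r, ∀ j, y - a j ≠ 0 := by
    intro y hy j h
    rw [sub_eq_zero] at h
    have h1 := ha j
    rw [← h, mem_ball] at h1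
    exact h1.ne hy
  -- The logarithmic derivative splits the product into simple poles at the `a j` and a term
  -- holomorphic on the disc. Cauchy's formula evaluates the former, and the latter integrates to
  -- zero.
  have hlog : ∀ y ∈ sphere c r, g y * (deriv f y / f y)
      = (∑ j, (y - a j)⁻¹ • g y) + g y * (deriv H y / H y) := by
    intro y hy
    have hyb := sphere_subset_closedBall hy
    have hff : f = fun y => (∏ j, (y - a j)) * H y := funext hf
    have h1 : logDeriv f y = ∑ j, (y - a j)⁻¹ + logDeriv H y := by
      rw [hff, logDeriv_mul y (Finset.prod_ne_zero_iff.2 fun j _ => hsub y hy j) (hH0 y hyb)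
        (by fun_prop) (hH y hyb).differentiableAt,
        logDeriv_prod (fun j _ => hsub y hy j) (fun j _ => by fun_prop)]
      congr 1
      refine Finset.sum_congr rfl fun j _ => ?_
      rw [logDeriv_apply]
      simp
    rw [logDeriv_apply, logDeriv_apply] at h1
    rw [h1, mul_add, Finset.mul_sum]
    congr 1
    exact Finset.sum_congr rfl fun j _ => by rw [smul_eq_mul, mul_comm]
  have hrest : AnalyticOnNhd ℂ (fun y => g y * (deriv H y / H y)) (closedBall c r) :=
    fun y hy => (hg y hy).mul (((hH y hy).deriv).div (hH y hy) (hH0 y hy))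
  have hint : ∀ j, CircleIntegrable (fun y => (y - a j)⁻¹ • g y) c r := by
    intro j
    refine ContinuousOn.circleIntegrable hr.le ?_
    have h1 : ContinuousOn (fun y => (y - a j)⁻¹) (sphere c r) :=
      ContinuousOn.inv₀ (by fun_prop) (fun y hy => hsub y hy j)
    exact h1.smul (hg.continuousOn.mono sphere_subset_closedBall)
  rw [circleIntegral.integral_congr hr.le hlog, circleIntegral.integral_add
    (by
      have := CircleIntegrable.sum (s := Finset.univ) (f := fun j y => (y - a j)⁻¹ • g y)
        (fun j _ => hint j)
      simpa [Finset.sum_fn] using this)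
    ((hrest.continuousOn.mono sphere_subset_closedBall).circleIntegrable hr.le),
    circleIntegral.integral_fun_sum (fun j _ => hint j),
    circleIntegral_eq_zero_of_differentiable_on_off_countable hr.le Set.countable_empty
      hrest.continuousOn
      (fun y hy => (hrest y (ball_subset_closedBall hy.1)).differentiableAt), add_zero,
    Finset.mul_sum]
  refine Finset.sum_congr rfl fun j _ => ?_
  rw [hg.differentiableOn.circleIntegral_sub_inv_smul (ha j), smul_eq_mul]

end Residues

/-! ### Circle integrals depending on a parameter -/

section Parametric

open Metric

variable {E : Type*} [NormedAddCommGroup E] [NormedSpace ℂ E]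

/-- Differentiation under the integral sign. Compactness of the circle gives one neighbourhood `U`
of `x₀` on which the differential of `F` is bounded by `M + 1`; this is the dominating constant.
Here and below, complex `C¹` serves as the notion of holomorphy in several variables. -/
lemma contDiffAt_circleIntegral {F : E × ℂ → ℂ} {x₀ : E} {c : ℂ} {r : ℝ} (hr : 0 ≤ r)
    (hF : ∀ y ∈ sphere c r, ContDiffAt ℂ 1 F (x₀, y)) :
    ContDiffAt ℂ 1 (fun x => ∮ y in C(c, r), F (x, y)) x₀ := by
  obtain ⟨M, hM⟩ := (isCompact_sphere c r).exists_bound_of_continuousOn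
    (f := fun y => fderiv ℂ F (x₀, y)) (fun y hy => by
      have := (hF y hy).continuousAt_fderiv one_ne_zero
      exact (ContinuousAt.comp (f := fun y => (x₀, y)) (x := y) this
        (by fun_prop)).continuousWithinAt)
  have hev : ∀ᶠ x in 𝓝 x₀, ∀ y ∈ sphere c r,
      ContDiffAt ℂ 1 F (x, y) ∧ ‖fderiv ℂ F (x, y)‖ < M + 1 := by
    refine (isCompact_sphere c r).eventually_forall_of_forall_eventually
      (P := fun x y => ContDiffAt ℂ 1 F (x, y) ∧ ‖fderiv ℂ F (x, y)‖ < M + 1) fun y hy => ?_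
    refine ((hF y hy).eventually (by simp)).and ?_
    refine ((hF y hy).continuousAt_fderiv one_ne_zero).norm.eventually_lt_const ?_
    exact (hM y hy).trans_lt (lt_add_one M)
  obtain ⟨U, hU, hUo, hxU⟩ := _root_.eventually_nhds_iff.1 hev
  have hcm : ∀ θ, circleMap c r θ ∈ sphere c r := fun θ => circleMap_mem_sphere c hr θ
  let F' : E → ℝ → E →L[ℂ] ℂ := fun x θ =>
    deriv (circleMap c r) θ • (fderiv ℂ F (x, circleMap c r θ)).comp (.inl ℂ E ℂ)
  have hdc : Continuous fun θ => deriv (circleMap c r) θ := by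
    simp only [deriv_circleMap]; fun_prop
  have hcF' : ∀ x ∈ U, Continuous (F' x) := by
    intro x hx
    refine hdc.smul ?_
    refine continuous_iff_continuousAt.2 fun θ => ?_
    have h1 := ((hU x hx _ (hcm θ)).1).continuousAt_fderiv one_ne_zero
    have h2 : ContinuousAt (fun θ => fderiv ℂ F (x, circleMap c r θ)) θ :=
      ContinuousAt.comp (f := fun θ => (x, circleMap c r θ)) h1 (by fun_prop)
    exact h2.clm_comp continuousAt_const
  have hcF : ∀ x ∈ U, Continuous fun θ => deriv (circleMap c r) θ • F (x, circleMap c r θ) := by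
    intro x hx
    refine hdc.smul ?_
    refine continuous_iff_continuousAt.2 fun θ => ?_
    exact ContinuousAt.comp (f := fun θ => (x, circleMap c r θ))
      (hU x hx _ (hcm θ)).1.continuousAt (by fun_prop)
  have hbd : ∀ x ∈ U, ∀ θ, ‖F' x θ‖ ≤ |r| * ((M + 1) * 1) := by
    intro x hx θ
    rw [norm_smul]
    refine mul_le_mul (by simp) ?_ (norm_nonneg _) (abs_nonneg _)
    refine (ContinuousLinearMap.opNorm_comp_le _ _).trans ?_
    have h1 := (hU x hx _ (hcm θ)).2
    exact mul_le_mul h1.le (ContinuousLinearMap.norm_inl_le_one ℂ E ℂ) (norm_nonneg _)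
      ((norm_nonneg _).trans h1.le)
  rw [contDiffAt_one_iff]
  refine ⟨fun x => ∫ θ in (0 : ℝ)..2 * Real.pi, F' x θ, U, hUo.mem_nhds hxU, ?_, ?_⟩
  · intro x hx
    refine ContinuousAt.continuousWithinAt ?_
    have hUx := hUo.mem_nhds hx
    refine intervalIntegral.continuousAt_of_dominated_interval
      (bound := fun _ => |r| * ((M + 1) * 1)) ?_ ?_ (by simp) ?_
    · filter_upwards [hUx] with x' hx' using (hcF' x' hx').aestronglyMeasurable
    · filter_upwards [hUx] with x' hx'
      exact Eventually.of_forall fun θ _ => hbd x' hx' θ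
    · refine Eventually.of_forall fun θ _ => ?_
      have h1 := ((hU x hx _ (hcm θ)).1).continuousAt_fderiv one_ne_zero
      have h2 : ContinuousAt (fun x => fderiv ℂ F (x, circleMap c r θ)) x :=
        ContinuousAt.comp (f := fun x => (x, circleMap c r θ)) h1 (by fun_prop)
      have h3 : ContinuousAt (fun x => (fderiv ℂ F (x, circleMap c r θ)).comp (.inl ℂ E ℂ)) x :=
        h2.clm_comp continuousAt_const
      exact h3.const_smul (deriv (circleMap c r) θ)
  · intro x hx
    refine intervalIntegral.hasFDerivAt_integral_of_dominated_of_fderiv_le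
      (F := fun x θ => deriv (circleMap c r) θ • F (x, circleMap c r θ))
      (bound := fun _ => |r| * ((M + 1) * 1)) (hUo.mem_nhds hx) ?_ ?_ ?_ ?_ (by simp) ?_
    · filter_upwards [hUo.mem_nhds hx] with x' hx' using (hcF x' hx').aestronglyMeasurable
    · exact (hcF x hx).intervalIntegrable _ _
    · exact (hcF' x hx).aestronglyMeasurable
    · exact Eventually.of_forall fun θ _ x' hx' => hbd x' hx' θ
    · refine Eventually.of_forall fun θ _ x' hx' => ?_
      have h1 := ((hU x' hx' _ (hcm θ)).1.differentiableAt one_ne_zero).hasFDerivAt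
      exact (h1.comp x' (hasFDerivAt_prodMk_left x' _)).const_smul (deriv (circleMap c r) θ)

/-- A partial derivative of a holomorphic function is holomorphic. -/
lemma contDiffAt_partial_deriv {f : E × ℂ → ℂ} {p : E × ℂ} (hf : ContDiffAt ℂ 1 f p) :
    ContDiffAt ℂ 1 (fun q : E × ℂ => deriv (fun y => f (q.1, y)) q.2) p := by
  obtain ⟨x₀, y₀⟩ := p
  have hev := hf.eventually (by simp)
  rw [nhds_prod_eq] at hev
  obtain ⟨U, hU, V, hV, hUV⟩ := Filter.mem_prod_iff.1 hev
  obtain ⟨r, hr, hrV⟩ := nhds_basis_closedBall.mem_iff.1 hV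
  have hx₀ : x₀ ∈ U := mem_of_mem_nhds hU
  -- Cauchy's formula for the derivative on a circle independent of `q`: it involves only values of
  -- `f`, so no second derivatives are needed.
  have key : (fun q : E × ℂ => deriv (fun y => f (q.1, y)) q.2) =ᶠ[𝓝 (x₀, y₀)]
      fun q => (2 * ↑Real.pi * Complex.I)⁻¹ •
        ∮ ζ in C(y₀, r), ((ζ - q.2) ^ 2)⁻¹ • f (q.1, ζ) := by
    filter_upwards [prod_mem_nhds (eventually_mem_nhds_iff.2 hU) (ball_mem_nhds y₀ hr)]
      with q hq
    have hqU : q.1 ∈ U := mem_of_mem_nhds hq.1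
    have hd : ∀ y ∈ closedBall y₀ r, ∀ᶠ w in 𝓝 y, DifferentiableAt ℂ (fun y => f (q.1, y)) w := by
      intro y hy
      have h1 : ContDiffAt ℂ 1 f (q.1, y) := hUV (show (q.1, y) ∈ U ×ˢ V from ⟨hqU, hrV hy⟩)
      have h2 := (Continuous.prodMk_right q.1).continuousAt (x := y) |>.eventually
        (h1.eventually (by simp))
      filter_upwards [h2] with w hw
      exact (hw.differentiableAt one_ne_zero).comp w (by fun_prop)
    have hopen : IsOpen {w | ∀ᶠ w' in 𝓝 w, DifferentiableAt ℂ (fun y => f (q.1, y)) w'} :=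
      isOpen_setOfPred_eventually_nhds
    exact (Complex.two_pi_I_inv_smul_circleIntegral_sub_sq_inv_smul_of_differentiable hopen
      (fun y hy => hd y hy)
      (fun w hw => (Eventually.self_of_nhds hw).differentiableWithinAt) hq.2).symm
  refine ContDiffAt.congr_of_eventuallyEq ?_ key
  refine ContDiffAt.const_smul (R := ℂ) _ ?_
  refine contDiffAt_circleIntegral (F := fun z : (E × ℂ) × ℂ =>
    ((z.2 - z.1.2) ^ 2)⁻¹ • f (z.1.1, z.2)) hr.le fun ζ hζ => ?_
  refine ContDiffAt.smul (f := fun z : (E × ℂ) × ℂ => ((z.2 - z.1.2) ^ 2)⁻¹) ?_ ?_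
  · refine ContDiffAt.inv (by fun_prop) ?_
    refine pow_ne_zero _ (sub_ne_zero.2 ?_)
    intro h
    change ζ = y₀ at h
    rw [h, mem_sphere, dist_self] at hζ
    exact hr.ne hζ
  · have h1 : ContDiffAt ℂ 1 f (x₀, ζ) :=
      hUV (show (x₀, ζ) ∈ U ×ˢ V from ⟨hx₀, hrV (sphere_subset_closedBall hζ)⟩)
    exact ContDiffAt.comp (f := fun z : (E × ℂ) × ℂ => (z.1.1, z.2)) ((x₀, y₀), ζ) h1
      (by fun_prop)

end Parametric

/-! ### Elimination of variables for holomorphic equations -/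

section Newton

variable {E : Type*} [NormedAddCommGroup E] [NormedSpace ℂ E]

/-- By Newton's identities, holomorphic power sums give holomorphic elementary symmetric
functions. -/
lemma contDiffAt_esymm {k : ℕ} {b : E → Fin k → ℂ} {x₀ : E}
    (hb : ∀ p, ContDiffAt ℂ 1 (fun x => ∑ j, b x j ^ p) x₀) (m : ℕ) :
    ContDiffAt ℂ 1 (fun x => MvPolynomial.aeval (b x) (MvPolynomial.esymm (Fin k) ℂ m)) x₀ := by
  induction m using Nat.strong_induction_on with
  | _ m ih =>
    rcases Nat.eq_zero_or_pos m with rfl | hm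
    · simp only [MvPolynomial.esymm_zero, map_one]
      exact contDiffAt_const
    · have key : ∀ x, MvPolynomial.aeval (b x) (MvPolynomial.esymm (Fin k) ℂ m)
          = (m : ℂ)⁻¹ * ((-1) ^ (m + 1) * ∑ a ∈ Finset.HasAntidiagonal.antidiagonal m with a.1 < m,
            (-1) ^ a.1 * MvPolynomial.aeval (b x) (MvPolynomial.esymm (Fin k) ℂ a.1)
              * ∑ j, b x j ^ a.2) := by
        intro x
        have h := congrArg (MvPolynomial.aeval (b x)) (MvPolynomial.mul_esymm_eq_sum (Fin k) ℂ m)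
        simp only [map_mul, map_natCast, map_pow, map_neg, map_one, map_sum,
          MvPolynomial.psum, MvPolynomial.aeval_X] at h
        have hm0 : (m : ℂ) ≠ 0 := Nat.cast_ne_zero.2 hm.ne'
        rw [← h]
        field_simp
      rw [funext key]
      refine contDiffAt_const.mul (contDiffAt_const.mul (ContDiffAt.sum fun a ha => ?_))
      exact (contDiffAt_const.mul (ih a.1 (Finset.mem_filter.1 ha).2)).mul (hb a.2)

/-- The product is the elementary symmetric function of top degree `k`. -/
lemma contDiffAt_prod_of_psum {k : ℕ} {b : E → Fin k → ℂ} {x₀ : E}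
    (hb : ∀ p, ContDiffAt ℂ 1 (fun x => ∑ j, b x j ^ p) x₀) :
    ContDiffAt ℂ 1 (fun x => ∏ j, b x j) x₀ := by
  have h := contDiffAt_esymm hb k
  have hp : MvPolynomial.esymm (Fin k) ℂ k = ∏ j, MvPolynomial.X j := by
    have : Finset.powersetCard k (Finset.univ : Finset (Fin k)) = {Finset.univ} := by
      have h1 := Finset.powersetCard_self (Finset.univ : Finset (Fin k))
      rwa [Finset.card_univ, Fintype.card_fin] at h1
    rw [MvPolynomial.esymm, this, Finset.sum_singleton]
  simpa [hp, map_prod] using h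

/-- If no combination of the form `∑ sⁱ vᵢ` distinguishes them, one of finitely many vectors is
zero. -/
lemma exists_eq_zero_of_prod_eq_zero {k c : ℕ} (v : Fin k → Fin c → ℂ)
    (h : ∀ s : Fin (k * c + 1), ∏ j, ∑ i : Fin c, (s : ℂ) ^ (i : ℕ) * v j i = 0) :
    ∃ j, v j = 0 := by
  classical
  -- The product of the polynomials `q j` has degree at most `k * c` and vanishes at `k * c + 1`
  -- distinct numbers, so it is zero. Polynomials form a domain, hence some `q j` is zero, and its
  -- coefficients are the entries of `v j`.
  let q : Fin k → Polynomial ℂ := fun j => ∑ i : Fin c, Polynomial.monomial (i : ℕ) (v j i)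
  have hq : ∀ j s, (q j).eval s = ∑ i : Fin c, s ^ (i : ℕ) * v j i := by
    intro j s
    simp [q, Polynomial.eval_finsetSum, Polynomial.eval_monomial, mul_comm]
  have hdeg : (∏ j, q j).natDegree ≤ k * c := by
    refine (Polynomial.natDegree_prod_le _ _).trans ?_
    refine (Finset.sum_le_card_nsmul _ _ c fun j _ => ?_).trans (by simp)
    refine Polynomial.natDegree_sum_le_of_forall_le _ _ fun i _ => ?_
    exact (Polynomial.natDegree_monomial_le _).trans i.2.le
  have h0 : ∏ j, q j = 0 := by
    refine Polynomial.eq_zero_of_natDegree_lt_card_of_eval_eq_zero _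
      (f := fun s : Fin (k * c + 1) => ((s : ℕ) : ℂ)) ?_ ?_ ?_
    · intro a b hab
      exact Fin.ext (Nat.cast_injective (R := ℂ) hab)
    · intro s
      rw [Polynomial.eval_prod]
      simpa [hq] using h s
    · simpa using Nat.lt_succ_of_le hdeg
  obtain ⟨j, -, hj⟩ := Finset.prod_eq_zero_iff.1 h0
  refine ⟨j, funext fun i => ?_⟩
  have := congrArg (fun p => Polynomial.coeff p i) hj
  simp only [q, Polynomial.finsetSum_coeff, Polynomial.coeff_monomial, Polynomial.coeff_zero]
    at this
  rw [Finset.sum_eq_single i (fun b _ hb => if_neg fun h => hb (Fin.ext h)) (by simp)] at this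
  simpa using this

end Newton

/-! ### Zeros depending on parameters, elimination, and openness of projections with isolated
fibres. -/

section Elimination

open Metric

variable {E : Type*} [NormedAddCommGroup E] [NormedSpace ℂ E]

lemma analyticAt_slice {h : E × ℂ → ℂ} {x : E} {y : ℂ} (hh : ContDiffAt ℂ 1 h (x, y)) :
    AnalyticAt ℂ (fun y => h (x, y)) y := by
  rw [Complex.analyticAt_iff_eventually_differentiableAt]
  have h2 := (Continuous.prodMk_right x).continuousAt (x := y) |>.eventually
    (hh.eventually (by simp))
  filter_upwards [h2] with w hw
  exact (hw.differentiableAt one_ne_zero).comp w (by fun_prop)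

/-- The number of zeros in a disc is locally constant, and symmetric functions of the values at
the zeros are holomorphic. -/
lemma exists_roots {h : E × ℂ → ℂ} {x₀ : E} {c : ℂ} {r : ℝ} (hr : 0 < r)
    (hh : ∀ y ∈ closedBall c r, ContDiffAt ℂ 1 h (x₀, y))
    (hne : ∀ y ∈ sphere c r, h (x₀, y) ≠ 0) :
    ∃ (k : ℕ) (a : E → Fin k → ℂ),
      (∀ᶠ x in 𝓝 x₀, (∀ j, a x j ∈ ball c r) ∧
        ∀ y ∈ closedBall c r, h (x, y) = 0 ↔ ∃ j, y = a x j) ∧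
      ∀ g : E × ℂ → ℂ, (∀ y ∈ closedBall c r, ContDiffAt ℂ 1 g (x₀, y)) →
        ContDiffAt ℂ 1 (fun x => ∏ j, g (x, a x j)) x₀ := by
  have hcd : ∀ g : E × ℂ → ℂ, (∀ y ∈ closedBall c r, ContDiffAt ℂ 1 g (x₀, y)) →
      ∀ᶠ x in 𝓝 x₀, ∀ y ∈ closedBall c r, ContDiffAt ℂ 1 g (x, y) := fun g hg =>
    (isCompact_closedBall c r).eventually_forall_of_forall_eventually
      (P := fun x y => ContDiffAt ℂ 1 g (x, y)) fun y hy => (hg y hy).eventually (by simp)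
  have hs0 : ∀ᶠ x in 𝓝 x₀, ∀ y ∈ sphere c r, h (x, y) ≠ 0 :=
    (isCompact_sphere c r).eventually_forall_of_forall_eventually
      (P := fun x y => h (x, y) ≠ 0) fun y hy =>
        (hh y (sphere_subset_closedBall hy)).continuousAt.eventually_ne (hne y hy)
  -- Junk values where the hypotheses fail turn the number of roots and the roots into functions of
  -- every `x`.
  have hfac : ∀ x, ∃ (k : ℕ) (a : Fin k → ℂ) (H : ℂ → ℂ),
      ((∀ y ∈ closedBall c r, ContDiffAt ℂ 1 h (x, y)) ∧ (∀ y ∈ sphere c r, h (x, y) ≠ 0)) →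
      (∀ j, a j ∈ ball c r) ∧ AnalyticOnNhd ℂ H (closedBall c r) ∧
      (∀ y ∈ closedBall c r, H y ≠ 0) ∧ ∀ y, h (x, y) = (∏ j, (y - a j)) * H y := by
    intro x
    by_cases hx : (∀ y ∈ closedBall c r, ContDiffAt ℂ 1 h (x, y)) ∧
      (∀ y ∈ sphere c r, h (x, y) ≠ 0)
    · obtain ⟨k, a, H, h1⟩ := exists_factorization (f := fun y => h (x, y)) hr
        (fun y hy => analyticAt_slice (hx.1 y hy)) hx.2
      exact ⟨k, a, H, fun _ => h1⟩
    · exact ⟨0, Fin.elim0, fun _ => 0, fun h => absurd h hx⟩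
  choose K A H hK using hfac
  let D : E × ℂ → ℂ := fun q => deriv (fun y => h (q.1, y)) q.2
  -- sums over the zeros are holomorphic in `x`
  have hsum : ∀ g : E × ℂ → ℂ, (∀ y ∈ closedBall c r, ContDiffAt ℂ 1 g (x₀, y)) →
      ContDiffAt ℂ 1 (fun x => ∑ j, g (x, A x j)) x₀ := by
    intro g hg
    have hF : ∀ y ∈ sphere c r, ContDiffAt ℂ 1 (fun q => g q * (D q / h q)) (x₀, y) := by
      intro y hy
      have hyb := sphere_subset_closedBall hy
      exact (hg y hyb).mul ((contDiffAt_partial_deriv (hh y hyb)).div (hh y hyb) (hne y hy))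
    have hI := (contDiffAt_circleIntegral hr.le hF).const_smul ((2 * Real.pi * Complex.I)⁻¹)
    refine hI.congr_of_eventuallyEq ?_
    filter_upwards [hcd h hh, hs0, hcd g hg] with x h1 h2 h3
    obtain ⟨ha, hH, hH0, hf⟩ := hK x ⟨h1, h2⟩
    have := circleIntegral_mul_logDeriv (g := fun y => g (x, y)) hr ha hH hH0 hf
      (fun y hy => analyticAt_slice (h3 y hy))
    change _ = (2 * Real.pi * Complex.I)⁻¹ • (∮ y in C(c, r), g (x, y) * (D (x, y) / h (x, y)))
    rw [this, smul_eq_mul, inv_mul_cancel_left₀ Complex.two_pi_I_ne_zero]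
  -- The number of roots is the sum of `g = 1` over them; being continuous at `x₀` and
  -- integer-valued, it is constant nearby.
  have hKconst : ∀ᶠ x in 𝓝 x₀, K x = K x₀ := by
    have h1 := (hsum (fun _ => 1) (fun _ _ => contDiffAt_const)).continuousAt
    simp only [Finset.sum_const, Finset.card_univ, Fintype.card_fin, nsmul_eq_mul, mul_one] at h1
    filter_upwards [h1.eventually (ball_mem_nhds _ one_pos)] with x hx
    change dist _ _ < _ at hx
    rw [Complex.dist_eq] at hx
    have h2 : ‖((((K x : ℤ) - (K x₀ : ℤ) : ℤ)) : ℂ)‖ < 1 := by push_cast; exact hx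
    rw [Complex.norm_intCast] at h2
    have h3 : |(K x : ℤ) - (K x₀ : ℤ)| < 1 := by exact_mod_cast h2
    have := Int.abs_lt_one_iff.1 h3
    omega
  -- The roots are reindexed by one fixed type, so that symmetric functions of them make sense for
  -- all `x` near `x₀`.
  have hcast : ∀ x, ∃ b : Fin (K x₀) → ℂ, K x = K x₀ →
      (∀ f : ℂ → ℂ, ∏ j, f (A x j) = ∏ j, f (b j)) ∧ (∀ f : ℂ → ℂ, ∑ j, f (A x j) = ∑ j, f (b j)) ∧
      (∀ y, (∃ j, y = A x j) ↔ ∃ j, y = b j) := by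
    intro x
    by_cases hx : K x = K x₀
    · refine ⟨fun j => A x (Fin.cast hx.symm j), fun _ => ⟨fun f => ?_, fun f => ?_, fun y => ?_⟩⟩
      · exact ((finCongr hx.symm).prod_comp (fun j => f (A x j))).symm
      · exact ((finCongr hx.symm).sum_comp (fun j => f (A x j))).symm
      · constructor
        · rintro ⟨j, rfl⟩
          exact ⟨Fin.cast hx j, rfl⟩
        · rintro ⟨j, rfl⟩
          exact ⟨Fin.cast hx.symm j, rfl⟩
    · exact ⟨fun _ => 0, fun h => absurd h hx⟩
  choose b hb using hcast
  refine ⟨K x₀, b, ?_, ?_⟩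
  · filter_upwards [hcd h hh, hs0, hKconst] with x h1 h2 h3
    obtain ⟨ha, hH, hH0, hf⟩ := hK x ⟨h1, h2⟩
    refine ⟨fun j => ?_, fun y hy => ?_⟩
    · obtain ⟨i, hi⟩ := ((hb x h3).2.2 (b x j)).2 ⟨j, rfl⟩
      rw [hi]; exact ha i
    · rw [← (hb x h3).2.2 y, hf, mul_eq_zero, or_iff_left (hH0 y hy), Finset.prod_eq_zero_iff]
      simp [sub_eq_zero]
  · intro g hg
    refine contDiffAt_prod_of_psum fun p => ?_
    refine (hsum (fun q => g q ^ p) fun y hy => (hg y hy).pow p).congr_of_eventuallyEq ?_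
    filter_upwards [hKconst] with x hx
    exact ((hb x hx).2.1 (fun y => g (x, y) ^ p)).symm

/-- Elimination of one variable: near an isolated point of the fibre, the projection of a
holomorphic zero set is a holomorphic zero set. -/
lemma exists_eliminant {c : ℕ} {f : E × ℂ → (Fin c → ℂ)} {x₀ : E} {y₀ : ℂ}
    (hf : ContDiffAt ℂ 1 f (x₀, y₀)) (hf0 : f (x₀, y₀) = 0)
    (hiso : ∀ᶠ y in 𝓝 y₀, f (x₀, y) = 0 → y = y₀) {N : Set (E × ℂ)} (hN : N ∈ 𝓝 (x₀, y₀)) :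
    ∃ U ∈ 𝓝 x₀, ∃ V ∈ 𝓝 y₀, U ×ˢ V ⊆ N ∧ ∃ (c' : ℕ) (g : E → (Fin c' → ℂ)),
      ContDiffAt ℂ 1 g x₀ ∧ ∀ x ∈ U, ((∃ y ∈ V, f (x, y) = 0) ↔ g x = 0) := by
  have hfi : ∀ i, ContDiffAt ℂ 1 (fun q => f q i) (x₀, y₀) := fun i => (contDiffAt_pi.1 hf) i
  -- Some component of `f` is not identically zero on the slice, as otherwise `y₀` would not be
  -- isolated. The common zeros of `f` are then sought among the finitely many roots of this
  -- component.
  obtain ⟨i, hi⟩ : ∃ i, ¬ ∀ᶠ y in 𝓝 y₀, f (x₀, y) i = 0 := by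
    by_contra hcon
    push Not at hcon
    have h1 : ∀ᶠ y in 𝓝 y₀, y = y₀ := by
      filter_upwards [hiso, eventually_all.2 hcon] with y h2 h3 using h2 (funext h3)
    have h2 : ∀ᶠ y in 𝓝[≠] y₀, False := by
      filter_upwards [h1.filter_mono nhdsWithin_le_nhds, self_mem_nhdsWithin] with y h h'
      exact h' h
    exact (NeBot.ne (f := 𝓝[≠] y₀) inferInstance) (eventually_false_iff_eq_bot.1 h2)
  have hne : ∀ᶠ y in 𝓝[≠] y₀, f (x₀, y) i ≠ 0 :=
    ((analyticAt_slice (hfi i)).eventually_eq_zero_or_eventually_ne_zero).resolve_left hi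
  rw [eventually_nhdsWithin_iff] at hne
  have hsl : ∀ᶠ y in 𝓝 y₀, ContDiffAt ℂ 1 f (x₀, y) :=
    (Continuous.prodMk_right x₀).continuousAt.eventually (hf.eventually (by simp))
  rw [nhds_prod_eq] at hN
  obtain ⟨U₁, hU₁, V₁, hV₁, hUV⟩ := Filter.mem_prod_iff.1 hN
  obtain ⟨r, hr, hrV⟩ := nhds_basis_closedBall.mem_iff.1 ((hne.and hsl).and hV₁)
  have hrne : ∀ y ∈ closedBall y₀ r, y ≠ y₀ → f (x₀, y) i ≠ 0 := fun y hy => (hrV hy).1.1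
  have hrcd : ∀ y ∈ closedBall y₀ r, ContDiffAt ℂ 1 f (x₀, y) := fun y hy => (hrV hy).1.2
  obtain ⟨k, a, ha, hprod⟩ := exists_roots (h := fun q => f q i) hr
    (fun y hy => contDiffAt_pi.1 (hrcd y hy) i)
    (fun y hy => hrne y (sphere_subset_closedBall hy) (by
      rintro rfl
      rw [mem_sphere, dist_self] at hy
      exact hr.ne hy))
  -- Whether all components of `f` vanish at one of the `k` roots is detected by the products over
  -- the roots of these `k * c + 1` linear combinations. The products are symmetric in the roots,
  -- hence holomorphic in `x`.
  let G : Fin (k * c + 1) → E × ℂ → ℂ := fun s q => ∑ j : Fin c, (s : ℂ) ^ (j : ℕ) * f q j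
  refine ⟨U₁ ∩ _, inter_mem hU₁ ha, ball y₀ r, ball_mem_nhds _ hr, ?_, k * c + 1,
    fun x s => ∏ j, G s (x, a x j), ?_, ?_⟩
  · exact (prod_mono inter_subset_left fun y hy => (hrV (ball_subset_closedBall hy)).2).trans hUV
  · refine contDiffAt_pi.2 fun s => hprod (G s) fun y hy => ?_
    exact ContDiffAt.sum fun j _ => contDiffAt_const.mul (contDiffAt_pi.1 (hrcd y hy) j)
  · rintro x ⟨-, hx1, hx2⟩
    constructor
    · rintro ⟨y, hy, h0⟩
      obtain ⟨j, rfl⟩ := (hx2 y (ball_subset_closedBall hy)).1 (congrFun h0 i)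
      refine funext fun s => Finset.prod_eq_zero (Finset.mem_univ j) ?_
      simp [G, h0]
    · intro h0
      obtain ⟨j, hj⟩ := exists_eq_zero_of_prod_eq_zero (fun j => f (x, a x j))
        (fun s => congrFun h0 s)
      exact ⟨a x j, hx1 j, hj⟩

/-- Elimination of several variables. -/
lemma exists_eliminant_pi {q : ℕ} : ∀ {c : ℕ} {f : E × (Fin q → ℂ) → (Fin c → ℂ)} {x₀ : E}
    {y₀ : Fin q → ℂ}, ContDiffAt ℂ 1 f (x₀, y₀) → f (x₀, y₀) = 0 →
    (∀ᶠ y in 𝓝 y₀, f (x₀, y) = 0 → y = y₀) → ∀ {N : Set (E × (Fin q → ℂ))}, N ∈ 𝓝 (x₀, y₀) →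
    ∃ N' ⊆ N, N' ∈ 𝓝 (x₀, y₀) ∧ ∃ (c' : ℕ) (g : E → (Fin c' → ℂ)),
      ContDiffAt ℂ 1 g x₀ ∧ ∀ᶠ x in 𝓝 x₀, ((∃ y, (x, y) ∈ N' ∧ f (x, y) = 0) ↔ g x = 0) := by
  induction q with
  | zero =>
    intro c f x₀ y₀ hf hf0 _ N hN
    refine ⟨N, Subset.rfl, hN, c, fun x => f (x, y₀), ?_, ?_⟩
    · exact ContDiffAt.comp (f := fun x => (x, y₀)) x₀ hf (by fun_prop)
    · have h1 : ∀ᶠ x in 𝓝 x₀, (x, y₀) ∈ N :=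
        (Continuous.prodMk_left y₀).continuousAt.eventually hN
      filter_upwards [h1] with x hx
      constructor
      · rintro ⟨y, -, hy⟩
        rwa [Subsingleton.elim y₀ y]
      · exact fun h => ⟨y₀, hx, h⟩
  | succ q ih =>
    intro c f x₀ y₀ hf hf0 hiso N hN
    -- The coordinate `y 0` is eliminated with the remaining ones as additional parameters; the
    -- induction hypothesis then eliminates these from the resulting eliminant.
    let e : (E × (Fin q → ℂ)) × ℂ → E × (Fin (q + 1) → ℂ) := fun p => (p.1.1, Fin.cons p.2 p.1.2)
    have he : ContDiff ℂ 1 e := by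
      refine ContDiff.prodMk (by fun_prop) ?_
      refine contDiff_pi.2 fun i => ?_
      refine Fin.cases ?_ (fun j => ?_) i
      · simp only [Fin.cons_zero]; fun_prop
      · simp only [Fin.cons_succ]; fun_prop
    have he0 : e ((x₀, Fin.tail y₀), y₀ 0) = (x₀, y₀) := by
      simp [e]
    have hiso' : ∀ᶠ y in 𝓝 (Fin.tail y₀, y₀ 0), f (x₀, Fin.cons y.2 y.1) = 0 →
        y = (Fin.tail y₀, y₀ 0) := by
      have hc : ContinuousAt (fun y : (Fin q → ℂ) × ℂ => (Fin.cons y.2 y.1 : Fin (q + 1) → ℂ))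
          (Fin.tail y₀, y₀ 0) := by
        have := (continuous_snd.comp he.continuous).comp
          ((Continuous.prodMk_right x₀).prodMap (continuous_id (X := ℂ)))
        exact this.continuousAt
      have h0 : (Fin.cons (y₀ 0) (Fin.tail y₀) : Fin (q + 1) → ℂ) = y₀ := Fin.cons_self_tail y₀
      have := hc.tendsto
      simp only [h0] at this
      filter_upwards [this.eventually hiso] with y hy h1
      have h2 := hy h1
      rw [← h2]
      simp
    have hN' : e ⁻¹' N ∈ 𝓝 ((x₀, Fin.tail y₀), y₀ 0) :=
      he.continuous.continuousAt.preimage_mem_nhds (by rwa [he0])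
    -- Keeping the first elimination inside this neighbourhood ensures that a zero of the eliminant
    -- over `x₀` comes from `y₀`, which is the isolation hypothesis for the second elimination.
    have hI : {p : (E × (Fin q → ℂ)) × ℂ | f (x₀, Fin.cons p.2 p.1.2) = 0 →
        (p.1.2, p.2) = (Fin.tail y₀, y₀ 0)} ∈ 𝓝 ((x₀, Fin.tail y₀), y₀ 0) :=
      ContinuousAt.preimage_mem_nhds (f := fun p : (E × (Fin q → ℂ)) × ℂ => (p.1.2, p.2))
        (x := ((x₀, Fin.tail y₀), y₀ 0)) (by fun_prop) hiso'
    obtain ⟨U, hU, V, hV, hUV, c', g, hg, hfg⟩ := exists_eliminant (f := f ∘ e)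
      (x₀ := (x₀, Fin.tail y₀)) (y₀ := y₀ 0)
      (ContDiffAt.comp _ (by rwa [he0]) he.contDiffAt) (by rw [Function.comp_apply, he0, hf0])
      (by
        have h1 := (Continuous.prodMk_right (Fin.tail y₀)).continuousAt (x := y₀ 0)
          |>.eventually hiso'
        filter_upwards [h1] with y hy h0
        exact (Prod.ext_iff.1 (hy h0)).2)
      (inter_mem hN' hI)
    have hU0 := mem_of_mem_nhds hU
    obtain ⟨N₂, hN₂, hN₂n, c'', g', hg', hfg'⟩ := ih hg
      ((hfg _ hU0).1 ⟨y₀ 0, mem_of_mem_nhds hV, by rw [Function.comp_apply, he0, hf0]⟩)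
      (by
        have h1 : ∀ᶠ y in 𝓝 (Fin.tail y₀), (x₀, y) ∈ U :=
          (Continuous.prodMk_right x₀).continuousAt.eventually hU
        filter_upwards [h1] with y hy h0
        obtain ⟨t, ht, hft⟩ := (hfg _ hy).2 h0
        have := (hUV (show ((x₀, y), t) ∈ U ×ˢ V from ⟨hy, ht⟩)).2 hft
        exact (Prod.ext_iff.1 this).1)
      hU
    have hsplit : ∀ y : Fin (q + 1) → ℂ, (Fin.cons (y 0) (Fin.tail y) : Fin (q + 1) → ℂ) = y :=
      Fin.cons_self_tail
    refine ⟨{p | (p.1, Fin.tail p.2) ∈ N₂ ∧ p.2 0 ∈ V}, ?_, ?_, c'', g', hg', ?_⟩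
    · rintro ⟨x, y⟩ ⟨h1, h2⟩
      have := (hUV (show ((x, Fin.tail y), y 0) ∈ U ×ˢ V from ⟨hN₂ h1, h2⟩)).1
      simpa [e] using this
    · have hc : Continuous fun p : E × (Fin (q + 1) → ℂ) => ((p.1, Fin.tail p.2), p.2 0) := by
        unfold Fin.tail
        fun_prop
      exact hc.continuousAt.preimage_mem_nhds (x := (x₀, y₀)) (prod_mem_nhds hN₂n hV)
    · filter_upwards [hfg'] with x hx
      rw [← hx]
      constructor
      · rintro ⟨y, ⟨h1, h2⟩, h3⟩
        exact ⟨Fin.tail y, h1, (hfg _ (hN₂ h1)).1 ⟨y 0, h2, by simpa [e] using h3⟩⟩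
      · rintro ⟨y, h1, h2⟩
        obtain ⟨t, ht, h3⟩ := (hfg _ (hN₂ h1)).2 h2
        exact ⟨Fin.cons t y, ⟨by simpa using h1, by simpa using ht⟩, h3⟩

/-- The identity theorem for holomorphic functions of several variables, in a ball. -/
lemma eq_zero_of_eventually_eq_zero_ball {F : Type*} [NormedAddCommGroup F] [NormedSpace ℂ F]
    [CompleteSpace F] {g : E → F} {x₀ x₁ : E} {ρ : ℝ}
    (hg : ∀ x ∈ ball x₀ ρ, DifferentiableAt ℂ g x) (hx₁ : x₁ ∈ ball x₀ ρ)
    (h0 : ∀ᶠ x in 𝓝 x₁, g x = 0) {x : E} (hx : x ∈ ball x₀ ρ) : g x = 0 := by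
  -- On the complex line through `x₁` and `x` the ball cuts out a convex set, so the one-variable
  -- identity theorem applies.
  let l : ℂ → E := fun t => x₁ + t • (x - x₁)
  have hl : Differentiable ℂ l := by
    intro t
    exact ((differentiableAt_id).smul_const (x - x₁)).const_add x₁
  have hconv : Convex ℝ (l ⁻¹' ball x₀ ρ) := by
    have : l = fun t => ((ContinuousLinearMap.toSpanSingleton ℂ (x - x₁)).restrictScalars ℝ) t
        + x₁ := by
      funext t
      simp [l, add_comm]
    rw [this]
    exact ((convex_ball x₀ ρ).translate_preimage_left x₁).is_linear_preimage
      ((ContinuousLinearMap.toSpanSingleton ℂ (x - x₁)).restrictScalars ℝ).isLinear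
  have hopen : IsOpen (l ⁻¹' ball x₀ ρ) := isOpen_ball.preimage hl.continuous
  have hd : DifferentiableOn ℂ (g ∘ l) (l ⁻¹' ball x₀ ρ) := fun t ht =>
    ((hg _ ht).comp t (hl t)).differentiableWithinAt
  have h0' : (g ∘ l) =ᶠ[𝓝 0] 0 := by
    have : Tendsto l (𝓝 0) (𝓝 x₁) := by simpa [l] using hl.continuous.tendsto 0
    exact this.eventually h0
  have := (hd.analyticOnNhd hopen).eqOn_zero_of_preconnected_of_eventuallyEq_zero
    hconv.isPreconnected (z₀ := 0) (by simpa [l] using hx₁) h0'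
  simpa [l] using this (show (1 : ℂ) ∈ l ⁻¹' ball x₀ ρ by simpa [l] using hx)

/-- If the projection of a holomorphic zero set has, arbitrarily close to a point which is
isolated in its fibre, interior points, then it is a neighbourhood of the image of that point. -/
lemma image_mem_nhds_of_isolated {q c : ℕ} {f : E × (Fin q → ℂ) → (Fin c → ℂ)} {x₀ : E}
    {y₀ : Fin q → ℂ} (hf : ContDiffAt ℂ 1 f (x₀, y₀)) (hf0 : f (x₀, y₀) = 0)
    (hiso : ∀ᶠ y in 𝓝 y₀, f (x₀, y) = 0 → y = y₀)
    (hint : ∀ N ∈ 𝓝 (x₀, y₀), ∃ p ∈ N, ∀ᶠ x in 𝓝 p.1, ∃ y, (x, y) ∈ N ∧ f (x, y) = 0)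
    {N : Set (E × (Fin q → ℂ))} (hN : N ∈ 𝓝 (x₀, y₀)) :
    ∀ᶠ x in 𝓝 x₀, ∃ y, (x, y) ∈ N ∧ f (x, y) = 0 := by
  obtain ⟨N', hN'N, hN', c', g, hg, hfg⟩ := exists_eliminant_pi hf hf0 hiso hN
  have hgd : ∀ᶠ x in 𝓝 x₀, DifferentiableAt ℂ g x :=
    (hg.eventually (by simp)).mono fun x hx => hx.differentiableAt one_ne_zero
  obtain ⟨ρ, hρ, hball⟩ := Metric.mem_nhds_iff.1 (hgd.and hfg)
  have hB : (Prod.fst ⁻¹' ball x₀ ρ : Set (E × (Fin q → ℂ))) ∈ 𝓝 (x₀, y₀) :=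
    continuous_fst.continuousAt.preimage_mem_nhds (ball_mem_nhds _ hρ)
  obtain ⟨p, hp, hpe⟩ := hint _ (inter_mem hN' hB)
  -- An interior point of the projection makes the eliminant vanish on an open set, hence on the
  -- whole ball; every `x` in the ball then has a preimage.
  have h0 : ∀ᶠ x in 𝓝 p.1, g x = 0 := by
    filter_upwards [hpe] with x ⟨y, hy, hfy⟩
    exact (hball hy.2).2.1 ⟨y, hy.1, hfy⟩
  filter_upwards [ball_mem_nhds x₀ hρ] with x hx
  obtain ⟨y, hy, hfy⟩ := (hball hx).2.2
    (eq_zero_of_eventually_eq_zero_ball (fun x hx => (hball hx).1) hp.2 h0 hx)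
  exact ⟨y, hN'N hy, hfy⟩

end Elimination

/-! ### Composition with an analytic function, as an operator on continuous functions -/

section Composition

variable {K : Type*} [TopologicalSpace K] [CompactSpace K]
  {V : Type*} [NormedAddCommGroup V] [NormedSpace ℂ V]
  {W : Type*} [NormedAddCommGroup W] [NormedSpace ℂ W]

/-- A continuous multilinear map, applied pointwise to continuous functions. -/
noncomputable def pointwiseMultilinear (K : Type*) [TopologicalSpace K] [CompactSpace K] {k : ℕ}
    (p : V [×k]→L[ℂ] W) : C(K, V) [×k]→L[ℂ] C(K, W) :=
  MultilinearMap.mkContinuous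
    { toFun := fun Y => ⟨fun s => p fun i => Y i s, by fun_prop⟩
      map_update_add' := by
        intro _ Y i a b
        ext s
        have h : ∀ c : C(K, V), (fun j => (Function.update Y i c) j s)
            = Function.update (fun j => Y j s) i (c s) := by
          intro c
          funext j
          by_cases hj : j = i
          · subst hj; simp
          · simp [hj]
        simp only [ContinuousMap.coe_mk, ContinuousMap.add_apply, h]
        exact p.map_update_add _ _ _ _
      map_update_smul' := by
        intro _ Y i c a
        ext s
        have h : ∀ c : C(K, V), (fun j => (Function.update Y i c) j s)
            = Function.update (fun j => Y j s) i (c s) := by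
          intro c
          funext j
          by_cases hj : j = i
          · subst hj; simp
          · simp [hj]
        simp only [ContinuousMap.coe_mk, ContinuousMap.smul_apply, h]
        exact p.map_update_smul _ _ _ _ } ‖p‖ (by
      intro Y
      rw [ContinuousMap.norm_le _ (by positivity)]
      intro s
      refine (p.le_opNorm _).trans ?_
      refine mul_le_mul_of_nonneg_left ?_ (norm_nonneg _)
      exact Finset.prod_le_prod (fun _ _ => norm_nonneg _)
        fun i _ => (Y i).norm_coe_le_norm s)

lemma norm_pointwiseMultilinear_le {k : ℕ} (p : V [×k]→L[ℂ] W) :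
    ‖pointwiseMultilinear K p‖ ≤ ‖p‖ :=
  MultilinearMap.mkContinuous_norm_le _ (norm_nonneg _) _

open Classical in
/-- The function `s ↦ g (Y s)`, with a junk value if it is not continuous. -/
noncomputable def compMap (g : V → W) (Y : C(K, V)) : C(K, W) :=
  if h : Continuous fun s => g (Y s) then ⟨fun s => g (Y s), h⟩ else 0

set_option linter.unusedSectionVars false in
lemma eventually_compMap {g : V → W} (hg : ∀ᶠ v in 𝓝 0, ContinuousAt g v) :
    ∀ᶠ Y : C(K, V) in 𝓝 0, ∀ s, compMap g Y s = g (Y s) := by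
  obtain ⟨r, hr, hball⟩ := Metric.mem_nhds_iff.1 hg
  filter_upwards [Metric.ball_mem_nhds (0 : C(K, V)) hr] with Y hY s
  have hc : Continuous fun s => g (Y s) := by
    refine continuous_iff_continuousAt.2 fun t => ?_
    refine ContinuousAt.comp (g := g) (hball ?_) Y.continuous.continuousAt
    rw [mem_ball_zero_iff] at hY ⊢
    exact (Y.norm_coe_le_norm t).trans_lt hY
  simp [compMap, hc]

/-- The power series of `g`, applied pointwise, is a power series between function spaces. Its
coefficients have no larger norms, so its radius is at least as large. -/
lemma analyticAt_compMap [CompleteSpace W] {g : V → W} (hg : AnalyticAt ℂ g 0) :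
    AnalyticAt ℂ (compMap (K := K) g) 0 := by
  obtain ⟨p, r, hp⟩ := hg
  let Q : FormalMultilinearSeries ℂ C(K, V) C(K, W) := fun k => pointwiseMultilinear K (p k)
  have hrad : r ≤ Q.radius := hp.r_le.trans
    (FormalMultilinearSeries.radius_le_of_le fun k => norm_pointwiseMultilinear_le (p k))
  have hQ := Q.hasFPowerSeriesOnBall (hp.r_pos.trans_le hrad)
  have hcont : ∀ᶠ v in 𝓝 (0 : V), ContinuousAt g v :=
    (hp.analyticAt.eventually_analyticAt).mono fun v hv => hv.continuousAt
  refine hQ.analyticAt.congr ?_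
  filter_upwards [eventually_compMap (K := K) hcont,
    Metric.eball_mem_nhds (0 : C(K, V)) hp.r_pos] with Y hY hYr
  ext s
  rw [hY s]
  have h1 := (Q.hasSum (x := Y) (Metric.eball_subset_eball hrad hYr)).mapL
    (ContinuousMap.evalCLM ℂ s)
  have hYs : Y s ∈ Metric.eball (0 : V) r := by
    rw [Metric.mem_eball, edist_zero_right] at hYr ⊢
    refine lt_of_le_of_lt ?_ hYr
    rw [enorm_le_iff_norm_le]
    exact Y.norm_coe_le_norm s
  have h2 := hp.hasSum hYs
  rw [zero_add] at h2
  exact h1.unique h2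

end Composition

/-! ### Total differential equations -/

section Frobenius

open MeasureTheory

/-- The unit interval. -/
abbrev UI : Type := Icc (0 : ℝ) 1

/-- The extension of a function on the unit interval by constants. -/
noncomputable def extend (y : C(UI, ℂ)) (t : ℝ) : ℂ := y (projIcc 0 1 zero_le_one t)

lemma continuous_extend (y : C(UI, ℂ)) : Continuous (extend y) :=
  y.continuous.comp continuous_projIcc

lemma extend_of_mem (y : C(UI, ℂ)) {t : ℝ} (ht : t ∈ Icc (0 : ℝ) 1) : extend y t = y ⟨t, ht⟩ := by
  rw [extend, projIcc_of_mem _ ht]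

/-- The primitive vanishing at `0`. -/
noncomputable def primitive : C(UI, ℂ) →L[ℂ] C(UI, ℂ) :=
  LinearMap.mkContinuous
    { toFun := fun y => ⟨fun s => ∫ t in (0 : ℝ)..s, extend y t,
        (intervalIntegral.continuous_primitive
          (fun a b => (continuous_extend y).intervalIntegrable a b) 0).comp continuous_subtype_val⟩
      map_add' := by
        intro y z
        ext s
        exact intervalIntegral.integral_add ((continuous_extend y).intervalIntegrable _ _)
          ((continuous_extend z).intervalIntegrable _ _)
      map_smul' := by
        intro c y
        ext s
        exact intervalIntegral.integral_smul c (extend y) } 1 (by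
      intro y
      rw [ContinuousMap.norm_le _ (by positivity), one_mul]
      intro s
      refine (intervalIntegral.norm_integral_le_of_norm_le_const (C := ‖y‖)
        fun t _ => y.norm_coe_le_norm _).trans ?_
      refine mul_le_of_le_one_right (norm_nonneg _) ?_
      rw [sub_zero, abs_of_nonneg s.2.1]
      exact s.2.2)

lemma primitive_apply (y : C(UI, ℂ)) (s : UI) :
    primitive y s = ∫ t in (0 : ℝ)..s, extend y t := rfl

variable {E : Type*} [NormedAddCommGroup E] [NormedSpace ℂ E]

/-- The path `s ↦ (s x, y s, x)`. -/
noncomputable def radialPath : E × C(UI, ℂ) →L[ℂ] C(UI, E × ℂ × E) :=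
  LinearMap.mkContinuous
    { toFun := fun q => ⟨fun s => (((s : ℝ) : ℂ) • q.1, q.2 s, q.1), by fun_prop⟩
      map_add' := by
        intro p q
        ext s <;> simp
      map_smul' := by
        intro c q
        ext s
        · exact smul_comm (((s : ℝ) : ℂ)) c q.1
        · rfl
        · rfl } 1 (by
      intro q
      rw [ContinuousMap.norm_le _ (by positivity), one_mul]
      intro s
      refine max_le ?_ (max_le ?_ (norm_fst_le q))
      · change ‖((s : ℝ) : ℂ) • q.1‖ ≤ _
        rw [norm_smul, Complex.norm_real, Real.norm_of_nonneg s.2.1]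
        exact (mul_le_of_le_one_left (norm_nonneg _) s.2.2).trans (norm_fst_le q)
      · exact (q.2.norm_coe_le_norm s).trans (norm_snd_le q))

/-- Reparametrization `t ↦ y (s t)`. -/
noncomputable def rescale (s : UI) (y : C(UI, ℂ)) : C(UI, ℂ) :=
  ⟨fun t => y ⟨s.1 * t.1, mul_nonneg s.2.1 t.2.1, mul_le_one₀ s.2.2 t.2.1 t.2.2⟩, by fun_prop⟩

lemma norm_rescale_le (s : UI) (y : C(UI, ℂ)) : ‖rescale s y‖ ≤ ‖y‖ := by
  rw [ContinuousMap.norm_le _ (norm_nonneg _)]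
  exact fun t => y.norm_coe_le_norm _

/-- Solution of `dφ(x) x = A(x, φ(x)) x`, by the implicit function theorem in the space of
continuous functions on the unit interval. -/
lemma exists_radial_solution [CompleteSpace E] {A : E × ℂ → (E →L[ℂ] ℂ)} (hA : AnalyticAt ℂ A 0) :
    ∃ φ : E → ℂ, AnalyticAt ℂ φ 0 ∧ φ 0 = 0 ∧ ∀ᶠ x in 𝓝 0, fderiv ℂ φ x x = A (x, φ x) x := by
  let g : E × ℂ × E → ℂ := fun p => A (p.1, p.2.1) p.2.2
  have hg : AnalyticAt ℂ g 0 := by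
    have h1 : ContDiffAt ℂ ⊤ (fun p : E × ℂ × E => A (p.1, p.2.1)) 0 :=
      ContDiffAt.comp (f := fun p : E × ℂ × E => (p.1, p.2.1)) 0 hA.contDiffAt (by fun_prop)
    exact (h1.clm_apply (by fun_prop)).analyticAt
  have hgc : ∀ᶠ v in 𝓝 (0 : E × ℂ × E), ContinuousAt g v :=
    hg.eventually_analyticAt.mono fun v hv => hv.continuousAt
  -- Small zeros `(x, y)` of `Φ` are the solutions of `y(s) = ∫₀ˢ A(t x, y(t)) x dt`, the radial
  -- equation in integral form. As `Φ (0, y) = y` for small `y`, the partial derivative in `y` is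
  -- the identity.
  let Φ : E × C(UI, ℂ) → C(UI, ℂ) := fun q => q.2 - primitive (compMap g (radialPath q))
  have hΦ : AnalyticAt ℂ Φ 0 := by
    refine analyticAt_snd.sub ?_
    refine (primitive.analyticAt _).comp ?_
    have h1 : AnalyticAt ℂ (compMap (K := UI) g) (radialPath (0 : E × C(UI, ℂ))) := by
      rw [map_zero]
      exact analyticAt_compMap hg
    have h2 : AnalyticAt ℂ (fun q : E × C(UI, ℂ) => radialPath q) 0 :=
      ContinuousLinearMap.analyticAt (radialPath (E := E)) 0
    exact AnalyticAt.comp (g := compMap (K := UI) g) (f := fun q : E × C(UI, ℂ) => radialPath q) h1 h2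
  have hcomp : ∀ᶠ q : E × C(UI, ℂ) in 𝓝 0, ∀ s,
      compMap g (radialPath q) s = A (((s : ℝ) : ℂ) • q.1, q.2 s) q.1 := by
    have h1 := radialPath (E := E).continuous.tendsto 0
    rw [map_zero] at h1
    exact h1.eventually (eventually_compMap hgc)
  have hΦ0 : ∀ᶠ y : C(UI, ℂ) in 𝓝 0, Φ (0, y) = y := by
    have h1 := (Continuous.prodMk_right (0 : E)).continuousAt (x := (0 : C(UI, ℂ)))
      |>.eventually hcomp
    filter_upwards [h1] with y hy
    have : compMap g (radialPath ((0 : E), y)) = 0 := by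
      ext s
      rw [hy s]
      simp
    simp [Φ, this]
  have hcd : ContDiffAt ℂ ⊤ Φ ((0 : E), (0 : C(UI, ℂ))) := hΦ.contDiffAt
  have hinv : (fderiv ℂ Φ ((0 : E), (0 : C(UI, ℂ))) ∘L .inr ℂ E C(UI, ℂ)).IsInvertible := by
    have h1 : HasFDerivAt (fun y : C(UI, ℂ) => Φ (0, y))
        (fderiv ℂ Φ ((0 : E), (0 : C(UI, ℂ))) ∘L .inr ℂ E C(UI, ℂ)) 0 :=
      (hΦ.differentiableAt.hasFDerivAt (x := ((0 : E), (0 : C(UI, ℂ))))).comp 0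
        (hasFDerivAt_prodMk_right 0 0)
    have h2 : HasFDerivAt (fun y : C(UI, ℂ) => Φ (0, y)) (ContinuousLinearMap.id ℂ _) 0 :=
      (hasFDerivAt_id 0).congr_of_eventuallyEq hΦ0
    rw [h1.unique h2]
    exact ⟨ContinuousLinearEquiv.refl ℂ _, rfl⟩
  let ψ := hcd.implicitFunction (by simp) hinv
  have hψan : AnalyticAt ℂ ψ 0 := (hcd.contDiffAt_implicitFunction (by simp) hinv).analyticAt
  have hψ0 : ψ 0 = 0 := hcd.implicitFunction_apply_self (by simp) hinv
  have hΦz : Φ (0, 0) = 0 := hΦ0.self_of_nhds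
  have huniq : ∀ᶠ v in 𝓝 ((0 : E), (0 : C(UI, ℂ))), Φ v = 0 ↔ ψ v.1 = v.2 := by
    have := hcd.eventually_apply_eq_iff_implicitFunction (by simp) hinv
    rwa [hΦz] at this
  have hψc : Tendsto ψ (𝓝 0) (𝓝 0) := by simpa [hψ0] using hψan.continuousAt.tendsto
  -- all the conditions hold in a product of balls
  rw [show (0 : E × C(UI, ℂ)) = (0, 0) from rfl] at hcomp
  obtain ⟨δ, hδ, hδb⟩ := Metric.mem_nhds_iff.1 (huniq.and hcomp)
  have hsmall : ∀ x : E, ∀ y : C(UI, ℂ), ‖x‖ < δ → ‖y‖ < δ →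
      (x, y) ∈ Metric.ball ((0 : E), (0 : C(UI, ℂ))) δ := by
    intro x y hx hy
    rw [← Prod.zero_eq_mk, mem_ball_zero_iff, Prod.norm_def]
    exact max_lt hx hy
  have hψsmall : ∀ᶠ x in 𝓝 (0 : E), ‖x‖ < δ ∧ ‖ψ x‖ < δ := by
    have h1 : ∀ᶠ y in 𝓝 (0 : C(UI, ℂ)), ‖y‖ < δ := by
      filter_upwards [Metric.ball_mem_nhds (0 : C(UI, ℂ)) hδ] with y hy
      exact mem_ball_zero_iff.1 hy
    have h2 : ∀ᶠ y in 𝓝 (0 : E), ‖y‖ < δ := by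
      filter_upwards [Metric.ball_mem_nhds (0 : E) hδ] with y hy
      exact mem_ball_zero_iff.1 hy
    exact h2.and (hψc.eventually h1)
  have hint : ∀ x : E, ‖x‖ < δ → ‖ψ x‖ < δ → ∀ s : UI,
      ψ x s = ∫ t in (0 : ℝ)..s, A ((t : ℂ) • x, extend (ψ x) t) x := by
    intro x h1 h2 s
    obtain ⟨h3, h4⟩ := hδb (hsmall x _ h1 h2)
    have h5 : Φ (x, ψ x) = 0 := h3.2 rfl
    have h6 := congrArg (fun y : C(UI, ℂ) => y s) (sub_eq_zero.1 h5)
    simp only [primitive_apply] at h6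
    rw [h6]
    refine intervalIntegral.integral_congr fun t ht => ?_
    rw [uIcc_of_le s.2.1] at ht
    have ht' : t ∈ Icc (0 : ℝ) 1 := ⟨ht.1, ht.2.trans s.2.2⟩
    simp only [extend_of_mem _ ht']
    exact h4 ⟨t, ht'⟩
  -- The path `t ↦ ψ x (s t)` solves the integral equation of `s x`, so the uniqueness in the
  -- implicit function theorem identifies it with `ψ (s x)`. Hence `φ(x) = ψ x 1` determines the
  -- solution along the entire ray.
  have hscale : ∀ x : E, ‖x‖ < δ → ‖ψ x‖ < δ → ∀ s : UI,
      ψ (((s : ℝ) : ℂ) • x) = rescale s (ψ x) := by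
    intro x h1 h2 s
    have hsx : ‖((s : ℝ) : ℂ) • x‖ < δ := by
      rw [norm_smul, Complex.norm_real, Real.norm_of_nonneg s.2.1]
      exact (mul_le_of_le_one_left (norm_nonneg _) s.2.2).trans_lt h1
    obtain ⟨h3, h4⟩ := hδb (hsmall _ _ hsx ((norm_rescale_le s (ψ x)).trans_lt h2))
    refine h3.1 ?_
    refine sub_eq_zero.2 ?_
    ext t
    change ψ x _ = primitive _ t
    rw [hint x h1 h2, primitive_apply]
    change ∫ τ in (0 : ℝ)..(s.1 * t.1), A ((τ : ℂ) • x, extend (ψ x) τ) x = _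
    have hsub := intervalIntegral.smul_integral_comp_mul_left (a := 0) (b := t.1)
      (fun τ : ℝ => A ((τ : ℂ) • x, extend (ψ x) τ) x) s.1
    rw [mul_zero] at hsub
    rw [← hsub, ← intervalIntegral.integral_smul]
    refine intervalIntegral.integral_congr fun τ hτ => ?_
    rw [uIcc_of_le t.2.1] at hτ
    have hτ' : τ ∈ Icc (0 : ℝ) 1 := ⟨hτ.1, hτ.2.trans t.2.2⟩
    have hsτ : s.1 * τ ∈ Icc (0 : ℝ) 1 := ⟨mul_nonneg s.2.1 hτ.1, mul_le_one₀ s.2.2 hτ.1 hτ'.2⟩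
    simp only [extend_of_mem _ hτ', extend_of_mem _ hsτ]
    refine Eq.trans ?_ (h4 ⟨τ, hτ'⟩).symm
    rw [map_smul]
    have e1 : ((s.1 * τ : ℝ) : ℂ) • x = (τ : ℂ) • (s.1 : ℂ) • x := by
      rw [smul_smul, Complex.ofReal_mul, mul_comm]
    rw [e1]
    rfl
  have hφan : AnalyticAt ℂ (fun x => ψ x 1) 0 :=
    ((ContinuousMap.evalCLM ℂ (1 : UI) : C(UI, ℂ) →L[ℂ] ℂ).analyticAt _).comp hψan
  refine ⟨fun x => ψ x 1, hφan, by simp [hψ0], ?_⟩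
  · have h2x : Tendsto (fun x : E => (2 : ℂ) • x) (𝓝 0) (𝓝 0) := by
      simpa using (continuous_const_smul (2 : ℂ)).tendsto (0 : E)
    have hAev : ∀ᶠ x in 𝓝 (0 : E), ContinuousAt A (x, ψ x 1) := by
      have h1 : Tendsto (fun x => (x, ψ x 1)) (𝓝 0) (𝓝 ((0 : E), (0 : ℂ))) := by
        have := (continuousAt_id.prodMk hφan.continuousAt).tendsto (x := (0 : E))
        simpa [hψ0] using this
      exact h1.eventually (hA.eventually_analyticAt.mono fun p hp => hp.continuousAt)
    filter_upwards [h2x.eventually hψsmall, hφan.eventually_analyticAt, hAev] with x hx hxa hxA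
    -- With `z = 2 x`, the point `x` lies at the interior time `1/2` of the path of `z`, where
    -- two-sided derivatives are available.
    let z : E := (2 : ℂ) • x
    have hhalf : (1 / 2 : ℝ) ∈ Icc (0 : ℝ) 1 := ⟨by norm_num, by norm_num⟩
    have hzx : (((1 / 2 : ℝ) : ℝ) : ℂ) • z = x := by
      simp [z, smul_smul]
    have hrel : ∀ t : ℝ, ∀ ht : t ∈ Icc (0 : ℝ) 1, ψ ((t : ℂ) • z) 1 = ψ z ⟨t, ht⟩ := by
      intro t ht
      rw [hscale z hx.1 hx.2 ⟨t, ht⟩]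
      change ψ z ⟨t * 1, _⟩ = _
      congr 1
      exact Subtype.ext (mul_one t)
    have hval : extend (ψ z) (1 / 2) = ψ x 1 := by
      rw [extend_of_mem _ hhalf, ← hrel _ hhalf, hzx]
    -- the derivative along the ray, computed in two ways
    have hd1 : HasDerivAt (fun t : ℝ => ψ ((t : ℂ) • z) 1)
        (fderiv ℂ (fun x => ψ x 1) x z) (1 / 2) := by
      have hl : HasDerivAt (fun t : ℝ => (t : ℂ) • z) ((1 : ℂ) • z) (1 / 2) :=
        (Complex.ofRealCLM.hasDerivAt (x := (1 / 2 : ℝ))).smul_const z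
      rw [one_smul] at hl
      have hf := (hxa.differentiableAt.hasFDerivAt).restrictScalars ℝ
      rw [← hzx] at hf
      have := hf.comp_hasDerivAt (1 / 2 : ℝ) hl
      rwa [hzx] at this
    have hd2 : HasDerivAt (fun t : ℝ => ∫ τ in (0 : ℝ)..t, A ((τ : ℂ) • z, extend (ψ z) τ) z)
        (A (x, ψ x 1) z) (1 / 2) := by
      have hcon : ContinuousOn (fun τ : ℝ => A ((τ : ℂ) • z, extend (ψ z) τ) z) (Icc 0 1) := by
        have h4 := (hδb (hsmall z _ hx.1 hx.2)).2
        refine ((continuous_extend (compMap g (radialPath (z, ψ z)))).continuousOn).congr ?_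
        intro τ hτ
        simp only [extend_of_mem _ hτ]
        exact (h4 ⟨τ, hτ⟩).symm
      have hnhds : Icc (0 : ℝ) 1 ∈ 𝓝 (1 / 2 : ℝ) := Icc_mem_nhds (by norm_num) (by norm_num)
      have := intervalIntegral.integral_hasDerivAt_right
        (f := fun τ : ℝ => A ((τ : ℂ) • z, extend (ψ z) τ) z) (a := 0) (b := 1 / 2)
        ((hcon.mono (by
          rw [uIcc_of_le (by norm_num)]
          exact Icc_subset_Icc_right (by norm_num))).intervalIntegrable)
        (hcon.stronglyMeasurableAtFilter_nhdsWithin measurableSet_Icc _ |>.filter_mono (by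
          rw [nhdsWithin_eq_nhds.2 hnhds])) (hcon.continuousAt hnhds)
      simp only [hval] at this
      rwa [hzx] at this
    have heq : (fun t : ℝ => ψ ((t : ℂ) • z) 1) =ᶠ[𝓝 (1 / 2)]
        fun t : ℝ => ∫ τ in (0 : ℝ)..t, A ((τ : ℂ) • z, extend (ψ z) τ) z := by
      filter_upwards [Icc_mem_nhds (show (0 : ℝ) < 1 / 2 by norm_num)
        (show (1 / 2 : ℝ) < 1 by norm_num)] with t ht
      rw [hrel t ht, hint z hx.1 hx.2]
    have hfin := hd1.unique (hd2.congr_of_eventuallyEq heq)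
    rw [map_smul, map_smul] at hfin
    exact smul_right_injective ℂ (two_ne_zero) hfin

/-- **Frobenius' theorem** for the completely integrable equation `dφ(x) = A(x, φ(x))`. -/
theorem exists_solution_of_integrable [CompleteSpace E] {A : E × ℂ → (E →L[ℂ] ℂ)}
    (hA : AnalyticAt ℂ A 0)
    (hint : ∀ᶠ p in 𝓝 0, ∀ v w, fderiv ℂ A p (v, A p v) w = fderiv ℂ A p (w, A p w) v) :
    ∃ φ : E → ℂ, AnalyticAt ℂ φ 0 ∧ φ 0 = 0 ∧ ∀ᶠ x in 𝓝 0, fderiv ℂ φ x = A (x, φ x) := by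
  obtain ⟨φ, hφ, hφ0, hrad⟩ := exists_radial_solution hA
  refine ⟨φ, hφ, hφ0, ?_⟩
  have hg : Tendsto (fun x => (x, φ x)) (𝓝 0) (𝓝 (0 : E × ℂ)) := by
    have := (continuousAt_id (x := (0 : E))).prodMk hφ.continuousAt
    simpa only [ContinuousAt, hφ0, id, ← Prod.zero_eq_mk] using this
  obtain ⟨K, hK⟩ : ∃ K : ℝ, ∀ᶠ p in 𝓝 (0 : E × ℂ), ‖fderiv ℂ A p‖ ≤ K := by
    refine ⟨‖fderiv ℂ A 0‖ + 1, ?_⟩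
    have := hA.fderiv.continuousAt.norm.tendsto.eventually (gt_mem_nhds (lt_add_one _))
    exact this.mono fun p hp => le_of_lt hp
  have hall := ((hφ.eventually_analyticAt.and (hg.eventually hA.eventually_analyticAt)).and
    (hrad.eventually_nhds.and (hg.eventually hint))).and (hg.eventually hK)
  obtain ⟨δ, hδ, hb⟩ := Metric.mem_nhds_iff.1 hall
  filter_upwards [Metric.ball_mem_nhds (0 : E) hδ] with x hx
  ext v
  -- the defect in the direction `v`
  let D : E → ℂ := fun y => fderiv ℂ φ y v - A (y, φ y) v
  let c : E → ℂ := fun y => fderiv ℂ A (y, φ y) (0, 1) x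
  have hball : ∀ t ∈ Icc (0 : ℝ) 1, (t : ℂ) • x ∈ Metric.ball (0 : E) δ := by
    intro t ht
    rw [mem_ball_zero_iff] at hx ⊢
    rw [norm_smul, Complex.norm_real, Real.norm_of_nonneg ht.1]
    exact (mul_le_of_le_one_left (norm_nonneg _) ht.2).trans_lt hx
  -- The radial equation is differentiated in the direction `v`. Symmetry of the second derivative
  -- of `φ` and the integrability of `A` leave a linear equation for the defect along rays.
  have hD : ∀ y ∈ Metric.ball (0 : E) δ, ∃ D' : E →L[ℂ] ℂ, HasFDerivAt D D' y ∧
      D' y = - D y + fderiv ℂ A (y, φ y) (0, D y) y := by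
    intro y hy
    obtain ⟨⟨⟨h1, h2⟩, h3, h4⟩, -⟩ := hb hy
    have hφ2 : HasFDerivAt (fderiv ℂ φ) (fderiv ℂ (fderiv ℂ φ) y) y :=
      h1.fderiv.differentiableAt.hasFDerivAt
    have hA1 : HasFDerivAt (fun z => A (z, φ z))
        (fderiv ℂ A (y, φ y) ∘L (ContinuousLinearMap.id ℂ E).prod (fderiv ℂ φ y)) y :=
      HasFDerivAt.comp y (f := fun z => (z, φ z)) h2.differentiableAt.hasFDerivAt
        ((hasFDerivAt_id y).prodMk h1.differentiableAt.hasFDerivAt)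
    have hD1 := (hφ2.clm_apply (hasFDerivAt_const v y)).sub
      (hA1.clm_apply (hasFDerivAt_const v y))
    refine ⟨_, hD1, ?_⟩
    have hR := (hφ2.clm_apply (hasFDerivAt_id y)).sub (hA1.clm_apply (hasFDerivAt_id y))
    have hR0 := hR.unique ((hasFDerivAt_const (0 : ℂ) y).congr_of_eventuallyEq
      (h3.mono fun z hz => by simp [hz]))
    have hRv := congrArg (fun T : E →L[ℂ] ℂ => T v) hR0
    have hsym : fderiv ℂ (fderiv ℂ φ) y y v = fderiv ℂ (fderiv ℂ φ) y v y :=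
      (h1.contDiffAt (n := ⊤)).isSymmSndFDerivAt (by simp) y v
    have hy1 : fderiv ℂ φ y y = A (y, φ y) y := h3.self_of_nhds
    have hiv := h4 v y
    have hlin : fderiv ℂ A (y, φ y) (0, D y) =
        fderiv ℂ A (y, φ y) (v, fderiv ℂ φ y v) - fderiv ℂ A (y, φ y) (v, A (y, φ y) v) := by
      rw [← map_sub]
      simp [D]
    simp at hRv ⊢
    rw [hlin, hsym, hy1, ← hiv]
    simp only [_root_.sub_apply, D]
    linear_combination hRv
  -- The factor `t` absorbs the term `- D y`: `e` solves `e' = c e` and starts at zero, so it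
  -- vanishes by Grönwall's inequality.
  let e : ℝ → ℂ := fun t => (t : ℂ) * D ((t : ℂ) • x)
  have he : ∀ t ∈ Icc (0 : ℝ) 1, HasDerivAt e (c ((t : ℂ) • x) * e t) t := by
    intro t ht
    obtain ⟨D', h1, h2⟩ := hD _ (hball t ht)
    have h3 : HasDerivAt (fun s : ℝ => (s : ℂ)) 1 t := Complex.ofRealCLM.hasDerivAt
    have h4 : HasDerivAt (fun s : ℝ => (s : ℂ) • x) x t := by
      simpa using h3.smul_const x
    have h5 : HasDerivAt (fun s : ℝ => D ((s : ℂ) • x)) (D' x) t :=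
      (h1.restrictScalars ℝ).comp_hasDerivAt t h4
    have h6 := h3.mul h5
    refine h6.congr_deriv ?_
    have h7 : (t : ℂ) * D' x = D' ((t : ℂ) • x) := by simp
    have h8 : ((0 : E), D ((t : ℂ) • x)) = D ((t : ℂ) • x) • ((0 : E), (1 : ℂ)) := by simp
    rw [h7, h2, h8, map_smul, map_smul, _root_.smul_apply]
    simp only [c, e, smul_eq_mul]
    ring
  have hz : ∀ t ∈ Icc (0 : ℝ) 1, e t = 0 := by
    refine eq_zero_of_abs_deriv_le_mul_abs_self_of_eq_zero_right
      (K := K * ‖((0 : E), (1 : ℂ))‖ * ‖x‖)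
      (fun t ht => (he t ht).continuousAt.continuousWithinAt)
      (fun t ht => (he t (Ico_subset_Icc_self ht)).hasDerivWithinAt) (by simp [e]) ?_
    intro t ht
    rw [norm_mul]
    refine mul_le_mul_of_nonneg_right ?_ (norm_nonneg _)
    have hK' : ‖fderiv ℂ A ((t : ℂ) • x, φ ((t : ℂ) • x))‖ ≤ K :=
      (hb (hball t (Ico_subset_Icc_self ht))).2
    refine (ContinuousLinearMap.le_opNorm _ _).trans ?_
    refine mul_le_mul_of_nonneg_right ?_ (norm_nonneg _)
    exact (ContinuousLinearMap.le_opNorm _ _).trans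
      (mul_le_mul_of_nonneg_right hK' (norm_nonneg _))
  have h1 := hz 1 (by simp)
  simp only [e, D, Complex.ofReal_one, one_smul, one_mul] at h1
  exact sub_eq_zero.1 h1

end Frobenius

/-! ### Unramified points and local sections of a web -/

section Unramified

variable {n : ℕ} {W : Set (P n × PDual n)}

/-- In homogeneous coordinates: `z` belongs to the bicone of `W`, which is regular at `z`, and
the projection to the base is immersive there. -/
def IsUnramifiedAt (W : Set (P n × PDual n)) (z : HVec n × HVec n) : Prop :=
  z ∈ bicone W ∧ IsRegularAt (bicone W) z ∧
    ∀ v ∈ tangentSpaceAt (bicone W) z, v.1 ∈ Submodule.span ℂ {z.1} → v.2 ∈ Submodule.span ℂ {z.2}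

lemma mem_span_singleton_smul {a : ℂ} (ha : a ≠ 0) {x y : HVec n} :
    a • y ∈ Submodule.span ℂ {a • x} ↔ y ∈ Submodule.span ℂ {x} := by
  rw [Submodule.span_singleton_smul_eq (IsUnit.mk0 a ha), Submodule.smul_mem_iff _ ha]

lemma isUnramifiedAt_scale₂ {a b : ℂ} (ha : a ≠ 0) (hb : b ≠ 0) {z : HVec n × HVec n}
    (hz : IsUnramifiedAt W z) : IsUnramifiedAt W (scale₂ ha hb z) := by
  obtain ⟨h1, ⟨k, h2⟩, h3⟩ := hz
  have hT := scale₂_mem_bicone ha hb W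
  refine ⟨(hT z).2 h1, ⟨k, h2.map_equiv _ hT⟩, fun v hv => ?_⟩
  obtain ⟨v', rfl⟩ := (scale₂ (n := n) ha hb).surjective v
  rw [map_mem_tangentSpaceAt_iff _ hT] at hv
  intro h4
  exact (mem_span_singleton_smul hb).2 (h3 v' hv ((mem_span_singleton_smul ha).1 h4))

lemma isUnramifiedAt_scale₂_iff {a b : ℂ} (ha : a ≠ 0) (hb : b ≠ 0) {z : HVec n × HVec n} :
    IsUnramifiedAt W (scale₂ ha hb z) ↔ IsUnramifiedAt W z := by
  refine ⟨fun h => ?_, isUnramifiedAt_scale₂ ha hb⟩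
  have := isUnramifiedAt_scale₂ (inv_ne_zero ha) (inv_ne_zero hb) h
  simpa [smul_smul, ha, hb] using this

lemma isUnramifiedAt_iff {z : HVec n × HVec n} (h₁ : z.1 ≠ 0) (h₂ : z.2 ≠ 0) :
    IsUnramifiedAt W z ↔ proj₂ z ∈ W ∧ proj₂ z ∉ criticalSet W := by
  obtain ⟨a, b, ha, hb, h⟩ := exists_scale₂_rep₂ h₁ h₂
  rw [← isUnramifiedAt_scale₂_iff ha hb, ← h]
  constructor
  · rintro ⟨h1, h2, h3⟩
    have h4 := rep₂_mem_bicone.1 h1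
    exact ⟨h4, fun hc => hc.2 ⟨⟨h4, h2⟩, h3⟩⟩
  · rintro ⟨h1, h2⟩
    have h3 : proj₂ z ∈ regularPart W ∧ ProjectionImmersiveAt W (proj₂ z) := by
      by_contra hc
      exact h2 ⟨h1, hc⟩
    exact ⟨rep₂_mem_bicone.2 h1, h3.1.2, h3.2⟩

lemma IsSubmanifoldAt.dim_eq_of_hasPureDim {E : Type*} [NormedAddCommGroup E] [NormedSpace ℂ E]
    [FiniteDimensional ℂ E] {A : Set E} {k l : ℕ} {z : E}
    (h : IsSubmanifoldAt A k z) (hp : HasPureDim A l) : k = l := by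
  obtain ⟨y, hy, hyl⟩ := ((mem_closure_iff_frequently.1 (hp h.1)).and_eventually h.eventually).exists
  exact (hyl hy.1).dim_unique hy

lemma finrank_HVec_prod : Module.finrank ℂ (HVec n × HVec n) = (n + 1) + (n + 1) := by
  simp

/-- At an unramified point, the fibre coordinates normalized by `α` are determined to first order
by local equations of the web. -/
lemma injective_fderiv_inr (hW : HasPureDim (bicone W) (n + 2)) {z : HVec n × HVec n}
    (hz : IsUnramifiedAt W z) {α : HVec n →L[ℂ] ℂ} (hα : α z.2 = 1) :
    ∃ f : HVec n × HVec n → (Fin n → ℂ), AnalyticAt ℂ f z ∧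
      Function.Injective (((fderiv ℂ f z) ∘L .inr ℂ _ _).prod α) ∧
      ∀ᶠ y in 𝓝 z, (y ∈ bicone W ↔ f y = 0) ∧ (y ∈ bicone W → IsRegularAt (bicone W) y ∧
        tangentSpaceAt (bicone W) y = (fderiv ℂ f y).ker) := by
  obtain ⟨h1, ⟨k, h2⟩, h3⟩ := hz
  obtain rfl := h2.dim_eq_of_hasPureDim hW
  obtain ⟨c, hc, f, hf, hs, hA⟩ := h2.exists_local
  rw [finrank_HVec_prod] at hc
  -- The ambient dimension is `2 n + 2` and the bicone has dimension `n + 2`, which leaves `n`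
  -- equations.
  obtain rfl : c = n := by omega
  have hT := (hA.self_of_nhds.2 h1).2
  refine ⟨f, hf, ?_, hA.mono fun y hy => ⟨hy.1, fun h => ⟨⟨_, (hy.2 h).1⟩, (hy.2 h).2⟩⟩⟩
  rw [injective_iff_map_eq_zero]
  intro v hv
  have hv1 : fderiv ℂ f z (0, v) = 0 := congrArg Prod.fst hv
  have hv2 : α v = 0 := congrArg Prod.snd hv
  have h4 : ((0 : HVec c), v) ∈ tangentSpaceAt (bicone W) z := by
    rw [hT]; exact hv1
  obtain ⟨t, ht⟩ := Submodule.mem_span_singleton.1 (h3 _ h4 (Submodule.zero_mem _))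
  have ht' : t • z.2 = v := ht
  rw [← ht', map_smul, hα, smul_eq_mul, mul_one] at hv2
  rw [← ht', hv2, zero_smul]

/-- The local section of the web through an unramified point. -/
lemma exists_section (hW : HasPureDim (bicone W) (n + 2)) {X₀ u₀ : HVec n}
    (hz : IsUnramifiedAt W (X₀, u₀)) {α : HVec n →L[ℂ] ℂ} (hα : α u₀ = 1) :
    ∃ σ : HVec n → HVec n, AnalyticAt ℂ σ X₀ ∧ σ X₀ = u₀ ∧
      ∀ᶠ z in 𝓝 (X₀, u₀), (z ∈ bicone W ∧ α z.2 = 1) ↔ σ z.1 = z.2 := by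
  obtain ⟨f, hf, hinj, hA⟩ := injective_fderiv_inr hW hz hα
  -- The `n` equations of the web and the normalization `α u = 1` are `n + 1` equations for the `n +
  -- 1` coordinates of `u`; their derivative in `u` is injective, hence invertible.
  let F : HVec n × HVec n → (Fin n → ℂ) × ℂ := fun z => (f z, α z.2 - 1)
  have hF : ContDiffAt ℂ ⊤ F (X₀, u₀) := by
    refine hf.contDiffAt.prodMk ?_
    fun_prop
  have hF0 : F (X₀, u₀) = 0 := by
    simp [F, hα, (hA.self_of_nhds.1).1 hz.1]
  have hd : HasFDerivAt F ((fderiv ℂ f (X₀, u₀)).prod (α ∘L .snd ℂ _ _)) (X₀, u₀) :=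
    hf.differentiableAt.hasFDerivAt.prodMk
      (((α ∘L ContinuousLinearMap.snd ℂ (HVec n) (HVec n)).hasFDerivAt).sub_const 1)
  have hinv : (fderiv ℂ F (X₀, u₀) ∘L .inr ℂ (HVec n) (HVec n)).IsInvertible := by
    have he : fderiv ℂ F (X₀, u₀) ∘L .inr ℂ (HVec n) (HVec n) =
        ((fderiv ℂ f (X₀, u₀)) ∘L .inr ℂ _ _).prod α := by
      rw [hd.fderiv]
      ext v <;> simp
    rw [he]
    let T := LinearEquiv.ofInjectiveOfFinrankEq
      (((fderiv ℂ f (X₀, u₀)) ∘L .inr ℂ _ _).prod α).toLinearMap hinj (by simp)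
    exact ⟨T.toContinuousLinearEquiv, by ext v <;> rfl⟩
  refine ⟨hF.implicitFunction (by simp) hinv,
    (hF.contDiffAt_implicitFunction (by simp) hinv).analyticAt,
    hF.implicitFunction_apply_self (by simp) hinv, ?_⟩
  filter_upwards [hF.eventually_apply_eq_iff_implicitFunction (by simp) hinv, hA] with z h1 h2
  rw [hF0] at h1
  rw [← h1, h2.1]
  simp [F, Prod.ext_iff, sub_eq_zero]

lemma eventually_section_mem (hX : HVec n → HVec n) {X₀ : HVec n} (h : ContinuousAt hX X₀)
    {p : HVec n × HVec n → Prop} (hp : ∀ᶠ z in 𝓝 (X₀, hX X₀), p z) :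
    ∀ᶠ X in 𝓝 X₀, p (X, hX X) :=
  (continuousAt_id.prodMk h).eventually hp

lemma exists_dual {u : HVec n} (hu : u ≠ 0) : ∃ α : HVec n →L[ℂ] ℂ, α u = 1 :=
  SeparatingDual.exists_eq_one hu

/-- Unramified points form an open subset of the web. -/
lemma eventually_isUnramifiedAt (hW : HasPureDim (bicone W) (n + 2)) {z : HVec n × HVec n}
    (hz : IsUnramifiedAt W z) : ∀ᶠ y in 𝓝 z, y ∈ bicone W → IsUnramifiedAt W y := by
  obtain ⟨h₁, h₂, -⟩ := mem_bicone.1 hz.1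
  obtain ⟨α, hα⟩ := exists_dual h₂
  obtain ⟨f, hf, hinj, hA⟩ := injective_fderiv_inr hW hz hα
  have hc : ContinuousAt (fun y => ((fderiv ℂ f y) ∘L .inr ℂ (HVec n) (HVec n)).prod α) z := by
    have h3 : ContinuousAt (fun y => (fderiv ℂ f y) ∘L .inr ℂ (HVec n) (HVec n)) z :=
      hf.fderiv.continuousAt.clm_comp continuousAt_const
    have h4 : ContinuousAt (fun y => (ContinuousLinearMap.inl ℂ (Fin n → ℂ) ℂ) ∘L
        ((fderiv ℂ f y) ∘L .inr ℂ (HVec n) (HVec n)) + (ContinuousLinearMap.inr ℂ _ _) ∘L α) z :=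
      (continuousAt_const.clm_comp h3).add continuousAt_const
    refine h4.congr (Eventually.of_forall fun y => ?_)
    ext v <;> simp
  have hinj' := hc.eventually (ContinuousLinearMap.isOpen_injective.mem_nhds hinj)
  have hα' : ∀ᶠ y in 𝓝 z, α y.2 ≠ 0 := by
    have : ContinuousAt (fun y : HVec n × HVec n => α y.2) z := by fun_prop
    exact this.eventually_ne (by rw [hα]; exact one_ne_zero)
  filter_upwards [hinj', hα', hA] with y hi ha hy hyW
  obtain ⟨hr, hT⟩ := hy.2 hyW
  refine ⟨hyW, hr, fun v hv hv1 => ?_⟩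
  obtain ⟨s, hs⟩ := Submodule.mem_span_singleton.1 hv1
  -- A scaling direction is subtracted from `v` so that the first component and the value of `α`
  -- both vanish; injectivity then kills the rest.
  have h5 := Submodule.sub_mem _ hv
    (smul_mem_tangentSpaceAt_bicone hyW s ((α y.2)⁻¹ * α v.2))
  rw [hT] at h5
  have h6 : v - (s • y.1, ((α y.2)⁻¹ * α v.2) • y.2) =
      (0, v.2 - ((α y.2)⁻¹ * α v.2) • y.2) := by
    rw [hs]
    ext <;> simp
  rw [h6] at h5
  have h7 : v.2 - ((α y.2)⁻¹ * α v.2) • y.2 = 0 := by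
    apply (injective_iff_map_eq_zero _).1 hi
    refine Prod.ext h5 ?_
    change α (v.2 - ((α y.2)⁻¹ * α v.2) • y.2) = 0
    rw [map_sub, map_smul, smul_eq_mul, mul_right_comm, inv_mul_cancel₀ ha, one_mul, sub_self]
  exact Submodule.mem_span_singleton.2 ⟨_, (sub_eq_zero.1 h7).symm⟩

lemma eventually_notMem_criticalSet (hW : HasPureDim (bicone W) (n + 2)) {w : P n × PDual n}
    (hw : w ∈ W) (hΓ : w ∉ criticalSet W) : ∀ᶠ w' in 𝓝 w, w' ∈ W → w' ∉ criticalSet W := by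
  have h1 : (rep₂ w).1 ≠ 0 := w.1.rep_nonzero
  have h2 : (rep₂ w).2 ≠ 0 := w.2.rep_nonzero
  rw [nhds_eq_map_rep₂, eventually_map]
  have h3 := eventually_isUnramifiedAt hW ((isUnramifiedAt_iff h1 h2).2 (by simp [hw, hΓ]))
  filter_upwards [h3, eventually_ne_ne h1 h2] with y hy hne hyW
  exact ((isUnramifiedAt_iff hne.1 hne.2).1 (hy (mem_bicone.2 ⟨hne.1, hne.2, hyW⟩))).2

/-- Unramified points are dense in the web. -/
lemma exists_isUnramifiedAt (hW : HasPureDim (bicone W) (n + 2))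
    (hΓ : DimLE (bicone (criticalSet W)) (n + 1)) {z : HVec n × HVec n} (hz : z ∈ bicone W)
    {N : Set (HVec n × HVec n)} (hN : N ∈ 𝓝 z) : ∃ y ∈ N, IsUnramifiedAt W y := by
  by_contra! hcon
  obtain ⟨N', hN'N, hN', hzN⟩ := mem_nhds_iff.1 hN
  obtain ⟨y, hyN, hy⟩ := mem_closure_iff.1 (hW hz) N' hN' hzN
  -- Were all points near `z` of the bicone critical, the critical set would contain a manifold
  -- piece of dimension `n + 2`, one more than allowed.
  have h1 : IsSubmanifoldAt (bicone (criticalSet W)) (n + 2) y := by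
    refine hy.congr ?_
    filter_upwards [hN'.mem_nhds hyN] with x hx
    constructor
    · intro hxW
      obtain ⟨h1, h2, h3⟩ := mem_bicone.1 hxW
      by_contra h4
      refine hcon x (hN'N hx) ((isUnramifiedAt_iff h1 h2).2 ⟨h3, fun h5 => h4 ?_⟩)
      exact mem_bicone.2 ⟨h1, h2, h5⟩
    · intro hxW
      obtain ⟨h1, h2, h3⟩ := mem_bicone.1 hxW
      exact mem_bicone.2 ⟨h1, h2, h3.1⟩
  have := hΓ _ _ h1
  omega

end Unramified

/-! ### The projection of a web to its base -/

section Openness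

variable {n : ℕ}

/-- Distinctness becomes the nonvanishing of a 2×2 minor, an open condition; this yields the
Hausdorff property. -/
lemma proj_ne_iff {u v : HVec n} (hu : u ≠ 0) (hv : v ≠ 0) :
    proj u ≠ proj v ↔ ∃ i j, u i * v j ≠ u j * v i := by
  constructor
  · intro h
    by_contra! hc
    obtain ⟨i, hi⟩ := Function.ne_iff.1 hv
    have hi' : v i ≠ 0 := hi
    have hui : u = (u i / v i) • v := by
      ext j
      have := hc i j
      simp only [Pi.smul_apply, smul_eq_mul]
      field_simp
      exact this.symm
    have h0 : u i / v i ≠ 0 := fun h0 => hu (by rw [hui, h0, zero_smul])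
    exact h (by rw [hui, proj_smul h0])
  · rintro ⟨i, j, hij⟩ h
    obtain ⟨a, -, rfl⟩ := exists_smul_of_proj_eq hu hv h
    exact hij (by simp only [Pi.smul_apply, smul_eq_mul]; ring)

instance : T2Space (P n) := by
  refine t2Space_iff_disjoint_nhds.2 fun x y hxy => ?_
  rw [← proj_rep x, ← proj_rep y] at hxy
  obtain ⟨i, j, hij⟩ := (proj_ne_iff x.rep_nonzero y.rep_nonzero).1 hxy
  have h1 : ∀ᶠ z : HVec n × HVec n in 𝓝 (x.rep, y.rep), z.1 i * z.2 j ≠ z.1 j * z.2 i := by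
    refine (isOpen_ne_fun ?_ ?_).mem_nhds hij <;> fun_prop
  obtain ⟨U, hU, V, hV, hUV⟩ := mem_nhds_prod_iff.1
    (h1.and (eventually_ne_ne (z := (x.rep, y.rep)) x.rep_nonzero y.rep_nonzero))
  rw [nhds_eq_map_rep x, nhds_eq_map_rep y]
  refine Filter.disjoint_iff.2 ⟨_, image_mem_map hU, _, image_mem_map hV, ?_⟩
  rw [Set.disjoint_left]
  rintro _ ⟨u, hu, rfl⟩ ⟨v, hv, huv⟩
  obtain ⟨h2, h3, h4⟩ := hUV (mk_mem_prod hu hv)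
  exact (proj_ne_iff h3 h4).2 ⟨i, j, h2⟩ huv.symm

variable {M : Set (P n)} {W : Set (P n × PDual n)} {d : ℕ}

/-- The projection of a web to its base is an open map, in homogeneous coordinates. -/
lemma IsWeb.eventually_exists_mem_bicone (hW : IsWeb M W d) {X₀ u₀ : HVec n} (hz : (X₀, u₀) ∈ bicone W)
    {N : Set (HVec n × HVec n)} (hN : N ∈ 𝓝 (X₀, u₀)) :
    ∀ᶠ X in 𝓝 X₀, ∃ u, (X, u) ∈ N ∧ (X, u) ∈ bicone W := by
  obtain ⟨hX, hu, hw⟩ := mem_bicone.1 hz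
  obtain ⟨α, hα⟩ := exists_dual hu
  obtain ⟨c, f, hf, hA⟩ := hW.analytic (X₀, u₀) (mem_bicone.2 ⟨hX, hu, hW.subset hw⟩)
  -- The normalization `α u = 1` is added to the equations of `W`. It selects at most one
  -- representative of each hyperplane, so the finiteness of the fibre makes `u₀` an isolated
  -- solution over `X₀`.
  let F : HVec n × (Fin (n + 1) → ℂ) → (Fin (c + 1) → ℂ) :=
    fun z => Fin.cons (α z.2 - 1) (f z)
  have hFz : ∀ z, F z = 0 ↔ α z.2 = 1 ∧ f z = 0 := by
    intro z
    rw [← sub_eq_zero (a := α z.2), funext_iff, Fin.forall_fin_succ, funext_iff]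
    rfl
  have hF : ContDiffAt ℂ 1 F (X₀, u₀) := by
    rw [contDiffAt_pi]
    intro i
    refine Fin.cases ?_ (fun j => ?_) i
    · change ContDiffAt ℂ 1 (fun z : HVec n × HVec n => α z.2 - 1) (X₀, u₀)
      fun_prop
    · exact (contDiffAt_pi.1 (hf.contDiffAt (n := 1))) j
  have hFW : ∀ᶠ z in 𝓝 (X₀, u₀), F z = 0 ↔ z ∈ bicone W ∧ α z.2 = 1 := by
    filter_upwards [hA] with z hz
    rw [hFz, hz, and_comm]
  have hiso : ∀ᶠ u in 𝓝 u₀, F (X₀, u) = 0 → u = u₀ := by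
    have hfin : {u : HVec n | (X₀, u) ∈ bicone W ∧ α u = 1}.Finite := by
      refine Finite.of_injOn (f := proj) (t := fibre W (proj X₀)) ?_ ?_
        (hW.fibre_finite _ (hW.subset hw).1)
      · exact fun u hu => (mem_bicone.1 hu.1).2.2
      · rintro u ⟨hu, hu1⟩ v ⟨hv, hv1⟩ huv
        obtain ⟨a, -, rfl⟩ := exists_smul_of_proj_eq (mem_bicone.1 hu).2.1 (mem_bicone.1 hv).2.1 huv
        rw [map_smul, hv1, smul_eq_mul, mul_one] at hu1
        rw [hu1, one_smul]
    have h1 : ∀ᶠ u in 𝓝 u₀, u ∈ {u : HVec n | (X₀, u) ∈ bicone W ∧ α u = 1} → u = u₀ := by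
      have h2 := (hfin.subset (sdiff_subset (t := {u₀}))).isClosed.isOpen_compl.mem_nhds
        (x := u₀) (by simp)
      filter_upwards [h2] with u hu hu'
      by_contra hne
      exact hu ⟨hu', hne⟩
    have h3 : ContinuousAt (fun u : HVec n => (X₀, u)) u₀ := by fun_prop
    filter_upwards [h1, h3.eventually hFW] with u h4 h5 h6
    exact h4 (h5.1 h6)
  -- Interior points of the image come from unramified points near `(X₀, u₀)`: after rescaling to `α
  -- = 1` by `g`, a local section passes through them.
  have hint : ∀ N ∈ 𝓝 (X₀, u₀), ∃ p ∈ N, ∀ᶠ x in 𝓝 p.1, ∃ y, (x, y) ∈ N ∧ F (x, y) = 0 := by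
    intro N hN
    let g : HVec n × HVec n → HVec n × HVec n := fun z => (z.1, (α z.2)⁻¹ • z.2)
    have hαc : ContinuousAt (fun z : HVec n × HVec n => α z.2) (X₀, u₀) := by fun_prop
    have hg : ContinuousAt g (X₀, u₀) := by
      refine continuousAt_fst.prodMk ((hαc.inv₀ ?_).smul continuousAt_snd)
      rw [hα]
      exact one_ne_zero
    have hg0 : g (X₀, u₀) = (X₀, u₀) := by simp [g, hα]
    obtain ⟨N', hN'N, hN', hzN'⟩ := mem_nhds_iff.1 (inter_mem hN hFW)
    have hpre : g ⁻¹' N' ∈ 𝓝 (X₀, u₀) :=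
      hg.preimage_mem_nhds (by rw [hg0]; exact hN'.mem_nhds hzN')
    obtain ⟨y, ⟨hy1, hy2⟩, hyW⟩ := exists_isUnramifiedAt hW.pureDim hW.critical_dim hz
      (inter_mem hpre (hαc.eventually_ne (by rw [hα]; exact one_ne_zero)))
    have hyW' : IsUnramifiedAt W (g y) := by
      have := isUnramifiedAt_scale₂ (one_ne_zero (α := ℂ)) (inv_ne_zero hy2) hyW
      simpa [g] using this
    have hαy : α (g y).2 = 1 := by
      simp only [g, map_smul, smul_eq_mul]
      exact inv_mul_cancel₀ hy2
    obtain ⟨σ, hσ, hσ0, hσW⟩ := exists_section (X₀ := (g y).1) (u₀ := (g y).2) hW.pureDim hyW' hαy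
    refine ⟨g y, (hN'N hy1).1, ?_⟩
    have h1 : ∀ᶠ z in 𝓝 ((g y).1, σ (g y).1), z ∈ N' := by
      rw [hσ0]
      exact hN'.mem_nhds hy1
    rw [← hσ0] at hσW
    filter_upwards [eventually_section_mem σ hσ.continuousAt h1,
      eventually_section_mem σ hσ.continuousAt hσW] with x hx1 hx2
    exact ⟨σ x, (hN'N hx1).1, (hN'N hx1).2.2 (hx2.2 rfl)⟩
  filter_upwards [image_mem_nhds_of_isolated hF (hFW.self_of_nhds.2 ⟨hz, hα⟩) hiso hint
    (inter_mem hN hFW)] with X hX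
  obtain ⟨u, hu1, hu2⟩ := hX
  exact ⟨u, hu1.1, (hu1.2.1 hu2).1⟩

/-- The projection of a web to its base is an open map. -/
lemma IsWeb.eventually_exists_mem (hW : IsWeb M W d) {w : P n × PDual n} (hw : w ∈ W)
    {N : Set (P n × PDual n)} (hN : N ∈ 𝓝 w) : ∀ᶠ m in 𝓝 w.1, ∃ h, (m, h) ∈ N ∧ (m, h) ∈ W := by
  rw [nhds_eq_map_rep₂, mem_map] at hN
  have h1 := hW.eventually_exists_mem_bicone (rep₂_mem_bicone.2 hw) hN
  rw [nhds_eq_map_rep, eventually_map]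
  filter_upwards [h1] with X hX
  obtain ⟨u, hu1, hu2⟩ := hX
  exact ⟨proj u, hu1, (mem_bicone.1 hu2).2.2⟩

lemma IsWeb.exists_notMem_criticalSet (hW : IsWeb M W d) {w : P n × PDual n} (hw : w ∈ W)
    {N : Set (P n × PDual n)} (hN : N ∈ 𝓝 w) : ∃ w' ∈ N, w' ∈ W ∧ w' ∉ criticalSet W := by
  rw [nhds_eq_map_rep₂, mem_map] at hN
  obtain ⟨y, hy, hyW⟩ := exists_isUnramifiedAt hW.pureDim hW.critical_dim
    (rep₂_mem_bicone.2 hw) hN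
  have h := mem_bicone.1 hyW.1
  exact ⟨_, hy, (isUnramifiedAt_iff h.1 h.2.1).1 hyW⟩

/-- The multiplicities are positive and add up to `d`. -/
lemma IsWeb.ncard_fibre_le (hW : IsWeb M W d) {m : P n} (hm : m ∈ M) : (fibre W m).ncard ≤ d := by
  obtain ⟨μ, hμ, hd⟩ := hW.fibre_degree m hm
  have hf := hW.fibre_finite m hm
  rw [← hd, ncard_eq_toFinset_card _ hf, finsum_mem_eq_finite_toFinset_sum _ hf,
    Finset.card_eq_sum_ones]
  exact Finset.sum_le_sum fun h hh => (hμ h (hf.mem_toFinset.1 hh)).1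

/-- The regular part of the base is dense. -/
lemma IsWeb.exists_mem_regularBase (hM : IsOpen M) (hW : IsWeb M W d) {m₀ : P n} (hm₀ : m₀ ∈ M)
    {N : Set (P n)} (hN : N ∈ 𝓝 m₀) : ∃ m ∈ N, m ∈ regularBase M W := by
  obtain ⟨B, hBN, hB, hmB⟩ := mem_nhds_iff.1 (inter_mem hN (hM.mem_nhds hm₀))
  -- Fibre cardinalities are bounded by `d`, so some `m` in `B` has the largest one. Near `m`,
  -- openness of the projection gives at least one point of the fibre in each `V h`, and maximality
  -- leaves no others.
  obtain ⟨m, hm, hmax⟩ := WellFounded.has_min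
    (InvImage.wf (fun m => d - (fibre W m).ncard) Nat.lt_wfRel.wf) B ⟨m₀, hmB⟩
  have hle : ∀ m' ∈ B, (fibre W m').ncard ≤ (fibre W m).ncard := by
    intro m' hm'
    have h1 : ¬ (d - (fibre W m').ncard < d - (fibre W m).ncard) := hmax m' hm'
    have h2 := hW.ncard_fibre_le (hBN hm').2
    have h3 := hW.ncard_fibre_le (hBN hm).2
    omega
  have hfin := hW.fibre_finite m (hBN hm).2
  obtain ⟨V, hV, hVd⟩ := hfin.t2_separation
  -- over a neighbourhood of `m`, each `V h` contains exactly one point of the fibre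
  have hex : ∀ᶠ m' in 𝓝 m, ∀ h ∈ fibre W m, ∃ h', h' ∈ V h ∧ (m', h') ∈ W := by
    rw [eventually_all_finite hfin]
    intro h hh
    have h1 : (univ ×ˢ V h : Set (P n × PDual n)) ∈ 𝓝 (m, h) :=
      (isOpen_univ.prod (hV h).2).mem_nhds ⟨trivial, (hV h).1⟩
    filter_upwards [hW.eventually_exists_mem hh h1] with m' ⟨h', hh', hW'⟩
    exact ⟨h', hh'.2, hW'⟩
  obtain ⟨B₁, hB₁, hB₁o, hmB₁⟩ := mem_nhds_iff.1 (inter_mem hex (hB.mem_nhds hm))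
  have huniq : ∀ m' ∈ B₁, ∃ g : PDual n → PDual n,
      (∀ h ∈ fibre W m, g h ∈ V h) ∧ fibre W m' = g '' fibre W m := by
    intro m' hm'
    choose! g hg using (hB₁ hm').1
    refine ⟨g, fun h hh => (hg h hh).1, ?_⟩
    have hinj : InjOn g (fibre W m) := by
      intro h hh h' hh' heq
      by_contra hne
      exact (hVd hh hh' hne).le_bot ⟨(hg h hh).1, heq ▸ (hg h' hh').1⟩
    symm
    refine eq_of_subset_of_ncard_le ?_ ?_ (hW.fibre_finite m' (hBN (hB₁ hm').2).2)
    · rintro _ ⟨h, hh, rfl⟩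
      exact (hg h hh).2
    · rw [hinj.ncard_image]
      exact hle m' (hB₁ hm').2
  -- successively, the sheets can be made to avoid the critical set
  have hstep : ∀ s : Set (PDual n), s.Finite → s ⊆ fibre W m → ∃ B₂ ⊆ B₁, IsOpen B₂ ∧
      B₂.Nonempty ∧ ∀ m' ∈ B₂, ∀ h ∈ s, ∀ h' ∈ V h, (m', h') ∈ W → (m', h') ∉ criticalSet W := by
    intro s hs
    induction s, hs using Set.Finite.induction_on with
    | empty => exact fun _ => ⟨B₁, Subset.rfl, hB₁o, ⟨m, hmB₁⟩, by simp⟩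
    | @insert h s _ _ ih =>
      intro hsub
      obtain ⟨B₂, hB₂, hB₂o, ⟨m₁, hm₁⟩, hB₂W⟩ := ih ((subset_insert _ _).trans hsub)
      have hh : h ∈ fibre W m := hsub (mem_insert _ _)
      obtain ⟨h₁, hh₁, hW₁⟩ := (hB₁ (hB₂ hm₁)).1 h hh
      -- An unramified point of the sheet in `V h`. Unramified points are open in `W` and the
      -- projection is open, so over a small `B₃` the only point of `W` in `V h` is unramified.
      obtain ⟨⟨m₂, h₂⟩, hmem, hW₂, hΓ₂⟩ := hW.exists_notMem_criticalSet hW₁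
        ((hB₂o.prod (hV h).2).mem_nhds ⟨hm₁, hh₁⟩)
      have hN₂ : {w | w ∈ W → w ∉ criticalSet W} ∩ (B₂ ×ˢ V h) ∈ 𝓝 (m₂, h₂) :=
        inter_mem (eventually_notMem_criticalSet hW.pureDim hW₂ hΓ₂)
          ((hB₂o.prod (hV h).2).mem_nhds hmem)
      obtain ⟨B₃, hB₃, hB₃o, hm₃⟩ := mem_nhds_iff.1
        (inter_mem (hW.eventually_exists_mem hW₂ hN₂) (hB₂o.mem_nhds hmem.1))
      refine ⟨B₃, fun x hx => hB₂ (hB₃ hx).2, hB₃o, ⟨m₂, hm₃⟩, ?_⟩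
      intro m' hm' k hk
      rcases mem_insert_iff.1 hk with rfl | hk
      · intro h' hh' hW'
        obtain ⟨h'', ⟨h1, h2⟩, h3⟩ := (hB₃ hm').1
        obtain ⟨g, hg, hgf⟩ := huniq m' (hB₂ (hB₃ hm').2)
        have hkey : ∀ x, x ∈ V k → (m', x) ∈ W → x = g k := by
          intro x hx hxW
          have : x ∈ fibre W m' := hxW
          rw [hgf] at this
          obtain ⟨l, hl, rfl⟩ := this
          by_cases hlk : l = k
          · rw [hlk]
          · exact ((hVd hl hh hlk).le_bot ⟨hg l hl, hx⟩).elim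
        rw [hkey h' hh' hW', ← hkey h'' h2.2 h3]
        exact h1 h3
      · exact hB₂W m' (hB₃ hm').2 k hk
  obtain ⟨B₂, hB₂, -, ⟨m', hm'⟩, hB₂W⟩ := hstep _ hfin Subset.rfl
  refine ⟨m', (hBN (hB₁ (hB₂ hm')).2).1, (hBN (hB₁ (hB₂ hm')).2).2, ?_⟩
  rintro ⟨⟨m'', h'⟩, hc, rfl⟩
  obtain ⟨g, hg, hgf⟩ := huniq m'' (hB₂ hm')
  have h1 : h' ∈ fibre W m'' := hc.1
  rw [hgf] at h1
  obtain ⟨l, hl, rfl⟩ := h1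
  exact hB₂W m'' hm' l hl _ (hg l hl) hc.1 hc

/-- The part of the web over the regular part of the base is dense. -/
lemma IsWeb.exists_mem_over_regularBase (hM : IsOpen M) (hW : IsWeb M W d) {w : P n × PDual n}
    (hw : w ∈ W) {N : Set (P n × PDual n)} (hN : N ∈ 𝓝 w) :
    ∃ w' ∈ N, w' ∈ W ∧ w'.1 ∈ regularBase M W := by
  obtain ⟨m, ⟨h, h1, h2⟩, h3⟩ := hW.exists_mem_regularBase hM (hW.subset hw).1
    (hW.eventually_exists_mem hw hN)
  exact ⟨(m, h), h1, h2, h3⟩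

end Openness

/-! ### Integral hypersurfaces -/

section IntegralFunction

variable {n : ℕ}

/-- The pairing of a covector with a vector. -/
noncomputable def dotL (n : ℕ) : HVec n →L[ℂ] HVec n →L[ℂ] ℂ :=
  (dotProductBilin ℂ ℂ).toContinuousBilinearMap

lemma dotL_apply (u X : HVec n) : dotL n u X = u ⬝ᵥ X := rfl

variable {M : Set (P n)} {W : Set (P n × PDual n)} {d : ℕ}

/-- Integrability of the contact form at all homogeneous coordinates. -/
lemma IsWeb.integrable_bicone (hW : IsWeb M W d) {z : HVec n × HVec n} (hz : z ∈ bicone W)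
    (hr : IsRegularAt (bicone W) z) {a b c : HVec n × HVec n}
    (ha : a ∈ tangentSpaceAt (bicone W) z) (hb : b ∈ tangentSpaceAt (bicone W) z)
    (hc : c ∈ tangentSpaceAt (bicone W) z) :
    contactForm z a * contactFormDeriv b c + contactForm z b * contactFormDeriv c a
      + contactForm z c * contactFormDeriv a b = 0 := by
  obtain ⟨h₁, h₂, hw⟩ := mem_bicone.1 hz
  obtain ⟨s, t, hs, ht, h⟩ := exists_scale₂_rep₂ h₁ h₂
  have hT := scale₂_mem_bicone hs ht W
  obtain ⟨k, hk⟩ := hr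
  have hreg : proj₂ z ∈ regularPart W :=
    ⟨hw, k, (isSubmanifoldAt_bicone_rep₂ h₁ h₂).2 hk⟩
  have hmap : ∀ v ∈ tangentSpaceAt (bicone W) z,
      scale₂ hs ht v ∈ tangentSpaceAt (bicone W) (rep₂ (proj₂ z)) := by
    intro v hv
    rw [h]
    exact map_mem_tangentSpaceAt _ hT hv
  have h1 := hW.integrable _ hreg _ (hmap a ha) _ (hmap b hb) _ (hmap c hc)
  rw [h] at h1
  simp only [contactForm, contactFormDeriv, scale₂_apply, smul_dotProduct, dotProduct_smul,
    smul_eq_mul] at h1 ⊢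
  -- Rescaling `(X, u)` by `(s, t)` multiplies the contact form and its derivative by `s t` each.
  have h2 : (s * t) ^ 2 ≠ 0 := pow_ne_zero _ (mul_ne_zero hs ht)
  refine (mul_eq_zero.1 ?_).resolve_left h2
  linear_combination h1

/-- The vectors `(v, dσ v)` are tangent to the bicone, so the integrability of the contact form
pulls back along `X ↦ (X, σ X)` to `σ ∧ dσ = 0`. -/
lemma IsWeb.integrable_section (hW : IsWeb M W d) {O : Set (HVec n)} (hO : IsOpen O)
    {σ : HVec n → HVec n} (hσ : ∀ X ∈ O, AnalyticAt ℂ σ X)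
    (hmem : ∀ X ∈ O, IsUnramifiedAt W (X, σ X)) {X : HVec n} (hX : X ∈ O) (a b c : HVec n) :
    σ X ⬝ᵥ a * (fderiv ℂ σ X b ⬝ᵥ c - fderiv ℂ σ X c ⬝ᵥ b)
      + σ X ⬝ᵥ b * (fderiv ℂ σ X c ⬝ᵥ a - fderiv ℂ σ X a ⬝ᵥ c)
      + σ X ⬝ᵥ c * (fderiv ℂ σ X a ⬝ᵥ b - fderiv ℂ σ X b ⬝ᵥ a) = 0 := by
  have hγ : HasFDerivAt (fun Y => (Y, σ Y)) ((ContinuousLinearMap.id ℂ _).prod (fderiv ℂ σ X)) X :=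
    (hasFDerivAt_id X).prodMk (hσ X hX).differentiableAt.hasFDerivAt
  have ht : ∀ v, (v, fderiv ℂ σ X v) ∈ tangentSpaceAt (bicone W) (X, σ X) :=
    fun v => mem_tangentSpaceAt_of_hasFDerivAt (A := bicone W) hγ (by
      filter_upwards [hO.mem_nhds hX] with Y hY using (hmem Y hY).1) v
  have h := hW.integrable_bicone (hmem X hX).1 (hmem X hX).2.1 (ht a) (ht b) (ht c)
  simp only [contactForm, contactFormDeriv] at h
  exact h

/-- The function whose graph is the integral hypersurface of the distribution `σ = 0`. -/
lemma exists_integral_function {O : Set (HVec n)} (hO : IsOpen O) {X₀ : HVec n} (hX₀ : X₀ ∈ O)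
    {σ : HVec n → HVec n} (hσ : ∀ X ∈ O, AnalyticAt ℂ σ X)
    (hint : ∀ X ∈ O, ∀ a b c : HVec n,
      σ X ⬝ᵥ a * (fderiv ℂ σ X b ⬝ᵥ c - fderiv ℂ σ X c ⬝ᵥ b)
        + σ X ⬝ᵥ b * (fderiv ℂ σ X c ⬝ᵥ a - fderiv ℂ σ X a ⬝ᵥ c)
        + σ X ⬝ᵥ c * (fderiv ℂ σ X a ⬝ᵥ b - fderiv ℂ σ X b ⬝ᵥ a) = 0)
    {e : HVec n} (he : ∀ X ∈ O, σ X ⬝ᵥ e = 1) (p : HVec n →L[ℂ] HVec n) :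
    ∃ φ : HVec n → ℂ, AnalyticAt ℂ φ 0 ∧ φ 0 = 0 ∧
      ∀ᶠ x in 𝓝 0, ∀ w, fderiv ℂ φ x w = - (σ (X₀ + p x + φ x • e) ⬝ᵥ p w) := by
  -- The integral hypersurface is sought as `x ↦ Q (x, φ x)`. As `σ ⬝ᵥ e = 1`, its tangent vectors
  -- `p w + dφ(w) e` are annihilated by `σ` exactly when `dφ(w) = -(σ ⬝ᵥ p w)`.
  let Q : HVec n × ℂ → HVec n := fun q => X₀ + p q.1 + q.2 • e
  let Q' : HVec n × ℂ →L[ℂ] HVec n :=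
    p ∘L ContinuousLinearMap.fst ℂ _ _ + (ContinuousLinearMap.snd ℂ _ _).smulRight e
  have hQ : ∀ q, HasFDerivAt Q Q' q := by
    intro q
    have h1 : HasFDerivAt (fun q : HVec n × ℂ => X₀ + Q' q) Q' q := Q'.hasFDerivAt.const_add X₀
    refine h1.congr_of_eventuallyEq (Eventually.of_forall fun q => ?_)
    simp [Q, Q', add_assoc]
  have hQ0 : Q 0 = X₀ := by simp [Q]
  let Λ : HVec n →L[ℂ] (HVec n →L[ℂ] ℂ) :=
    -((ContinuousLinearMap.compL ℂ (HVec n) (HVec n) ℂ).flip p ∘L dotL n)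
  have hΛ : ∀ u w, Λ u w = - (u ⬝ᵥ p w) := fun u w => rfl
  have hpre : ∀ᶠ q in 𝓝 (0 : HVec n × ℂ), Q q ∈ O :=
    (hQ 0).continuousAt.preimage_mem_nhds (by rw [hQ0]; exact hO.mem_nhds hX₀)
  have hA : AnalyticAt ℂ (fun q => Λ (σ (Q q))) 0 := by
    have h1 : AnalyticAt ℂ Q 0 := by
      have : ContDiffAt ℂ ⊤ Q 0 := by fun_prop
      exact this.analyticAt
    have h2 : AnalyticAt ℂ (fun q => σ (Q q)) 0 :=
      AnalyticAt.comp (g := σ) (f := Q) (by rw [hQ0]; exact hσ _ hX₀) h1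
    exact (Λ.analyticAt _).comp h2
  obtain ⟨φ, hφ, hφ0, hsol⟩ := exists_solution_of_integrable hA (by
    filter_upwards [hpre] with q hq v w
    have hd : HasFDerivAt (fun q => Λ (σ (Q q))) (Λ ∘L (fderiv ℂ σ (Q q) ∘L Q')) q :=
      Λ.hasFDerivAt.comp q ((hσ _ hq).differentiableAt.hasFDerivAt.comp q (hQ q))
    have hzero : ∀ Y, fderiv ℂ σ (Q q) Y ⬝ᵥ e = 0 := by
      intro Y
      have h1 : HasFDerivAt (fun X => dotL n (σ X) e)
          ((dotL n).flip e ∘L fderiv ℂ σ (Q q)) (Q q) :=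
        ((dotL n).flip e).hasFDerivAt.comp (Q q) (hσ _ hq).differentiableAt.hasFDerivAt
      have h2 := h1.unique ((hasFDerivAt_const (1 : ℂ) (Q q)).congr_of_eventuallyEq (by
        filter_upwards [hO.mem_nhds hq] with X hX using he X hX))
      exact congrArg (fun T : HVec n →L[ℂ] ℂ => T Y) h2
    rw [hd.fderiv]
    have hQv : ∀ v, Q' (v, Λ (σ (Q q)) v) = p v - (σ (Q q) ⬝ᵥ p v) • e := by
      intro v
      simp [Q', hΛ, sub_eq_add_neg]
    simp only [ContinuousLinearMap.comp_apply, hQv]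
    simp only [hΛ]
    -- Integrability is evaluated on `e` and two vectors annihilated by `σ`; a single term survives,
    -- and it is the symmetry that Frobenius' theorem requires.
    have h3 := hint _ hq e (p v - (σ (Q q) ⬝ᵥ p v) • e) (p w - (σ (Q q) ⬝ᵥ p w) • e)
    have h4 : ∀ v, σ (Q q) ⬝ᵥ (p v - (σ (Q q) ⬝ᵥ p v) • e) = 0 := by
      intro v
      rw [dotProduct_sub, dotProduct_smul, he _ hq, smul_eq_mul, mul_one, sub_self]
    rw [h4, h4, he _ hq] at h3
    simp only [dotProduct_sub, dotProduct_smul, hzero] at h3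
    simp only [smul_zero, sub_zero] at h3
    linear_combination -h3)
  exact ⟨φ, hφ, hφ0, hsol.mono fun x hx w => by rw [hx]; rfl⟩

/-- A vector paired to `1` with `u₀` may be corrected by a multiple of `X₀`, because `u₀ ⬝ᵥ X₀ = 0`.
The frame separates the scaling direction `X₀`, the leaf directions `ker ℓ ∩ ker u₀` and the
transversal `e`. -/
lemma exists_adapted_frame {X₀ u₀ : HVec n} (hX : X₀ ≠ 0) (hu : u₀ ≠ 0) (h : u₀ ⬝ᵥ X₀ = 0) :
    ∃ (ℓ : HVec n →L[ℂ] ℂ) (e : HVec n), ℓ X₀ = 1 ∧ ℓ e = 0 ∧ u₀ ⬝ᵥ e = 1 := by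
  obtain ⟨ℓ, hℓ⟩ := exists_dual hX
  obtain ⟨i, hi⟩ := Function.ne_iff.1 hu
  have hi' : u₀ i ≠ 0 := hi
  let e' : HVec n := Pi.single i (u₀ i)⁻¹
  have he' : u₀ ⬝ᵥ e' = 1 := by simp [e', hi']
  refine ⟨ℓ, e' - ℓ e' • X₀, hℓ, by simp [hℓ], ?_⟩
  rw [dotProduct_sub, dotProduct_smul, h, he', smul_zero, sub_zero]

lemma hyperplaneLin_injective {h k : PDual n} (heq : hyperplaneLin h = hyperplaneLin k) :
    h = k := by
  by_contra hne
  rw [← proj_rep h, ← proj_rep k] at hne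
  obtain ⟨i, j, hij⟩ := (proj_ne_iff h.rep_nonzero k.rep_nonzero).1 hne
  let Y : HVec n := Pi.single i (h.rep j) - Pi.single j (h.rep i)
  have h1 : Y ∈ hyperplaneLin h := by
    change h.rep ⬝ᵥ Y = 0
    simp only [Y, dotProduct_sub, dotProduct_single]
    ring
  rw [heq] at h1
  have h2 : k.rep ⬝ᵥ Y = 0 := h1
  simp only [Y, dotProduct_sub, dotProduct_single] at h2
  exact hij (by linear_combination -h2)

end IntegralFunction

/-! ### Leaves of a web -/

section Leaf

variable {n : ℕ}

/-- The normalization of the homogeneous coordinates by `ℓ = 1`. -/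
noncomputable def normalize (ℓ : HVec n →L[ℂ] ℂ) (X : HVec n) : HVec n := (ℓ X)⁻¹ • X

lemma normalize_smul (ℓ : HVec n →L[ℂ] ℂ) {a : ℂ} (ha : a ≠ 0) (X : HVec n) :
    normalize ℓ (a • X) = normalize ℓ X := by
  simp only [normalize, map_smul, smul_eq_mul, smul_smul, mul_inv]
  rw [mul_right_comm, inv_mul_cancel₀ ha, one_mul]

lemma proj_normalize {ℓ : HVec n →L[ℂ] ℂ} {X : HVec n} (h : ℓ X ≠ 0) :
    proj (normalize ℓ X) = proj X := proj_smul (inv_ne_zero h) X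

lemma apply_normalize {ℓ : HVec n →L[ℂ] ℂ} {X : HVec n} (h : ℓ X ≠ 0) :
    ℓ (normalize ℓ X) = 1 := by
  rw [normalize, map_smul, smul_eq_mul, inv_mul_cancel₀ h]

lemma contDiffAt_normalize {ℓ : HVec n →L[ℂ] ℂ} {X : HVec n} (h : ℓ X ≠ 0) :
    ContDiffAt ℂ ⊤ (normalize ℓ) X := by
  unfold normalize
  fun_prop (disch := assumption)

lemma hasFDerivAt_normalize {ℓ : HVec n →L[ℂ] ℂ} {X : HVec n} (h : ℓ X ≠ 0) :
    ∃ s' : HVec n →L[ℂ] HVec n, HasFDerivAt (normalize ℓ) s' X ∧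
      ∀ Y, s' Y = (ℓ X)⁻¹ • (Y - ℓ Y • normalize ℓ X) := by
  have h1 : HasFDerivAt (fun X => (ℓ X)⁻¹) _ X := (hasFDerivAt_inv h).comp X ℓ.hasFDerivAt
  have h2 := h1.smul (hasFDerivAt_id (𝕜 := ℂ) X)
  refine ⟨_, h2, fun Y => ?_⟩
  simp only [normalize, id]
  ext i
  simp
  field_simp
  ring

/-- The differential of the equation of the integral hypersurface. -/
lemma hasFDerivAt_leaf_equation {ℓ : HVec n →L[ℂ] ℂ} {X₀ u₀ e : HVec n} {p : HVec n →L[ℂ] HVec n}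
    (hdec : ∀ Y, Y = ℓ Y • X₀ + p Y + (u₀ ⬝ᵥ Y) • e) (hpp : ∀ Y, p (p Y) = p Y) {X u : HVec n}
    (hX : ℓ X ≠ 0) (hue : u ⬝ᵥ e = 1) (huX : u ⬝ᵥ X = 0) {φ : HVec n → ℂ}
    (hφ : DifferentiableAt ℂ φ (p (normalize ℓ X)))
    (hφ' : ∀ w, fderiv ℂ φ (p (normalize ℓ X)) w = -(u ⬝ᵥ p w)) :
    HasFDerivAt (fun Y => u₀ ⬝ᵥ normalize ℓ Y - φ (p (normalize ℓ Y)))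
      ((ℓ X)⁻¹ • dotL n u) X := by
  obtain ⟨s', hs', hsY⟩ := hasFDerivAt_normalize hX
  have h1 : HasFDerivAt (fun Y => u₀ ⬝ᵥ normalize ℓ Y) (dotL n u₀ ∘L s') X :=
    (dotL n u₀).hasFDerivAt.comp X hs'
  have h2 : HasFDerivAt (fun Y => φ (p (normalize ℓ Y)))
      (fderiv ℂ φ (p (normalize ℓ X)) ∘L (p ∘L s')) X :=
    HasFDerivAt.comp X (f := fun Y => p (normalize ℓ Y)) hφ.hasFDerivAt
      (p.hasFDerivAt.comp X hs')
  refine (h1.sub h2).congr_fderiv ?_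
  ext1 Y
  have h3 : ℓ (s' Y) = 0 := by
    rw [hsY, map_smul, map_sub, map_smul, apply_normalize hX]
    simp
  have h4 : u ⬝ᵥ s' Y = (ℓ X)⁻¹ * (u ⬝ᵥ Y) := by
    rw [hsY, dotProduct_smul, dotProduct_sub, dotProduct_smul, normalize, dotProduct_smul, huX]
    simp
  have h5 : u ⬝ᵥ s' Y = u ⬝ᵥ p (s' Y) + u₀ ⬝ᵥ s' Y := by
    conv_lhs => rw [hdec (s' Y), h3]
    rw [zero_smul, zero_add, dotProduct_add, dotProduct_smul, hue, smul_eq_mul, mul_one]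
  have h6 := hφ' (p (s' Y))
  rw [hpp] at h6
  change u₀ ⬝ᵥ s' Y - fderiv ℂ φ (p (normalize ℓ X)) (p (s' Y)) = (ℓ X)⁻¹ * (u ⬝ᵥ Y)
  rw [h6, ← h4, h5]
  ring

variable {M : Set (P n)} {W : Set (P n × PDual n)} {d : ℕ}

lemma IsWeb.dotProduct_eq_zero (hW : IsWeb M W d) {z : HVec n × HVec n} (hz : z ∈ bicone W) :
    z.2 ⬝ᵥ z.1 = 0 := by
  obtain ⟨h₁, h₂, h⟩ := mem_bicone.1 hz
  exact (mem_hyperplane h₁ h₂).1 (hW.subset h).2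

/-- Through each point of the web over the regular part of the base there passes a leaf. -/
theorem IsWeb.exists_leaf (hW : IsWeb M W d) {X₀ u₀ : HVec n} (hz : (X₀, u₀) ∈ bicone W)
    (hreg : proj X₀ ∈ regularBase M W) :
    ∃ L, IsLeaf M W L ∧ proj X₀ ∈ L ∧ tangentSpaceAt (cone L) X₀ = hyperplaneLin (proj u₀) ∧
      ∀ X ∈ cone L, ∃ u, (X, u) ∈ bicone W ∧
        tangentSpaceAt (cone L) X = hyperplaneLin (proj u) := by
  obtain ⟨hX₀, hu₀, hw⟩ := mem_bicone.1 hz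
  simp only at hX₀ hu₀
  have hzu : IsUnramifiedAt W (X₀, u₀) :=
    (isUnramifiedAt_iff hX₀ hu₀).2 ⟨hw, fun hc => hreg.2 ⟨_, hc, rfl⟩⟩
  have hinc : u₀ ⬝ᵥ X₀ = 0 := hW.dotProduct_eq_zero hz
  obtain ⟨ℓ, e, hℓX, hℓe, hue⟩ := exists_adapted_frame hX₀ hu₀ hinc
  have hα : (dotL n).flip e u₀ = 1 := hue
  obtain ⟨σ, hσ, hσ0, hσW⟩ := exists_section hW.pureDim hzu hα
  rw [← hσ0] at hσW
  have hunr := eventually_isUnramifiedAt hW.pureDim hzu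
  rw [← hσ0] at hunr
  -- a neighbourhood on which `σ` is a section of the web
  obtain ⟨O, hOsub, hO, hX₀O⟩ := mem_nhds_iff.1 (hσ.eventually_analyticAt.and
    ((eventually_section_mem σ hσ.continuousAt hσW).and
      (eventually_section_mem σ hσ.continuousAt hunr)))
  have hσan : ∀ X ∈ O, AnalyticAt ℂ σ X := fun X hX => (hOsub hX).1
  have hσmem : ∀ X ∈ O, (X, σ X) ∈ bicone W := fun X hX => ((hOsub hX).2.1.2 rfl).1
  have hσe : ∀ X ∈ O, σ X ⬝ᵥ e = 1 := fun X hX => ((hOsub hX).2.1.2 rfl).2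
  have hσunr : ∀ X ∈ O, IsUnramifiedAt W (X, σ X) := fun X hX => (hOsub hX).2.2 (hσmem X hX)
  -- The projection onto `ker ℓ ∩ ker u₀` along `X₀` and `e`.
  let p : HVec n →L[ℂ] HVec n :=
    ContinuousLinearMap.id ℂ _ - ℓ.smulRight X₀ - (dotL n u₀).smulRight e
  have hp : ∀ Y, p Y = Y - ℓ Y • X₀ - (u₀ ⬝ᵥ Y) • e := fun Y => rfl
  have hdec : ∀ Y, Y = ℓ Y • X₀ + p Y + (u₀ ⬝ᵥ Y) • e := by
    intro Y
    rw [hp]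
    abel
  have hℓp : ∀ Y, ℓ (p Y) = 0 := by
    intro Y
    rw [hp, map_sub, map_sub, map_smul, map_smul, hℓX, hℓe]
    simp
  have hup : ∀ Y, u₀ ⬝ᵥ p Y = 0 := by
    intro Y
    rw [hp, dotProduct_sub, dotProduct_sub, dotProduct_smul, dotProduct_smul, hinc, hue]
    simp
  have hpp : ∀ Y, p (p Y) = p Y := by
    intro Y
    rw [hp (p Y), hℓp, hup]
    simp
  have hpX₀ : p X₀ = 0 := by rw [hp, hℓX, hinc]; simp
  have hpe : p e = 0 := by rw [hp, hℓe, hue]; simp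
  obtain ⟨φ, hφ, hφ0, hsol⟩ := exists_integral_function hO hX₀O hσan
    (fun X hX => hW.integrable_section hO hσan hσunr hX) hσe p
  let γ : HVec n → HVec n := fun x => X₀ + p x + φ x • e
  have hγ0 : γ 0 = X₀ := by simp [γ, hφ0]
  have hγc : ContinuousAt γ 0 :=
    (continuousAt_const.add p.continuous.continuousAt).add (hφ.continuousAt.smul continuousAt_const)
  obtain ⟨r, hr, hball⟩ := Metric.mem_nhds_iff.1 ((hφ.eventually_analyticAt.and hsol).and
    (hγc.preimage_mem_nhds (by rw [hγ0]; exact hO.mem_nhds hX₀O)))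
  have hℓγ : ∀ x, ℓ (γ x) = 1 := by
    intro x
    simp [γ, hℓX, hℓp, hℓe]
  have huγ : ∀ x, u₀ ⬝ᵥ γ x = φ x := by
    intro x
    simp only [γ, dotProduct_add, dotProduct_smul, hinc, hup, hue]
    simp
  have hpγ : ∀ x, p (γ x) = p x := by
    intro x
    simp [γ, hpX₀, hpp, hpe]
  -- The fixed vectors of `p` are the leaf directions, and `ℓ (γ x) = 1` picks one representative of
  -- each point: `L` is a graph over a ball in these directions.
  let B : Set (HVec n) := Metric.ball 0 r ∩ {x | p x = x}
  let L : Set (P n) := (fun x => proj (γ x)) '' B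
  -- the cone over `L`
  have hLcone : ∀ X, X ∈ cone L ↔ ℓ X ≠ 0 ∧ p (normalize ℓ X) ∈ Metric.ball 0 r ∧
      u₀ ⬝ᵥ normalize ℓ X - φ (p (normalize ℓ X)) = 0 := by
    intro X
    rw [mem_cone]
    constructor
    · rintro ⟨hX, x, ⟨hx, hpx⟩, hxX⟩
      have hγx : γ x ≠ 0 := fun h => one_ne_zero (α := ℂ) (by rw [← hℓγ x, h, map_zero])
      obtain ⟨a, ha, rfl⟩ := exists_smul_of_proj_eq hX hγx hxX.symm
      have hn : normalize ℓ (a • γ x) = γ x := by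
        rw [normalize_smul ℓ ha, normalize, hℓγ, inv_one, one_smul]
      have hpx' : p x = x := hpx
      rw [hn, hpγ, hpx', huγ, sub_self]
      exact ⟨by rw [map_smul, hℓγ, smul_eq_mul, mul_one]; exact ha, hx, rfl⟩
    · rintro ⟨h1, h2, h3⟩
      refine ⟨fun h => h1 (by rw [h, map_zero]), _, ⟨h2, hpp _⟩, ?_⟩
      rw [← proj_normalize h1]
      conv_rhs => rw [hdec (normalize ℓ X), apply_normalize h1, sub_eq_zero.1 h3]
      simp [γ, hpp]
  have hLγ : ∀ X ∈ cone L, normalize ℓ X = γ (p (normalize ℓ X)) := by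
    intro X hX
    obtain ⟨h1, -, h3⟩ := (hLcone X).1 hX
    conv_lhs => rw [hdec (normalize ℓ X), apply_normalize h1, sub_eq_zero.1 h3]
    simp [γ, hpp]
  have hLO : ∀ X ∈ cone L, normalize ℓ X ∈ O := by
    intro X hX
    rw [hLγ X hX]
    exact (hball ((hLcone X).1 hX).2.1).2
  have hLW : ∀ X, ℓ X ≠ 0 → normalize ℓ X ∈ O → (X, σ (normalize ℓ X)) ∈ bicone W := by
    intro X hX h
    have h1 := mem_bicone.1 (hσmem _ h)
    refine mem_bicone.2 ⟨fun h => hX (by simp only at h; rw [h, map_zero]), h1.2.1, ?_⟩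
    have h2 := h1.2.2
    rw [proj₂, proj_normalize hX] at h2
    exact h2
  have hder : ∀ X ∈ cone L, HasFDerivAt
      (fun Y => u₀ ⬝ᵥ normalize ℓ Y - φ (p (normalize ℓ Y)))
      ((ℓ X)⁻¹ • dotL n (σ (normalize ℓ X))) X := by
    intro X hX
    obtain ⟨h1, h2, h3⟩ := (hLcone X).1 hX
    obtain ⟨⟨h4, h5⟩, h6⟩ := hball h2
    refine hasFDerivAt_leaf_equation hdec hpp h1 (hσe _ (hLO X hX))
      (hW.dotProduct_eq_zero (hLW X h1 (hLO X hX))) h4.differentiableAt fun w => ?_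
    have h7 : X₀ + p (p (normalize ℓ X)) + φ (p (normalize ℓ X)) • e = normalize ℓ X :=
      (hLγ X hX).symm
    rw [h5 w, h7]
  -- `L` is a submanifold with the required tangent spaces
  have hsub : ∀ X ∈ cone L, IsSubmanifoldAt (cone L) n X ∧
      tangentSpaceAt (cone L) X = hyperplaneLin (proj (σ (normalize ℓ X))) := by
    intro X hX
    obtain ⟨h1, h2, h3⟩ := (hLcone X).1 hX
    have hcn := contDiffAt_normalize h1
    let f : HVec n → (Fin 1 → ℂ) := fun Y _ => u₀ ⬝ᵥ normalize ℓ Y - φ (p (normalize ℓ Y))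
    have hf : AnalyticAt ℂ f X := by
      have h4 : ContDiffAt ℂ ⊤ f X := by
        rw [contDiffAt_pi]
        intro _
        refine ((dotL n u₀).contDiff.contDiffAt.comp X hcn).sub ?_
        have h5 : ContDiffAt ℂ ⊤ φ (p (normalize ℓ X)) := (hball h2).1.1.contDiffAt
        exact ContDiffAt.comp X (f := fun Y => p (normalize ℓ Y)) h5
          (p.contDiff.contDiffAt.comp X hcn)
      exact h4.analyticAt
    have hfd : HasFDerivAt f (ContinuousLinearMap.pi fun _ =>
        (ℓ X)⁻¹ • dotL n (σ (normalize ℓ X))) X := hasFDerivAt_pi.2 fun _ => hder X hX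
    have hs : Function.Surjective (fderiv ℂ f X) := by
      rw [hfd.fderiv]
      intro y
      refine ⟨(ℓ X * y 0) • e, ?_⟩
      ext i
      rw [Subsingleton.elim i 0]
      simp only [ContinuousLinearMap.pi_apply, _root_.smul_apply, map_smul, dotL_apply,
        hσe _ (hLO X hX), smul_eq_mul]
      field_simp
    have heq : ∀ᶠ Y in 𝓝 X, (Y ∈ cone L ↔ f Y = 0) := by
      have h5 : ∀ᶠ Y in 𝓝 X, ℓ Y ≠ 0 := ℓ.continuous.continuousAt.eventually_ne h1
      have h6 : ∀ᶠ Y in 𝓝 X, p (normalize ℓ Y) ∈ Metric.ball 0 r :=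
        (p.continuous.continuousAt.comp hcn.continuousAt).preimage_mem_nhds
          (Metric.isOpen_ball.mem_nhds h2)
      filter_upwards [h5, h6] with Y h7 h8
      rw [hLcone, funext_iff]
      exact ⟨fun h _ => h.2.2, fun h => ⟨h7, h8, h 0⟩⟩
    refine ⟨⟨hX, 1, by simp, f, hf, hs, heq⟩, ?_⟩
    rw [tangentSpaceAt_eq_ker hX hf hs heq, hfd.fderiv]
    ext Y
    rw [mem_hyperplaneLin (mem_bicone.1 (hσmem _ (hLO X hX))).2.1, LinearMap.mem_ker]
    change (fun _ : Fin 1 => (ℓ X)⁻¹ * (σ (normalize ℓ X) ⬝ᵥ Y)) = 0 ↔ _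
    rw [funext_iff]
    simp [h1]
  have hX₀L : proj X₀ ∈ L := ⟨0, ⟨Metric.mem_ball_self hr, map_zero p⟩, by simp only [hγ0]⟩
  have hX₀c : X₀ ∈ cone L := mem_cone.2 ⟨hX₀, hX₀L⟩
  have hnX₀ : normalize ℓ X₀ = X₀ := by rw [normalize, hℓX, inv_one, one_smul]
  refine ⟨L, ?_, hX₀L, ?_, fun X hX =>
    ⟨_, hLW X ((hLcone X).1 hX).1 (hLO X hX), (hsub X hX).2⟩⟩
  swap
  · rw [(hsub X₀ hX₀c).2, hnX₀, hσ0]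
  refine ⟨?_, ⟨?_, ?_, ?_⟩, ⟨_, hX₀L, hreg⟩, ?_⟩
  · intro m hm
    have hmc : m.rep ∈ cone L := rep_mem_cone.2 hm
    have h1 := (mem_bicone.1 (hLW _ ((hLcone _).1 hmc).1 (hLO _ hmc))).2.2
    rw [proj₂, proj_rep] at h1
    exact (hW.subset h1).1
  · intro X hX
    obtain ⟨-, c, -, f, hf, -, h⟩ := (hsub X hX).1
    exact ⟨c, f, hf, h⟩
  · exact fun X hX => subset_closure (hsub X hX).1
  · have hLeq : {m | m ∈ L ∧ IsSubmanifoldAt (cone L) n m.rep} = L := by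
      ext m
      exact ⟨fun h => h.1, fun h => ⟨h, (hsub _ (rep_mem_cone.2 h)).1⟩⟩
    rw [hLeq]
    have hconv : Convex ℝ B := by
      refine (convex_ball _ _).inter ?_
      intro x hx y hy a b _ _ _
      have hx' : p x = x := hx
      have hy' : p y = y := hy
      change p (a • x + b • y) = a • x + b • y
      have h1 : ∀ (c : ℝ) (v : HVec n), p (c • v) = c • p v := fun c v =>
        (p.restrictScalars ℝ).map_smul c v
      rw [map_add, h1, h1, hx', hy']
    refine ⟨⟨_, hX₀L⟩, (hconv.isPreconnected.image _ ?_)⟩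
    intro x hx
    have h1 : γ x ≠ 0 := fun h => one_ne_zero (α := ℂ) (by rw [← hℓγ x, h, map_zero])
    have h2 : ContinuousAt γ x := (continuousAt_const.add p.continuous.continuousAt).add
      ((hball hx.1).1.1.continuousAt.smul continuousAt_const)
    exact (ContinuousAt.comp (g := proj) (continuousAt_proj h1) h2).continuousWithinAt
  · rintro m ⟨hm, -⟩
    have hmc : m.rep ∈ cone L := rep_mem_cone.2 hm
    have hℓm := ((hLcone _).1 hmc).1
    have hU : ∀ᶠ X in 𝓝 m.rep, X ≠ 0 ∧ ℓ X ≠ 0 ∧ normalize ℓ X ∈ O :=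
      (continuousAt_id.eventually_ne m.rep_nonzero).and
        ((ℓ.continuous.continuousAt.eventually_ne hℓm).and
          ((contDiffAt_normalize hℓm).continuousAt.preimage_mem_nhds (hO.mem_nhds (hLO _ hmc))))
    refine ⟨{m' | ℓ m'.rep ≠ 0 ∧ normalize ℓ m'.rep ∈ O}, ?_,
      fun m' => proj (σ (normalize ℓ m'.rep)), ?_, ?_, ?_⟩
    · rw [nhds_eq_map_rep m, mem_map]
      filter_upwards [hU] with X ⟨h1, h2, h3⟩
      obtain ⟨a, ha, h⟩ := exists_rep_smul h1
      change ℓ (proj X).rep ≠ 0 ∧ normalize ℓ (proj X).rep ∈ O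
      rw [h, normalize_smul ℓ ha, map_smul]
      exact ⟨mul_ne_zero ha h2, h3⟩
    · rintro m' ⟨h1, h2⟩
      refine ContinuousAt.continuousWithinAt ?_
      rw [ContinuousAt, nhds_eq_map_rep m', tendsto_map'_iff]
      have h3 : ContinuousAt (fun X => proj (σ (normalize ℓ X))) m'.rep :=
        ContinuousAt.comp (f := fun X => σ (normalize ℓ X))
          (continuousAt_proj (mem_bicone.1 (hσmem _ h2)).2.1)
          (ContinuousAt.comp (hσan _ h2).continuousAt (contDiffAt_normalize h1).continuousAt)
      refine h3.tendsto.congr' ?_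
      filter_upwards [continuousAt_id.eventually_ne m'.rep_nonzero] with X hX
      obtain ⟨a, ha, h⟩ := exists_rep_smul hX
      change proj (σ (normalize ℓ X)) = proj (σ (normalize ℓ (proj X).rep))
      change (proj X).rep = a • X at h
      rw [h, normalize_smul ℓ ha]
    · rintro m' ⟨h1, h2⟩
      have := (mem_bicone.1 (hLW _ h1 h2)).2.2
      rwa [proj₂, proj_rep] at this
    · rintro m' ⟨hm', -⟩
      exact hsub _ (rep_mem_cone.2 hm')

lemma mem_cone_piece {O : Set (P n)} {u X : HVec n} (hu : u ≠ 0) :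
    X ∈ cone (O ∩ hyperplane (proj u)) ↔ X ∈ cone O ∧ u ⬝ᵥ X = 0 := by
  rw [mem_cone, mem_cone]
  constructor
  · exact fun ⟨h1, h2, h3⟩ => ⟨⟨h1, h2⟩, (mem_hyperplane h1 hu).1 h3⟩
  · exact fun ⟨⟨h1, h2⟩, h3⟩ => ⟨h1, h2, (mem_hyperplane h1 hu).2 h3⟩

lemma tangentSpaceAt_piece {O : Set (P n)} (hO : IsOpen O) {h : PDual n} {X : HVec n}
    (hX : X ∈ cone (O ∩ hyperplane h)) :
    tangentSpaceAt (cone (O ∩ hyperplane h)) X = hyperplaneLin h := by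
  have hmem : ∀ Y, Y ∈ cone (O ∩ hyperplane h) ↔ Y ∈ cone O ∧ h.rep ⬝ᵥ Y = 0 := by
    intro Y
    conv_lhs => rw [← proj_rep h]
    exact mem_cone_piece h.rep_nonzero
  let f : HVec n →L[ℂ] (Fin 1 → ℂ) := ContinuousLinearMap.pi fun _ => dotL n h.rep
  have hs : Function.Surjective f := by
    obtain ⟨i, hi⟩ := Function.ne_iff.1 h.rep_nonzero
    have hi' : h.rep i ≠ 0 := hi
    intro y
    refine ⟨Pi.single i ((h.rep i)⁻¹ * y 0), ?_⟩
    ext j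
    rw [Subsingleton.elim j 0]
    change h.rep ⬝ᵥ _ = _
    rw [dotProduct_single, mul_inv_cancel_left₀ hi']
  rw [tangentSpaceAt_eq_ker hX (f.analyticAt X) (by rw [f.fderiv]; exact hs), f.fderiv]
  · ext Y
    rw [LinearMap.mem_ker]
    change (fun _ : Fin 1 => h.rep ⬝ᵥ Y) = 0 ↔ h.rep ⬝ᵥ Y = 0
    rw [funext_iff]
    simp
  · filter_upwards [(isOpen_iff_isOpen_cone.1 hO).mem_nhds ((hmem X).1 hX).1] with Y hY
    rw [hmem]
    change _ ↔ (fun _ : Fin 1 => h.rep ⬝ᵥ Y) = 0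
    rw [funext_iff]
    simp [hY]

/-- If a web is linear, then its leaves through a point of the base are the hyperplanes
belonging to the web at this point. -/
lemma IsWeb.eventually_mem_of_isLinear (hW : IsWeb M W d) (hlin : IsLinear M W) {X₀ u₀ : HVec n}
    (hz : (X₀, u₀) ∈ bicone W) (hreg : proj X₀ ∈ regularBase M W) :
    ∀ᶠ X in 𝓝 X₀, u₀ ⬝ᵥ X = 0 → (X, u₀) ∈ bicone W := by
  obtain ⟨hX₀, hu₀, hw⟩ := mem_bicone.1 hz
  obtain ⟨L, hL, hX₀L, hT, hLW⟩ := hW.exists_leaf hz hreg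
  obtain ⟨h, O, hO, rfl⟩ := hlin L hL
  have hX₀c : X₀ ∈ cone (O ∩ hyperplane h) := mem_cone.2 ⟨hX₀, hX₀L⟩
  -- The tangent hyperplane at `X₀` identifies the hyperplane containing the leaf.
  obtain rfl : h = proj u₀ := by
    rw [tangentSpaceAt_piece hO hX₀c] at hT
    exact hyperplaneLin_injective hT
  filter_upwards [(isOpen_iff_isOpen_cone.1 hO).mem_nhds ((mem_cone_piece hu₀).1 hX₀c).1] with X hX
  intro huX
  have hXc := (mem_cone_piece hu₀).2 ⟨hX, huX⟩
  -- At every other point of the leaf, the web contains its tangent hyperplane, which is again `proj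
  -- u₀`.
  obtain ⟨u, hu, hTu⟩ := hLW X hXc
  rw [tangentSpaceAt_piece hO hXc] at hTu
  obtain ⟨h1, h2, h3⟩ := mem_bicone.1 hu
  refine mem_bicone.2 ⟨h1, hu₀, ?_⟩
  rw [proj₂, hyperplaneLin_injective hTu]
  exact h3

/-- Over the regular part of the base of a linear web, the vectors `(Y, 0)` with `u ⬝ᵥ Y = 0` are
tangent to the web. -/
lemma IsWeb.mem_tangentSpaceAt_of_isLinear (hW : IsWeb M W d) (hlin : IsLinear M W)
    {X₀ u₀ : HVec n} (hz : (X₀, u₀) ∈ bicone W) (hreg : proj X₀ ∈ regularBase M W) {Y : HVec n}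
    (hY : u₀ ⬝ᵥ Y = 0) : (Y, 0) ∈ tangentSpaceAt (bicone W) (X₀, u₀) := by
  have hinc : u₀ ⬝ᵥ X₀ = 0 := hW.dotProduct_eq_zero hz
  -- The line `(X₀ + t Y, u₀)` moves the point inside the fixed hyperplane, hence inside the web for
  -- small `t`.
  apply mem_tangentSpaceAt_of_line
  have h1 : ContinuousAt (fun t : ℂ => X₀ + t • Y) 0 := by fun_prop
  have h2 : ∀ᶠ X in 𝓝 (X₀ + (0 : ℂ) • Y), u₀ ⬝ᵥ X = 0 → (X, u₀) ∈ bicone W := by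
    rw [zero_smul, add_zero]
    exact hW.eventually_mem_of_isLinear hlin hz hreg
  filter_upwards [h1.eventually h2] with t ht
  have h3 : (X₀, u₀) + t • (Y, (0 : HVec n)) = (X₀ + t • Y, u₀) := by simp
  rw [h3]
  exact ht (by rw [dotProduct_add, dotProduct_smul, hinc, hY]; simp)

end Leaf

/-! ### Irreducible components of a linear web -/

section Components

variable {n : ℕ} {M : Set (P n)} {W C : Set (P n × PDual n)} {d : ℕ}

/-- The connected components of the regular part are open in `W`. -/
lemma eventually_mem_connectedComponentIn {w : P n × PDual n} (hw : w ∈ regularPart W) :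
    ∀ᶠ w' in 𝓝 w, w' ∈ W → w' ∈ connectedComponentIn (regularPart W) w := by
  obtain ⟨hwW, k, hk⟩ := hw
  have hne := eventually_ne_ne (z := rep₂ w) w.1.rep_nonzero w.2.rep_nonzero
  obtain ⟨S, hS, hSc, hzS, hev⟩ := hk.exists_preconnected (hk.eventually.and hne)
  have himg : proj₂ '' S ⊆ connectedComponentIn (regularPart W) w := by
    refine IsPreconnected.subset_connectedComponentIn ?_ ⟨_, hzS, proj₂_rep₂ w⟩ ?_
    · refine hSc.image _ fun y hy => ?_
      obtain ⟨-, -, h1, h2⟩ := hS hy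
      exact (continuousAt_proj₂ h1 h2).continuousWithinAt
    · rintro _ ⟨y, hy, rfl⟩
      obtain ⟨hyW, h0, h1, h2⟩ := hS hy
      exact ⟨(mem_bicone.1 hyW).2.2, k, (isSubmanifoldAt_bicone_rep₂ h1 h2).2 (h0 hyW)⟩
  rw [nhds_eq_map_rep₂, eventually_map]
  filter_upwards [hev, hne] with y hy h hyW
  exact himg ⟨y, hy (mem_bicone.2 ⟨h.1, h.2, hyW⟩), rfl⟩

lemma eventually_mem_bicone_iff {A B : Set (P n × PDual n)} {z : HVec n × HVec n}
    (h₁ : z.1 ≠ 0) (h₂ : z.2 ≠ 0) (h : ∀ᶠ w in 𝓝 (proj₂ z), (w ∈ A ↔ w ∈ B)) :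
    ∀ᶠ y in 𝓝 z, (y ∈ bicone A ↔ y ∈ bicone B) := by
  filter_upwards [(continuousAt_proj₂ h₁ h₂).eventually h] with y hy
  rw [mem_bicone, mem_bicone, hy]

/-- The points over the regular part of the base near which `W` coincides with its irreducible
component `C` are dense in `C`. -/
lemma IsWeb.exists_mem_component (hM : IsOpen M) (hW : IsWeb M W d) (hC : IsComponent W C)
    {z : HVec n × HVec n} (hz : z ∈ bicone C) {N : Set (HVec n × HVec n)} (hN : N ∈ 𝓝 z) :
    ∃ y ∈ N, y ∈ bicone W ∧ proj y.1 ∈ regularBase M W ∧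
      ∀ᶠ x in 𝓝 y, (x ∈ bicone C ↔ x ∈ bicone W) := by
  obtain ⟨w₀, hw₀, rfl⟩ := hC
  obtain ⟨h₁, h₂, hzC⟩ := mem_bicone.1 hz
  obtain ⟨N', hN', hN'o, hzN'⟩ := mem_nhds_iff.1 (inter_mem hN (eventually_ne_ne h₁ h₂))
  have himg : proj₂ '' N' ∈ 𝓝 (proj₂ z) := by
    rw [nhds_proj₂ h₁ h₂]
    exact image_mem_map (hN'o.mem_nhds hzN')
  -- A nearby point in the connected component of the regular part that defines `C`. Around it `W`
  -- has no other points, so a further small move within `W` reaches the regular base without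
  -- leaving `C`.
  obtain ⟨_, ⟨y₁, hy₁, rfl⟩, hK⟩ := mem_closure_iff_nhds.1 hzC.2 _ himg
  have hKreg := connectedComponentIn_subset _ _ hK
  have hloc := eventually_mem_connectedComponentIn hKreg
  rw [← connectedComponentIn_eq hK] at hloc
  obtain ⟨h₃, h₄⟩ := (hN' hy₁).2
  have himg₁ : proj₂ '' N' ∈ 𝓝 (proj₂ y₁) := by
    rw [nhds_proj₂ h₃ h₄]
    exact image_mem_map (hN'o.mem_nhds hy₁)
  obtain ⟨_, ⟨⟨y, hy, rfl⟩, hyloc⟩, hyW, hyreg⟩ := hW.exists_mem_over_regularBase hM hKreg.1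
    (inter_mem himg₁ hloc.eventually_nhds)
  obtain ⟨h₅, h₆⟩ := (hN' hy).2
  refine ⟨y, (hN' hy).1, mem_bicone.2 ⟨h₅, h₆, hyW⟩, hyreg, eventually_mem_bicone_iff h₅ h₆ ?_⟩
  filter_upwards [hyloc] with w hw
  exact ⟨fun h => h.1, fun h => ⟨h, subset_closure (hw h)⟩⟩

/-- For a linear web, the vectors `(Y, 0)` with `u ⬝ᵥ Y = 0` are tangent to the irreducible
components at their regular points. -/
theorem IsWeb.eventually_mem_tangentSpaceAt_component (hM : IsOpen M) (hW : IsWeb M W d)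
    (hlin : IsLinear M W) (hC : IsComponent W C) {w : P n × PDual n} (hw : w ∈ regularPart C) :
    ∀ᶠ z in 𝓝 (rep₂ w), z ∈ bicone C →
      ∀ Y : HVec n, z.2 ⬝ᵥ Y = 0 → (Y, 0) ∈ tangentSpaceAt (bicone C) z := by
  obtain ⟨hwC, k, hk⟩ := hw
  obtain ⟨c, -, f, hf, -, hA⟩ := hk.exists_local
  have hgood := hf.eventually_analyticAt.and hA
  filter_upwards [hgood.eventually_nhds] with z hz hzC Y hY
  obtain ⟨hfz, -, hTz⟩ := hz.self_of_nhds
  obtain ⟨h₁, h₂, -⟩ := mem_bicone.1 hzC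
  rw [(hTz hzC).2]
  -- If `df` did not kill `(Y, 0)`, it would not kill the values of a continuous extension at points
  -- near `z`. Such points are found over the regular base, where the extension is tangent to `W`.
  by_contra hne
  obtain ⟨α, hα⟩ := exists_dual h₂
  obtain ⟨i, hi⟩ := Function.ne_iff.1 h₂
  have hi' : z.2 i ≠ 0 := hi
  let e : HVec n := Pi.single i 1
  have hze : z.2 ⬝ᵥ e ≠ 0 := by simpa [e] using hi'
  -- extension of `(Y, 0)` to a continuous section
  let V : HVec n × HVec n → HVec n × HVec n := fun y =>
    ((y.2 ⬝ᵥ e) • Y - (y.2 ⬝ᵥ Y) • e, 0)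
  have hVz : V z = (z.2 ⬝ᵥ e) • (Y, 0) := by simp [V, hY]
  have hVc : ContinuousAt V z := by
    have h1 : Continuous fun y : HVec n × HVec n =>
        (((dotL n).flip e y.2) • Y - ((dotL n).flip Y y.2) • e, (0 : HVec n)) := by fun_prop
    exact h1.continuousAt
  have hcont : ContinuousAt (fun y => fderiv ℂ f y (V y)) z :=
    hfz.fderiv.continuousAt.clm_apply hVc
  have hne' : fderiv ℂ f z (V z) ≠ 0 := by
    rw [hVz, map_smul]
    exact smul_ne_zero hze hne
  obtain ⟨y, ⟨hy1, hy2⟩, hyW, hyreg, hyC⟩ := hW.exists_mem_component hM hC hzC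
    (inter_mem (hcont.eventually_ne hne') hz)
  refine hy1 ?_
  have h5 := hW.mem_tangentSpaceAt_of_isLinear hlin (X₀ := y.1) (u₀ := y.2) hyW hyreg
    (Y := (y.2 ⬝ᵥ e) • Y - (y.2 ⬝ᵥ Y) • e) (by
      rw [dotProduct_sub, dotProduct_smul, dotProduct_smul, smul_eq_mul, smul_eq_mul]
      ring)
  rw [← tangentSpaceAt_congr hyC, (hy2.2.2 (hyC.self_of_nhds.2 hyW)).2] at h5
  exact h5

/-- A local frame of the tautological bundle. -/
lemma exists_frame {u₀ : HVec n} (hu₀ : u₀ ≠ 0) : ∃ Y : Fin n → HVec n → HVec n,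
    (∀ i, ContDiff ℂ ⊤ (Y i)) ∧ (∀ i u, u ⬝ᵥ Y i u = 0) ∧
      LinearIndependent ℂ (fun i => Y i u₀) := by
  obtain ⟨i, hi⟩ := Function.ne_iff.1 hu₀
  have hi' : u₀ i ≠ 0 := hi
  let e : HVec n := Pi.single i (u₀ i)⁻¹
  have he : u₀ ⬝ᵥ e = 1 := by simp [e, hi']
  have hsurj : Function.Surjective (dotL n u₀) := fun y => ⟨y • e, by
    rw [map_smul, dotL_apply, he, smul_eq_mul, mul_one]⟩
  have hrank : Module.finrank ℂ (dotL n u₀).ker = n := by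
    have h1 := LinearMap.finrank_range_add_finrank_ker (dotL n u₀).toLinearMap
    rw [LinearMap.range_eq_top.2 hsurj, finrank_top, Module.finrank_self,
      Module.finrank_fin_fun] at h1
    omega
  let b := Module.finBasisOfFinrankEq ℂ (dotL n u₀).ker hrank
  -- The field `(u ⬝ᵥ e) bᵢ - (u ⬝ᵥ bᵢ) e` is annihilated by every `u` and equals `bᵢ` at `u₀`.
  refine ⟨fun i u => (dotL n).flip e u • (b i : HVec n) - (dotL n).flip (b i : HVec n) u • e,
    fun i => by fun_prop, fun i u => ?_, ?_⟩
  · change u ⬝ᵥ ((u ⬝ᵥ e) • (b i : HVec n) - (u ⬝ᵥ (b i : HVec n)) • e) = 0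
    rw [dotProduct_sub, dotProduct_smul, dotProduct_smul, smul_eq_mul, smul_eq_mul]
    ring
  · have h1 : ∀ i, (dotL n).flip e u₀ • (b i : HVec n) - (dotL n).flip (b i : HVec n) u₀ • e =
        (b i : HVec n) := by
      intro i
      have h2 : (dotL n).flip e u₀ = 1 := he
      have h3 : (dotL n).flip (b i : HVec n) u₀ = 0 := (b i).2
      rw [h2, h3, one_smul, zero_smul, sub_zero]
    simp only [h1]
    exact b.linearIndependent.map' (Submodule.subtype _) (Submodule.ker_subtype _)

/-- The lift moves the point and keeps the hyperplane: the fields `(Y i u, 0)` are defined without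
reference to ramification. -/
lemma IsWeb.tautologicalExtends (hM : IsOpen M) (hW : IsWeb M W d) (hlin : IsLinear M W) :
    TautologicalExtends W := by
  intro C hC w hw
  obtain ⟨Y, hY, hYu, hYi⟩ := exists_frame w.2.rep_nonzero
  refine ⟨fun i z => (Y i z.2, 0), fun i => ?_, ?_⟩
  · have h1 : ContDiff ℂ ⊤ fun z : HVec n × HVec n => (Y i z.2, (0 : HVec n)) :=
      ((hY i).comp contDiff_snd).prodMk contDiff_const
    exact h1.contDiffAt.analyticAt
  · have hc : Continuous fun (z : HVec n × HVec n) i => Y i z.2 :=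
      continuous_pi fun i => (hY i).continuous.comp continuous_snd
    have hli := hc.continuousAt.preimage_mem_nhds
      (x := rep₂ w) (isOpen_setOfPred_linearIndependent.mem_nhds hYi)
    filter_upwards [hW.eventually_mem_tangentSpaceAt_component hM hlin hC hw, hli] with z h1 h2 hzC
    exact ⟨fun i => ⟨h1 hzC _ (hYu i _), hYu i _⟩, h2⟩

/-- The scaling field `(0, u)` is added to the `n` lifts. The other scaling `(X, 0)` is already in
their span, since `u ⬝ᵥ X = 0` on the web. -/
lemma IsWeb.isDicritical (hM : IsOpen M) (hW : IsWeb M W d) (hlin : IsLinear M W) :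
    IsDicritical W := by
  intro C hC w hw
  obtain ⟨Y, hY, hYu, hYi⟩ := exists_frame w.2.rep_nonzero
  let V : Fin (n + 1) → HVec n × HVec n → HVec n × HVec n := fun i z =>
    (Fin.cons (0, z.2) (fun j => (Y j z.2, 0)) : Fin (n + 1) → HVec n × HVec n) i
  have hV : ∀ i, ContDiff ℂ ⊤ (V i) := by
    intro i
    refine Fin.cases ?_ (fun j => ?_) i
    · exact contDiff_const.prodMk contDiff_snd
    · exact ((hY j).comp contDiff_snd).prodMk contDiff_const
  have hVi : LinearIndependent ℂ (fun i => V i (rep₂ w)) := by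
    change LinearIndependent ℂ (Fin.cons (0, w.2.rep) (fun j => (Y j w.2.rep, 0)) :
      Fin (n + 1) → HVec n × HVec n)
    rw [linearIndependent_finCons]
    refine ⟨hYi.map' (LinearMap.inl ℂ (HVec n) (HVec n)) (LinearMap.ker_eq_bot.2 LinearMap.inl_injective),
      fun hmem => ?_⟩
    have hle : Submodule.span ℂ (range fun j => (Y j w.2.rep, (0 : HVec n))) ≤
        (LinearMap.snd ℂ (HVec n) (HVec n)).ker := by
      rw [Submodule.span_le]
      rintro _ ⟨j, rfl⟩
      rfl
    exact w.2.rep_nonzero (hle hmem)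
  refine ⟨V, fun i => (hV i).contDiffAt.analyticAt, ?_⟩
  have hc : Continuous fun z i => V i z := continuous_pi fun i => (hV i).continuous
  have hli := hc.continuousAt.preimage_mem_nhds
    (x := rep₂ w) (isOpen_setOfPred_linearIndependent.mem_nhds hVi)
  filter_upwards [hW.eventually_mem_tangentSpaceAt_component hM hlin hC hw, hli] with z h1 h2 hzC
  refine ⟨fun i => ?_, h2⟩
  refine Fin.cases ?_ (fun j => ?_) i
  · refine ⟨?_, dotProduct_zero _⟩
    have := smul_mem_tangentSpaceAt_bicone hzC 0 1
    rwa [zero_smul, one_smul] at this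
  · exact ⟨h1 hzC _ (hYu j _), hYu j _⟩

end Components

/-! ### Affine charts -/

section AffineChart

variable {n : ℕ}

/-- The affine coordinates where `X i ≠ 0`. -/
noncomputable def affineCoord (i : Fin (n + 1)) (X : HVec n) : Fin n → ℂ :=
  fun j => X (i.succAbove j) / X i

lemma affineCoord_smul (i : Fin (n + 1)) {a : ℂ} (ha : a ≠ 0) (X : HVec n) :
    affineCoord i (a • X) = affineCoord i X := by
  ext j
  exact mul_div_mul_left _ _ ha

lemma affineCoord_rep (i : Fin (n + 1)) {X : HVec n} (hX : X ≠ 0) :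
    affineCoord i (proj X).rep = affineCoord i X := by
  obtain ⟨a, ha, h⟩ := exists_rep_smul hX
  rw [h, affineCoord_smul i ha]

/-- Homogeneous coordinates of the point with the affine coordinates `y`. -/
def affinePoint (i : Fin (n + 1)) (y : Fin n → ℂ) : HVec n := i.insertNth (1 : ℂ) y

lemma affinePoint_apply_self (i : Fin (n + 1)) (y : Fin n → ℂ) : affinePoint i y i = 1 :=
  Fin.insertNth_apply_same (α := fun _ => ℂ) i 1 y

lemma affinePoint_apply_succAbove (i : Fin (n + 1)) (y : Fin n → ℂ) (j : Fin n) :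
    affinePoint i y (i.succAbove j) = y j :=
  Fin.insertNth_apply_succAbove (α := fun _ => ℂ) i 1 y j

lemma affinePoint_ne_zero (i : Fin (n + 1)) (y : Fin n → ℂ) : affinePoint i y ≠ 0 := fun h =>
  one_ne_zero (α := ℂ) (by rw [← affinePoint_apply_self i y, h, Pi.zero_apply])

lemma affineCoord_affinePoint (i : Fin (n + 1)) (y : Fin n → ℂ) :
    affineCoord i (affinePoint i y) = y := by
  ext j
  rw [affineCoord, affinePoint_apply_self, affinePoint_apply_succAbove, div_one]

lemma affinePoint_affineCoord (i : Fin (n + 1)) {X : HVec n} (hX : X i ≠ 0) :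
    affinePoint i (affineCoord i X) = (X i)⁻¹ • X := by
  ext k
  refine Fin.succAboveCases i ?_ (fun j => ?_) k
  · rw [affinePoint_apply_self, Pi.smul_apply, smul_eq_mul, inv_mul_cancel₀ hX]
  · rw [affinePoint_apply_succAbove, affineCoord, Pi.smul_apply, smul_eq_mul, div_eq_inv_mul]

lemma proj_affinePoint_affineCoord (i : Fin (n + 1)) {X : HVec n} (hX : X i ≠ 0) :
    proj (affinePoint i (affineCoord i X)) = proj X := by
  rw [affinePoint_affineCoord i hX, proj_smul (inv_ne_zero hX)]

lemma contDiff_affinePoint (i : Fin (n + 1)) : ContDiff ℂ ⊤ (affinePoint i) := by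
  rw [contDiff_pi]
  intro k
  refine Fin.succAboveCases i ?_ (fun j => ?_) k
  · simp only [affinePoint_apply_self]
    exact contDiff_const
  · simp only [affinePoint_apply_succAbove]
    fun_prop

lemma contDiffAt_affineCoord (i : Fin (n + 1)) {X : HVec n} (hX : X i ≠ 0) :
    ContDiffAt ℂ ⊤ (affineCoord i) X := by
  rw [contDiffAt_pi]
  intro j
  unfold affineCoord
  fun_prop (disch := assumption)

lemma rep_apply_ne_zero_iff (i : Fin (n + 1)) {X : HVec n} (hX : X ≠ 0) :
    (proj X).rep i ≠ 0 ↔ X i ≠ 0 := by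
  obtain ⟨a, ha, h⟩ := exists_rep_smul hX
  rw [h, Pi.smul_apply, smul_ne_zero_iff, and_iff_right ha]

/-- The affine chart `X i ≠ 0`, restricted to an open set `M`. -/
noncomputable def affineChart (i : Fin (n + 1)) {M : Set (P n)} (hM : IsOpen M) :
    OpenPartialHomeomorph (P n) (Fin n → ℂ) where
  toFun m := affineCoord i m.rep
  invFun y := proj (affinePoint i y)
  source := {m | m ∈ M ∧ m.rep i ≠ 0}
  target := {y | proj (affinePoint i y) ∈ M}
  map_source' := by
    rintro m ⟨h1, h2⟩
    change proj _ ∈ M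
    rwa [proj_affinePoint_affineCoord i h2, proj_rep]
  map_target' := by
    intro y hy
    refine ⟨hy, (rep_apply_ne_zero_iff i (affinePoint_ne_zero i y)).2 ?_⟩
    rw [affinePoint_apply_self]
    exact one_ne_zero
  left_inv' := by
    rintro m ⟨h1, h2⟩
    rw [proj_affinePoint_affineCoord i h2, proj_rep]
  right_inv' := by
    intro y _
    rw [affineCoord_rep i (affinePoint_ne_zero i y), affineCoord_affinePoint]
  open_source := by
    have h1 : cone {m : P n | m.rep i ≠ 0} = {X | X i ≠ 0} := by
      ext X
      rw [mem_cone]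
      constructor
      · exact fun ⟨h1, h2⟩ => (rep_apply_ne_zero_iff i h1).1 h2
      · intro h1
        have h0 : X ≠ 0 := fun h => h1 (by rw [h, Pi.zero_apply])
        exact ⟨h0, (rep_apply_ne_zero_iff i h0).2 h1⟩
    have h2 : IsOpen {m : P n | m.rep i ≠ 0} := by
      rw [isOpen_iff_isOpen_cone, h1]
      exact isOpen_ne_fun (continuous_apply i) continuous_const
    exact hM.inter h2
  open_target := by
    rw [isOpen_iff_mem_nhds]
    intro y hy
    exact ((continuousAt_proj (affinePoint_ne_zero i y)).comp
      (contDiff_affinePoint i).continuous.continuousAt).preimage_mem_nhds (hM.mem_nhds hy)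
  continuousOn_toFun := by
    rintro m ⟨-, h⟩
    refine ContinuousAt.continuousWithinAt ?_
    rw [ContinuousAt, nhds_eq_map_rep m, tendsto_map'_iff]
    refine (contDiffAt_affineCoord i h).continuousAt.tendsto.congr' ?_
    filter_upwards [isOpen_ne.mem_nhds m.rep_nonzero] with X hX
    exact (affineCoord_rep i hX).symm
  continuousOn_invFun := fun y _ => ((continuousAt_proj (affinePoint_ne_zero i y)).comp
    (contDiff_affinePoint i).continuous.continuousAt).continuousWithinAt

lemma isHolomorphicChart_affineChart (i : Fin (n + 1)) {M : Set (P n)} (hM : IsOpen M) :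
    IsHolomorphicChart (affineChart i hM) := by
  constructor
  · intro X hX
    obtain ⟨h1, -, h2⟩ := mem_cone.1 hX
    have h3 := (rep_apply_ne_zero_iff i h1).1 h2
    refine ⟨affineCoord i, (contDiffAt_affineCoord i h3).analyticAt,
      Eventually.of_forall fun Y hY => ?_⟩
    rw [← proj_of_ne hY]
    exact affineCoord_rep i hY
  · intro y _
    exact ⟨affinePoint i, (contDiff_affinePoint i).contDiffAt.analyticAt,
      Eventually.of_forall fun t => ⟨affinePoint_ne_zero i t, proj_of_ne _⟩⟩

lemma dotProduct_eq_affineCoord (i : Fin (n + 1)) (u : HVec n) {X : HVec n} (hX : X i ≠ 0) :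
    u ⬝ᵥ X = X i * (u i + (fun j => u (i.succAbove j)) ⬝ᵥ affineCoord i X) := by
  simp only [dotProduct, affineCoord]
  rw [Fin.sum_univ_succAbove _ i, mul_add, Finset.mul_sum, mul_comm (u i)]
  congr 1
  refine Finset.sum_congr rfl fun j _ => ?_
  field_simp

/-- The linear equation is divided by the coordinate `X i`. A point of `L` in the chart excludes the
hyperplane `X i = 0`, the only one whose affine equation would have zero linear part. -/
lemma IsPieceOf.hasAffineEquation {i : Fin (n + 1)} {M : Set (P n)} (hM : IsOpen M) {L : Set (P n)}
    {h : PDual n} (hL : IsPieceOf L h) (hne : L.Nonempty) (hsub : L ⊆ (affineChart i hM).source) :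
    HasAffineEquation (affineChart i hM) L := by
  obtain ⟨O, hO, rfl⟩ := hL
  have hmem : ∀ m : P n, m.rep i ≠ 0 → (m ∈ hyperplane h ↔
      (fun j => h.rep (i.succAbove j)) ⬝ᵥ affineCoord i m.rep = - h.rep i) := by
    intro m hm
    rw [← proj_rep m, ← proj_rep h, mem_hyperplane m.rep_nonzero h.rep_nonzero,
      dotProduct_eq_affineCoord i _ hm, mul_eq_zero, or_iff_right hm, proj_rep, proj_rep,
      add_comm, add_eq_zero_iff_eq_neg]
  refine ⟨fun j => h.rep (i.succAbove j), - h.rep i, fun h0 => ?_,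
    O ∩ (affineChart i hM).source, hO.inter (affineChart i hM).open_source, inter_subset_right, ?_⟩
  · obtain ⟨m, hm⟩ := hne
    have h1 := (hmem m (hsub hm).2).1 hm.2
    rw [h0, zero_dotProduct, eq_comm, neg_eq_zero] at h1
    refine h.rep_nonzero (funext fun k => ?_)
    refine Fin.succAboveCases i h1 (fun j => ?_) k
    exact congrFun h0 j
  · ext m
    constructor
    · exact fun hm => ⟨⟨hm.1, hsub hm⟩, (hmem m (hsub hm).2).1 hm.2⟩
    · exact fun hm => ⟨hm.1.1, (hmem m hm.1.2.2).2 hm.2⟩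

/-- Any affine chart around the point serves all leaves at once; leaves are nonempty because they
meet the regular base. -/
lemma IsLinear.isTotallyLinearizable {M : Set (P n)} {W : Set (P n × PDual n)} (hM : IsOpen M)
    (hlin : IsLinear M W) : IsTotallyLinearizable M W := by
  intro m hm
  obtain ⟨i, hi⟩ := Function.ne_iff.1 m.rep_nonzero
  refine ⟨affineChart i hM, isHolomorphicChart_affineChart i hM, ⟨hm, hi⟩, fun _ h => h.1, ?_⟩
  intro L hL hsub
  obtain ⟨h, hh⟩ := hlin L hL
  exact hh.hasAffineEquation hM (hL.meets_regular.mono inter_subset_left) hsub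

end AffineChart

end ProjWeb

theorem proposition7p1 (n : ℕ) (hn : 1 ≤ n) :
    (∀ (M : Set (ProjWeb.P n)) (W : Set (ProjWeb.P n × ProjWeb.PDual n)) (d : ℕ),
      IsOpen M → ProjWeb.IsWeb M W d → ProjWeb.IsLinear M W →
        ProjWeb.IsTotallyLinearizable M W ∧ ProjWeb.IsDicritical W ∧
          ProjWeb.TautologicalExtends W) ∧
    (∀ (W : Set (ProjWeb.P n × ProjWeb.PDual n)) (d : ℕ),
      ProjWeb.IsWeb Set.univ W d → ProjWeb.IsAlgebraicWeb W d →
        ProjWeb.IsLinear Set.univ W ∧ ProjWeb.IsTotallyLinearizable Set.univ W ∧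
          ProjWeb.IsDicritical W ∧ ProjWeb.TautologicalExtends W) := by
  have main : ∀ (M : Set (ProjWeb.P n)) (W : Set (ProjWeb.P n × ProjWeb.PDual n)) (d : ℕ),
      IsOpen M → ProjWeb.IsWeb M W d → ProjWeb.IsLinear M W →
        ProjWeb.IsTotallyLinearizable M W ∧ ProjWeb.IsDicritical W ∧
          ProjWeb.TautologicalExtends W := fun M W d hM hW hlin =>
    ⟨hlin.isTotallyLinearizable hM, hW.isDicritical hM hlin, hW.tautologicalExtends hM hlin⟩
  refine ⟨main, fun W d hW halg => ?_⟩
  have hlin : ProjWeb.IsLinear Set.univ W := fun L hL => by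
    obtain ⟨S, -, h, -⟩ := halg
    obtain ⟨k, -, hk⟩ := h L hL
    exact ⟨k, hk⟩
  exact ⟨hlin, main _ W d isOpen_univ hW hlin⟩
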